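/- Let $M$ be a smooth (Hausdorff, finite-dimensional, without boundary) manifold of dimension at least $2$ and let $p\in M$. A path $[0,1]\to M$ is piecewise smooth if it is continuous and $[0,1]$ has a finite partition such that the path is smooth on each closed piece (one-sidedly at the end points); $\Omega^{\mathrm{ps}}(M,p)$ denotes the set of piecewise-smooth loops $[0,1]\to M$ based at $p$. For composable paths, $\gamma'\cdot\gamma$ is the concatenation that runs first through $\gamma$ and then through $\gamma'$, and $\gamma^{-1}(t)=\gamma(1-t)$. - A *thin homotopy* between $\gamma_0,\gamma_1\in\Omega^{\mathrm{ps}}(M,p)$ is a continuous map $\eta:[0,1]^2\to M$ such that $\eta(s,\cdot)\in\Omega^{\mathrm{ps}}(M,p)$ for every $s\in[0,1]$, $\eta(0,\cdot)=\gamma_0$, $\eta(1,\cdot)=\gamma_1$, the restriction of $\eta$ to every closed polygon of some finite polygonal paving of $[0,1]^2$ is smooth, and $\eta([0,1]^2)\subseteq\gamma_0([0,1])\cup\gamma_1([0,1])$. Two loops are *thin equivalent*, $\gamma\sim_{\mathrm{thin}}\gamma'$, if they are related by finitely many thin homotopies. - A *generalized reparametrization* of $\gamma\in\Omega^{\mathrm{ps}}(M,p)$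 is a loop in $\Omega^{\mathrm{ps}}(M,p)$ of the form $\gamma\circ\phi$, where $\phi:[0,1]\to[0,1]$ is continuous and piecewise smooth (not necessarily monotone) with $\phi(0)=0$ and $\phi(1)=1$. A *retracing* relates a loop $\alpha_2\cdot\alpha_1$ to $\alpha_2\cdot\beta^{-1}\cdot\beta\cdot\alpha_1$, where $\alpha_1,\alpha_2,\beta$ are piecewise-smooth paths in $M$ with $\alpha_1(0)=\alpha_2(1)=p$ and $\alpha_1(1)=\alpha_2(0)=\beta(0)$. Two loops are *retrace equivalent*, $\gamma\sim_{\mathrm{ret}}\gamma'$, if they are related by finitely many retracings and generalized reparametrizations, each used in either direction. Then: 1. For every $\gamma\in\Omega^{\mathrm{ps}}(M,p)$ there is $\gamma'\in\Omega^{\mathrm{ps}}(M,p)$ such that $\gamma\sim_{\mathrm{thin}}\gamma'$ but $\gamma\not\sim_{\mathrm{ret}}\gamma'$. 2. For every $\gamma\in\Omega^{\mathrm{ps}}(M,p)$ the class $[\gamma]_{\mathrm{ret}}$ is a proper subset of the class $[\gamma]_{\mathrm{thin}}$. 3. Concatenation and inversion of loops induce group structures on $\mathcal L^{\mathrm{ret}}(M,p)=\Omega^{\mathrm{ps}}(M,p)/\!\sim_{\mathrm{ret}}$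 and $\mathcal L^{\mathrm{thin}}(M,p)=\Omega^{\mathrm{ps}}(M,p)/\!\sim_{\mathrm{thin}}$, the map $[\gamma]_{\mathrm{ret}}\mapsto[\gamma]_{\mathrm{thin}}$ is a well-defined group epimorphism $\mathcal L^{\mathrm{ret}}(M,p)\to\mathcal L^{\mathrm{thin}}(M,p)$, and it is not injective; in particular it is not an isomorphism. -/

import Mathlib

open Set
open scoped Manifold ContDiff unitInterval

namespace ThinLoops

section Paths

variable {E H : Type*} [NormedAddCommGroup E] [NormedSpace ℝ E] [TopologicalSpace H]
  {X : Type*} [TopologicalSpace X] [ChartedSpace H X]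

/-- A continuous path is piecewise smooth if there are finitely many break points such that the
path is smooth (one-sidedly at the end points) on every closed subinterval of `[0,1]` without
break points in its interior. Equivalently, it is smooth on each of the closed pieces of some
finite partition of `[0,1]`. -/
def IsPiecewiseSmooth (J : ModelWithCorners ℝ E H) {x y : X} (γ : Path x y) : Prop :=
  ∃ T : Finset ℝ, ∀ a b : ℝ, 0 ≤ a → a < b → b ≤ 1 → (∀ t ∈ T, t ∉ Ioo a b) →
    ContMDiffOn 𝓘(ℝ, ℝ) J ∞ γ.extend (Icc a b)

variable {J : ModelWithCorners ℝ E H}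

theorem IsPiecewiseSmooth.refl (x : X) : IsPiecewiseSmooth J (Path.refl x) := by
  refine ⟨∅, fun a b _ _ _ _ => ?_⟩
  rw [Path.refl_extend]
  exact contMDiffOn_const

theorem IsPiecewiseSmooth.symm {x y : X} {γ : Path x y} (h : IsPiecewiseSmooth J γ) :
    IsPiecewiseSmooth J γ.symm := by
  obtain ⟨T, hT⟩ := h
  refine ⟨T.image (fun t => 1 - t), fun a b ha hab hb hn => ?_⟩
  have h1 := hT (1 - b) (1 - a) (by linarith) (by linarith) (by linarith) (fun t ht hm =>
    hn (1 - t) (Finset.mem_image_of_mem _ ht) ⟨by linarith [hm.2], by linarith [hm.1]⟩)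
  have h2 : ContMDiffOn 𝓘(ℝ, ℝ) 𝓘(ℝ, ℝ) ∞ (fun t : ℝ => 1 - t) (Icc a b) :=
    (contDiff_const.sub contDiff_id).contMDiff.contMDiffOn
  rw [Path.extend_symm]
  exact h1.comp h2 (fun t ht => ⟨by linarith [ht.2], by linarith [ht.1]⟩)

theorem IsPiecewiseSmooth.trans {x y z : X} {γ : Path x y} {γ' : Path y z}
    (h : IsPiecewiseSmooth J γ) (h' : IsPiecewiseSmooth J γ') :
    IsPiecewiseSmooth J (γ.trans γ') := by
  obtain ⟨T, hT⟩ := h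
  obtain ⟨T', hT'⟩ := h'
  refine ⟨insert (1 / 2) (T.image (fun t => t / 2) ∪ T'.image (fun t => (t + 1) / 2)),
    fun a b ha hab hb hn => ?_⟩
  have hhalf := hn (1 / 2) (Finset.mem_insert_self _ _)
  rcases le_or_gt b (1 / 2) with hb2 | hb2
  · have h1 := hT (2 * a) (2 * b) (by linarith) (by linarith) (by linarith) (fun t ht hm =>
      hn (t / 2) (Finset.mem_insert_of_mem (Finset.mem_union_left _
        (Finset.mem_image_of_mem _ ht))) ⟨by linarith [hm.1], by linarith [hm.2]⟩)
    have h2 : ContMDiffOn 𝓘(ℝ, ℝ) 𝓘(ℝ, ℝ) ∞ (fun t : ℝ => 2 * t) (Icc a b) :=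
      (contDiff_const.mul contDiff_id).contMDiff.contMDiffOn
    refine (h1.comp h2 (fun t ht => ⟨by linarith [ht.1], by linarith [ht.2]⟩)).congr ?_
    intro t ht
    exact Path.extend_trans_of_le_half _ _ (ht.2.trans hb2)
  · have ha2 : 1 / 2 ≤ a := by
      by_contra hlt
      exact hhalf ⟨not_le.mp hlt, hb2⟩
    have h1 := hT' (2 * a - 1) (2 * b - 1) (by linarith) (by linarith) (by linarith)
      (fun t ht hm =>
      hn ((t + 1) / 2) (Finset.mem_insert_of_mem (Finset.mem_union_right _
        (Finset.mem_image_of_mem _ ht))) ⟨by linarith [hm.1], by linarith [hm.2]⟩)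
    have h2 : ContMDiffOn 𝓘(ℝ, ℝ) 𝓘(ℝ, ℝ) ∞ (fun t : ℝ => 2 * t - 1) (Icc a b) :=
      ((contDiff_const.mul contDiff_id).sub contDiff_const).contMDiff.contMDiffOn
    refine (h1.comp h2 (fun t ht => ⟨by linarith [ht.1], by linarith [ht.2]⟩)).congr ?_
    intro t ht
    exact Path.extend_trans_of_half_le _ _ (ha2.trans ht.1)

end Paths

/-- A polygonal paving of the unit square: finitely many (convex) polygons with nonempty, pairwise
disjoint interiors whose union is `[0,1]²`. -/
def IsPolygonalPaving (P : Finset (Set (ℝ × ℝ))) : Prop :=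
  (∀ K ∈ P, (∃ V : Finset (ℝ × ℝ), K = convexHull ℝ (V : Set (ℝ × ℝ))) ∧
    (interior K).Nonempty) ∧
  (∀ K ∈ P, ∀ L ∈ P, K ≠ L → Disjoint (interior K) (interior L)) ∧
  (⋃ K ∈ P, K) = Icc (0 : ℝ) 1 ×ˢ Icc (0 : ℝ) 1

section Loops

variable {n : ℕ} {M : Type*} [TopologicalSpace M] [ChartedSpace (EuclideanSpace ℝ (Fin n)) M]

/-- The set `Ω^ps(M,p)` of piecewise-smooth loops in the `n`-manifold `M` based at `p`. -/
def PSLoop (n : ℕ) {M : Type*} [TopologicalSpace M]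
    [ChartedSpace (EuclideanSpace ℝ (Fin n)) M] (p : M) : Type _ :=
  {γ : Path p p // IsPiecewiseSmooth (𝓡 n) γ}

/-- Concatenation of loops: first `γ`, then `γ'`, each at double speed. -/
noncomputable def PSLoop.trans {p : M} (γ γ' : PSLoop n p) : PSLoop n p :=
  ⟨γ.1.trans γ'.1, γ.2.trans γ'.2⟩

/-- The reversed loop `t ↦ γ (1 - t)`. -/
def PSLoop.symm {p : M} (γ : PSLoop n p) : PSLoop n p :=
  ⟨γ.1.symm, γ.2.symm⟩

/-- A thin homotopy `η (s, t)`: a homotopy of based loops through piecewise-smooth loops, smooth on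
every closed polygon of some polygonal paving of `[0,1]²`, with image contained in the union
of the images of its two ends. -/
def ThinHomotopic {p : M} (γ₀ γ₁ : PSLoop n p) : Prop :=
  ∃ η : Path.Homotopy γ₀.1 γ₁.1,
    (∀ s : I, IsPiecewiseSmooth (𝓡 n) (η.eval s)) ∧
    (∃ P : Finset (Set (ℝ × ℝ)), IsPolygonalPaving P ∧ ∀ K ∈ P,
      ContMDiffOn 𝓘(ℝ, ℝ × ℝ) (𝓡 n) ∞
        (fun z : ℝ × ℝ =>
          η (projIcc (0 : ℝ) 1 zero_le_one z.1, projIcc (0 : ℝ) 1 zero_le_one z.2)) K) ∧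
    range η ⊆ range γ₀.1 ∪ range γ₁.1

/-- Thin equivalence: being related by finitely many thin homotopies. -/
def thinSetoid (n : ℕ) {M : Type*} [TopologicalSpace M]
    [ChartedSpace (EuclideanSpace ℝ (Fin n)) M] (p : M) : Setoid (PSLoop n p) :=
  Relation.EqvGen.setoid ThinHomotopic

/-- `γ'` is a generalized reparametrization of `γ`: `γ' = γ ∘ φ` for a continuous piecewise-smooth
(not necessarily monotone) `φ : [0,1] → [0,1]` with `φ 0 = 0` and `φ 1 = 1`. -/
def IsReparametrization {p : M} (γ γ' : PSLoop n p) : Prop :=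
  ∃ φ : Path (0 : ℝ) 1, IsPiecewiseSmooth 𝓘(ℝ, ℝ) φ ∧ ∃ hφ : ∀ t, φ t ∈ Icc (0 : ℝ) 1,
    ∀ t : I, γ'.1 t = γ.1 ⟨φ t, hφ t⟩

/-- `γ'` arises from `γ` by inserting a retracing: `γ` runs through `α₁` and then `α₂`, whereas
`γ'` runs through `α₁`, `β`, the reversed path of `β`, and `α₂`. -/
def IsRetracing {p : M} (γ γ' : PSLoop n p) : Prop :=
  ∃ (x y : M) (α₁ : Path p x) (β : Path x y) (α₂ : Path x p),
    IsPiecewiseSmooth (𝓡 n) α₁ ∧ IsPiecewiseSmooth (𝓡 n) β ∧ IsPiecewiseSmooth (𝓡 n) α₂ ∧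
    γ.1 = α₁.trans α₂ ∧ γ'.1 = α₁.trans ((β.trans β.symm).trans α₂)

/-- Retrace equivalence: being related by finitely many retracings and generalized
reparametrizations, in either direction. -/
def retraceSetoid (n : ℕ) {M : Type*} [TopologicalSpace M]
    [ChartedSpace (EuclideanSpace ℝ (Fin n)) M] (p : M) : Setoid (PSLoop n p) :=
  Relation.EqvGen.setoid (fun γ γ' => IsReparametrization γ γ' ∨ IsRetracing γ γ')

/-- The set of classes `Ω^ps(M,p) / ∼_thin`. -/
abbrev LThin (n : ℕ) {M : Type*} [TopologicalSpace M]
    [ChartedSpace (EuclideanSpace ℝ (Fin n)) M] (p : M) : Type _ :=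
  Quotient (thinSetoid n p)

/-- The set of classes `Ω^ps(M,p) / ∼_ret`. -/
abbrev LRet (n : ℕ) {M : Type*} [TopologicalSpace M]
    [ChartedSpace (EuclideanSpace ℝ (Fin n)) M] (p : M) : Type _ :=
  Quotient (retraceSetoid n p)

/-- The class of a loop up to thin equivalence. -/
def thinClass {p : M} (γ : PSLoop n p) : LThin n p := Quotient.mk (thinSetoid n p) γ

/-- The class of a loop up to retrace equivalence. -/
def retraceClass {p : M} (γ : PSLoop n p) : LRet n p := Quotient.mk (retraceSetoid n p) γ

end Loops

end ThinLoops

open ThinLoops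

/-! The loop that separates the two relations is a comb. It runs out along an interval with an
infinite sequence of teeth accumulating at the base point, going up and down each tooth, and then
returns along the interval without visiting the teeth. The heights are chosen so that the whole loop
is smooth. Scaling all heights to zero at once, and then the base interval, is a composite of two
thin homotopies to the constant loop. A retracing, however, has a single base point and a single
turning point, so finitely many moves should only remove finitely many teeth (`combLoop_thin`,
`combLoop_not_retrace`).

To make this precise despite non-monotone reparametrizations, count modulo two. For two points `l`,
`r` outside a set `B`, count the passages between `l` and `r` through `B` that meet a set `Q`. The
parity is unchanged by generalized reparametrization (`crossingParity_comp`): the passages of `f ∘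
φ` lie over those of `f`, and each fibre is odd, because it counts how often a real function crosses
an interval whose opposite sides contain its end values. The parity is additive under concatenation
at a point outside `B` and unchanged by reversal, so a retracing changes it by twice the
contribution of `β`, provided its two points avoid `B`. For pairwise disjoint sets `B k`, the
parities of retrace equivalent loops agree for all but finitely many `k`
(`eventually_pathParity_eq`). The comb has parity one for every `k`, the constant loop parity zero.

The other half is that retrace equivalence implies thin equivalence. The obstacle is a
reparametrization `γ ∘ φ` of a loop with break points: in the linear homotopy from the identity to
`φ`, the preimages of the breaks need not be polygonal. Each break is therefore removed first by a
thin homotopy that brings the loop to rest there. Smoothness of that homotopy composed with `φ` is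
the analytic core (`contDiffWithinAt_comp_mul`), proved by Hadamard factorization of the jump
between the two smooth branches.

Both quotients are groups by one argument for loop congruences. Multiplying an arbitrary `γ` by the
comb loop and cancelling in the retrace group gives the first claim for every `γ`; the other claims
follow. -/

namespace ThinLoops

/-! ### Parity of crossings and its invariance under change of parameter. -/

section Crossings

variable {X : Type*}

/-- The passages of `f` on `[a, b]` between the points `l` and `r` through the set `B`, in either
direction, that meet `Q` on the way. -/
def crossings (B Q : Set X) (l r : X) (f : ℝ → X) (a b : ℝ) : Set (ℝ × ℝ) :=
  {w | a ≤ w.1 ∧ w.1 < w.2 ∧ w.2 ≤ b ∧ (f w.1 = l ∧ f w.2 = r ∨ f w.1 = r ∧ f w.2 = l) ∧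
    (∀ t ∈ Ioo w.1 w.2, f t ∈ B) ∧ ∃ t ∈ Ioo w.1 w.2, f t ∈ Q}

variable {B Q : Set X} {l r : X} {f : ℝ → X} {a b : ℝ}

theorem crossings_fst_notMem (hl : l ∉ B) (hr : r ∉ B) {w : ℝ × ℝ}
    (hw : w ∈ crossings B Q l r f a b) : f w.1 ∉ B := by
  rcases hw.2.2.2.1 with h | h <;> rw [h.1] <;> assumption

theorem crossings_snd_notMem (hl : l ∉ B) (hr : r ∉ B) {w : ℝ × ℝ}
    (hw : w ∈ crossings B Q l r f a b) : f w.2 ∉ B := by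
  rcases hw.2.2.2.1 with h | h <;> rw [h.2] <;> assumption

/-- If one passage began or ended strictly inside the other, its end point, which is `l` or `r`,
would have to lie in `B`. -/
theorem crossings_eq_of_overlap (hl : l ∉ B) (hr : r ∉ B) {w w' : ℝ × ℝ}
    (hw : w ∈ crossings B Q l r f a b) (hw' : w' ∈ crossings B Q l r f a b)
    (h1 : w.1 < w'.2) (h2 : w'.1 < w.2) : w = w' := by
  have e1 : w.1 = w'.1 := by
    rcases lt_trichotomy w.1 w'.1 with h | h | h
    · exact absurd (hw.2.2.2.2.1 _ ⟨h, h2⟩) (crossings_fst_notMem hl hr hw')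
    · exact h
    · exact absurd (hw'.2.2.2.2.1 _ ⟨h, h1⟩) (crossings_fst_notMem hl hr hw)
  have e2 : w.2 = w'.2 := by
    rcases lt_trichotomy w.2 w'.2 with h | h | h
    · exact absurd (hw'.2.2.2.2.1 _ ⟨h2, h⟩) (crossings_snd_notMem hl hr hw)
    · exact h
    · exact absurd (hw.2.2.2.2.1 _ ⟨h1, h⟩) (crossings_snd_notMem hl hr hw')
  exact Prod.ext e1 e2

/-- The times at `l` and the times at `r` form disjoint compact sets, so every passage has length at
least some `δ > 0`. Two passages whose starting times have the same integer part in units of `δ`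
overlap and hence coincide. -/
theorem crossings_finite [TopologicalSpace X] [T1Space X] (hl : l ∉ B) (hr : r ∉ B) (hlr : l ≠ r)
    (hf : ContinuousOn f (Icc a b)) : (crossings B Q l r f a b).Finite := by
  obtain ⟨δ, hδ, hball⟩ : ∃ δ > 0, ∀ w ∈ crossings B Q l r f a b, δ ≤ w.2 - w.1 := by
    have hl' : IsClosed (Icc a b ∩ f ⁻¹' {l}) :=
      hf.preimage_isClosed_of_isClosed isClosed_Icc isClosed_singleton
    have hr' : IsClosed (Icc a b ∩ f ⁻¹' {r}) :=
      hf.preimage_isClosed_of_isClosed isClosed_Icc isClosed_singleton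
    have hdisj : Disjoint (Icc a b ∩ f ⁻¹' {l}) (Icc a b ∩ f ⁻¹' {r}) := by
      rw [Set.disjoint_left]
      rintro t ⟨_, h1⟩ ⟨_, h2⟩
      exact hlr (h1.symm.trans h2)
    obtain ⟨δ, hδ, h⟩ := hdisj.exists_thickenings
      (isCompact_Icc.of_isClosed_subset hl' inter_subset_left) hr'
    refine ⟨δ, hδ, fun w hw => ?_⟩
    by_contra! hlt
    obtain ⟨h1, h2, h3, h4, -, -⟩ := hw
    have hd : dist w.1 w.2 < δ := by
      rw [Real.dist_eq, abs_sub_comm, abs_of_pos (by linarith)]; exact hlt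
    have m1 : w.1 ∈ Icc a b := ⟨h1, by linarith⟩
    have m2 : w.2 ∈ Icc a b := ⟨by linarith, h3⟩
    rcases h4 with h4 | h4
    · exact Set.disjoint_left.mp h (Metric.self_subset_thickening hδ _ ⟨m1, h4.1⟩)
        (Metric.mem_thickening_iff.mpr ⟨w.2, ⟨m2, h4.2⟩, hd⟩)
    · exact Set.disjoint_left.mp h (Metric.mem_thickening_iff.mpr ⟨w.2, ⟨m2, h4.2⟩, hd⟩)
        (Metric.self_subset_thickening hδ _ ⟨m1, h4.1⟩)
  refine Set.Finite.of_finite_image (f := fun w : ℝ × ℝ => ⌊w.1 / δ⌋)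
    ((Set.finite_Icc ⌊a / δ⌋ ⌊b / δ⌋).subset ?_) ?_
  · rintro _ ⟨w, hw, rfl⟩
    exact ⟨Int.floor_le_floor (by gcongr; exact hw.1),
      Int.floor_le_floor (by gcongr; exact hw.2.1.le.trans hw.2.2.1)⟩
  · intro w hw w' hw' h
    have h1 : |w.1 / δ - w'.1 / δ| < 1 := Int.abs_sub_lt_one_of_floor_eq_floor h
    rw [← sub_div, abs_div, abs_of_pos hδ, div_lt_one hδ, abs_lt] at h1
    have := hball w hw
    have := hball w' hw'
    exact crossings_eq_of_overlap hl hr hw hw' (by linarith) (by linarith)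

/-- The number of crossings modulo two. -/
noncomputable def crossingParity (B Q : Set X) (l r : X) (f : ℝ → X) (a b : ℝ) : ZMod 2 :=
  ((crossings B Q l r f a b).ncard : ZMod 2)

/-- No passage can contain in its interior a time at which `f` is outside `B`. -/
theorem crossings_union {m : ℝ} (hm : f m ∉ B) (ham : a ≤ m) (hmb : m ≤ b) :
    crossings B Q l r f a b = crossings B Q l r f a m ∪ crossings B Q l r f m b := by
  ext w
  constructor
  · rintro ⟨h1, h2, h3, h4, h5, h6⟩
    rcases le_or_gt w.2 m with h | h
    · exact Or.inl ⟨h1, h2, h, h4, h5, h6⟩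
    · refine Or.inr ⟨?_, h2, h3, h4, h5, h6⟩
      by_contra! hlt
      exact hm (h5 m ⟨hlt, h⟩)
  · rintro (⟨h1, h2, h3, h4, h5, h6⟩ | ⟨h1, h2, h3, h4, h5, h6⟩)
    · exact ⟨h1, h2, h3.trans hmb, h4, h5, h6⟩
    · exact ⟨ham.trans h1, h2, h3, h4, h5, h6⟩

theorem crossings_disjoint {m : ℝ} :
    Disjoint (crossings B Q l r f a m) (crossings B Q l r f m b) := by
  rw [Set.disjoint_left]
  rintro w ⟨-, h2, h3, -⟩ ⟨h1, -⟩
  linarith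

theorem ncard_crossings_add [TopologicalSpace X] [T1Space X] (hl : l ∉ B) (hr : r ∉ B)
    (hlr : l ≠ r) (hf : ContinuousOn f (Icc a b)) {m : ℝ} (hm : f m ∉ B) (ham : a ≤ m)
    (hmb : m ≤ b) : (crossings B Q l r f a b).ncard =
      (crossings B Q l r f a m).ncard + (crossings B Q l r f m b).ncard := by
  rw [crossings_union hm ham hmb, Set.ncard_union_eq crossings_disjoint
    (crossings_finite hl hr hlr (hf.mono (Icc_subset_Icc_right hmb)))
    (crossings_finite hl hr hlr (hf.mono (Icc_subset_Icc_left ham)))]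

theorem crossingParity_add [TopologicalSpace X] [T1Space X] (hl : l ∉ B) (hr : r ∉ B)
    (hlr : l ≠ r) (hf : ContinuousOn f (Icc a b)) {m : ℝ} (hm : f m ∉ B) (ham : a ≤ m)
    (hmb : m ≤ b) : crossingParity B Q l r f a b =
      crossingParity B Q l r f a m + crossingParity B Q l r f m b := by
  simp only [crossingParity, ncard_crossings_add hl hr hlr hf hm ham hmb, Nat.cast_add]

/-- Between a point below `u` and a point above `v` there is a passage from `u` to `v`. -/
theorem exists_crossing {φ : ℝ → ℝ} {u v : ℝ} (huv : u < v) (hab : a ≤ b)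
    (hφ : ContinuousOn φ (Icc a b)) (ha : φ a ≤ u) (hb : v ≤ φ b) :
    ∃ w : ℝ × ℝ, a ≤ w.1 ∧ w.1 < w.2 ∧ w.2 ≤ b ∧ φ w.1 = u ∧ φ w.2 = v ∧
      ∀ t ∈ Ioo w.1 w.2, φ t ∈ Ioo u v := by
  have c1 : IsCompact (Icc a b ∩ φ ⁻¹' {v}) := isCompact_Icc.of_isClosed_subset
    (hφ.preimage_isClosed_of_isClosed isClosed_Icc isClosed_singleton) inter_subset_left
  -- Take the first time `y` at the value `v`, then the last time `x` before it at the value `u`;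
  -- the intermediate value theorem keeps `φ` strictly between them.
  obtain ⟨y, ⟨hy, hyv⟩, hmin⟩ := c1.exists_isLeast
    (by
      obtain ⟨t, ht, h⟩ := intermediate_value_Icc hab hφ ⟨ha.trans huv.le, hb⟩
      exact ⟨t, ht, h⟩)
  have hφ' := hφ.mono (Icc_subset_Icc_right hy.2)
  have c2 : IsCompact (Icc a y ∩ φ ⁻¹' {u}) := isCompact_Icc.of_isClosed_subset
    (hφ'.preimage_isClosed_of_isClosed isClosed_Icc isClosed_singleton) inter_subset_left
  have hyv : φ y = v := hyv
  obtain ⟨x, ⟨hx, hxu⟩, hmax⟩ := c2.exists_isGreatest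
    (by
      obtain ⟨t, ht, h⟩ := intermediate_value_Icc hy.1 hφ' ⟨ha, by rw [hyv]; exact huv.le⟩
      exact ⟨t, ht, h⟩)
  have hxu : φ x = u := hxu
  have hxy : x < y := by
    rcases hx.2.lt_or_eq with h | h
    · exact h
    · rw [h, hyv] at hxu; exact absurd hxu huv.ne'
  refine ⟨(x, y), hx.1, hxy, hy.2, hxu, hyv, fun t ht => ⟨?_, ?_⟩⟩
  · by_contra! h
    obtain ⟨z, hz, hzu⟩ := intermediate_value_Icc ht.2.le
      (hφ.mono (Icc_subset_Icc (hx.1.trans ht.1.le) hy.2))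
      (⟨h, by rw [hyv]; exact huv.le⟩ : u ∈ Icc (φ t) (φ y))
    exact absurd (hmax ⟨⟨hx.1.trans (ht.1.le.trans hz.1), hz.2⟩, hzu⟩)
      (not_le.mpr (ht.1.trans_le hz.1))
  · by_contra! h
    obtain ⟨z, hz, hzv⟩ := intermediate_value_Icc ht.1.le
      (hφ.mono (Icc_subset_Icc hx.1 (ht.2.le.trans hy.2)))
      (⟨by rw [hxu]; exact huv.le, h⟩ : v ∈ Icc (φ x) (φ t))
    exact absurd (hmin ⟨⟨hx.1.trans hz.1, hz.2.trans (ht.2.le.trans hy.2)⟩, hzv⟩)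
      (not_le.mpr (hz.2.trans_lt ht.2))

theorem exists_crossing' {φ : ℝ → ℝ} {u v : ℝ} (huv : u < v) (hab : a ≤ b)
    (hφ : ContinuousOn φ (Icc a b)) (ha : v ≤ φ a) (hb : φ b ≤ u) :
    ∃ w : ℝ × ℝ, a ≤ w.1 ∧ w.1 < w.2 ∧ w.2 ≤ b ∧ φ w.1 = v ∧ φ w.2 = u ∧
      ∀ t ∈ Ioo w.1 w.2, φ t ∈ Ioo u v := by
  obtain ⟨w, h1, h2, h3, h4, h5, h6⟩ := exists_crossing (φ := fun t => -φ t) (u := -v) (v := -u)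
    (neg_lt_neg huv) hab hφ.neg (neg_le_neg ha) (neg_le_neg hb)
  refine ⟨w, h1, h2, h3, neg_injective h4, neg_injective h5, fun t ht => ?_⟩
  have := h6 t ht
  exact ⟨by linarith [this.2], by linarith [this.1]⟩

/-- A real function passes an interval an odd number of times if and only if it changes sides. -/
theorem crossingParity_real {φ : ℝ → ℝ} {u v : ℝ} (huv : u < v) (hab : a ≤ b)
    (hφ : ContinuousOn φ (Icc a b)) (ha : φ a ∉ Ioo u v) (hb : φ b ∉ Ioo u v) :
    crossingParity (Ioo u v) univ u v φ a b = if (φ a ≤ u ↔ φ b ≤ u) then 0 else 1 := by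
  have hu : u ∉ Ioo u v := fun h => lt_irrefl _ h.1
  have hv : v ∉ Ioo u v := fun h => lt_irrefl _ h.2
  -- Strong induction on the number of crossings: cut out one of them, which switches sides, and
  -- apply the hypothesis to the two remaining intervals. Without crossings, the intermediate value
  -- theorem forbids a change of side.
  have key : ∀ k : ℕ, ∀ a b : ℝ, a ≤ b → ContinuousOn φ (Icc a b) → φ a ∉ Ioo u v →
      φ b ∉ Ioo u v → (crossings (Ioo u v) univ u v φ a b).ncard = k →
      ((k : ℕ) : ZMod 2) = if (φ a ≤ u ↔ φ b ≤ u) then 0 else 1 := by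
    intro k
    induction k using Nat.strong_induction_on with
    | _ k ih =>
      intro a b hab hφ ha hb hk
      have hfin := crossings_finite (Q := univ) hu hv huv.ne hφ
      by_cases h0 : crossings (Ioo u v) univ u v φ a b = ∅
      · rw [h0, Set.ncard_empty] at hk
        subst hk
        have ha' : φ a ≤ u ∨ v ≤ φ a := by
          by_contra! h; exact ha h
        have hb' : φ b ≤ u ∨ v ≤ φ b := by
          by_contra! h; exact hb h
        have hne : ∀ w : ℝ × ℝ, a ≤ w.1 → w.1 < w.2 → w.2 ≤ b →
            (φ w.1 = u ∧ φ w.2 = v ∨ φ w.1 = v ∧ φ w.2 = u) →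
            ¬ ∀ t ∈ Ioo w.1 w.2, φ t ∈ Ioo u v := fun w h1 h2 h3 h4 h5 => by
          have : w ∈ crossings (Ioo u v) univ u v φ a b := ⟨h1, h2, h3, h4, h5,
            (w.1 + w.2) / 2, ⟨by linarith, by linarith⟩, trivial⟩
          rw [h0] at this
          exact this
        rw [if_pos, Nat.cast_zero]
        rcases ha' with h1 | h1 <;> rcases hb' with h2 | h2
        · tauto
        · obtain ⟨w, i1, i2, i3, i4, i5, i6⟩ := exists_crossing huv hab hφ h1 h2
          exact absurd i6 (hne w i1 i2 i3 (Or.inl ⟨i4, i5⟩))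
        · obtain ⟨w, i1, i2, i3, i4, i5, i6⟩ := exists_crossing' huv hab hφ h1 h2
          exact absurd i6 (hne w i1 i2 i3 (Or.inr ⟨i4, i5⟩))
        · have := huv.trans_le h1
          have := huv.trans_le h2
          constructor <;> intro <;> linarith
      · obtain ⟨w, hw⟩ := Set.nonempty_iff_ne_empty.mpr h0
        have n1 := crossings_fst_notMem hu hv hw
        have n2 := crossings_snd_notMem hu hv hw
        obtain ⟨h1, h2, h3, h4, h5, -⟩ := id hw
        have e1 := ncard_crossings_add (Q := univ) hu hv huv.ne hφ n1 h1 (h2.le.trans h3)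
        have e2 := ncard_crossings_add (Q := univ) hu hv huv.ne
          (hφ.mono (Icc_subset_Icc_left h1)) n2 h2.le h3
        have e3 : crossings (Ioo u v) univ u v φ w.1 w.2 = {w} := by
          ext w'
          constructor
          · intro hw'
            have hw'' : w' ∈ crossings (Ioo u v) univ u v φ a b :=
              ⟨h1.trans hw'.1, hw'.2.1, hw'.2.2.1.trans h3, hw'.2.2.2⟩
            exact (crossings_eq_of_overlap hu hv hw hw'' (hw'.1.trans_lt hw'.2.1)
              (hw'.2.1.trans_le hw'.2.2.1)).symm
          · rintro rfl
            exact ⟨le_rfl, h2, le_rfl, hw.2.2.2⟩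
        rw [e3, Set.ncard_singleton] at e2
        have i1 := ih _ (by omega) a w.1 h1 (hφ.mono (Icc_subset_Icc_right (h2.le.trans h3)))
          ha n1 rfl
        have i2 := ih _ (by omega) w.2 b h3 (hφ.mono (Icc_subset_Icc_left (h1.trans h2.le)))
          n2 hb rfl
        rw [← hk, e1, e2, Nat.cast_add, Nat.cast_add, i1, i2]
        have hlt := not_le.mpr huv
        rcases h4 with ⟨h4, h4'⟩ | ⟨h4, h4'⟩ <;> rw [h4, h4'] <;>
          by_cases p : φ a ≤ u <;> by_cases q : φ b ≤ u <;> simp [p, q, hlt] <;> decide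
  exact key _ a b hab hφ ha hb rfl

/-- The parity of the number of crossings does not change under a (not necessarily monotone)
change of the parameter. -/
theorem crossingParity_comp [TopologicalSpace X] [T1Space X] (hl : l ∉ B) (hr : r ∉ B)
    (hlr : l ≠ r) {a' b' : ℝ} {φ : ℝ → ℝ} (hab : a ≤ b) (hf : ContinuousOn f (Icc a' b'))
    (hφ : ContinuousOn φ (Icc a b)) (hmaps : MapsTo φ (Icc a b) (Icc a' b'))
    (hends : φ a = a' ∧ φ b = b' ∨ φ a = b' ∧ φ b = a') :
    crossingParity B Q l r (f ∘ φ) a b = crossingParity B Q l r f a' b' := by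
  classical
  have hfin := crossings_finite (Q := Q) hl hr hlr hf
  have hfin' := crossings_finite (Q := Q) hl hr hlr (hf.comp hφ hmaps)
  -- On the open interval, `φ` avoids both of its end values, since `f` sends those outside `B`. The
  -- image is connected and contains the midpoint of the end values, so it stays between them.
  have hbetween : ∀ w ∈ crossings B Q l r (f ∘ φ) a b, ∀ t ∈ Ioo w.1 w.2,
      φ t ∈ Ioo (min (φ w.1) (φ w.2)) (max (φ w.1) (φ w.2)) := by
    intro w hw t ht
    have n1 : f (φ w.1) ∉ B := crossings_fst_notMem hl hr hw
    have n2 : f (φ w.2) ∉ B := crossings_snd_notMem hl hr hw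
    obtain ⟨h1, h2, h3, h4, h5, -⟩ := hw
    have hne : φ w.1 ≠ φ w.2 := by
      intro h
      rcases h4 with h4 | h4
      · exact hlr (by rw [← h4.1, ← h4.2]; simp [h])
      · exact hlr (by rw [← h4.1, ← h4.2]; simp [h])
    have hs : Ioo w.1 w.2 ⊆ Icc a b := fun x hx => ⟨h1.trans hx.1.le, hx.2.le.trans h3⟩
    have hc : IsPreconnected (φ '' Ioo w.1 w.2) := isPreconnected_Ioo.image _ (hφ.mono hs)
    have hav1 : φ w.1 ∉ φ '' Ioo w.1 w.2 := by
      rintro ⟨x, hx, e⟩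
      exact n1 (e ▸ h5 x hx)
    have hav2 : φ w.2 ∉ φ '' Ioo w.1 w.2 := by
      rintro ⟨x, hx, e⟩
      exact n2 (e ▸ h5 x hx)
    have hord := hc.ordConnected
    have hmid : ∃ x ∈ Ioo w.1 w.2, φ x ∈ Ioo (min (φ w.1) (φ w.2)) (max (φ w.1) (φ w.2)) := by
      have hcc : ContinuousOn φ (Icc w.1 w.2) := hφ.mono (Icc_subset_Icc h1 h3)
      have : (φ w.1 + φ w.2) / 2 ∈ φ '' Icc w.1 w.2 := by
        rcases lt_or_gt_of_ne hne with h | h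
        · exact intermediate_value_Icc h2.le hcc ⟨by linarith, by linarith⟩
        · exact intermediate_value_Icc' h2.le hcc ⟨by linarith, by linarith⟩
      obtain ⟨x, hx, e⟩ := this
      refine ⟨x, ⟨lt_of_le_of_ne hx.1 ?_, lt_of_le_of_ne hx.2 ?_⟩, ?_⟩
      · rintro rfl; apply hne; linarith
      · rintro rfl; apply hne; linarith
      · rw [e]
        rcases lt_or_gt_of_ne hne with h | h
        · rw [min_eq_left h.le, max_eq_right h.le]; constructor <;> linarith
        · rw [min_eq_right h.le, max_eq_left h.le]; constructor <;> linarith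
    obtain ⟨x, hx, hx1, hx2⟩ := hmid
    have hmin : min (φ w.1) (φ w.2) ∉ φ '' Ioo w.1 w.2 := by
      rcases min_choice (φ w.1) (φ w.2) with h | h <;> rw [h] <;> assumption
    have hmax : max (φ w.1) (φ w.2) ∉ φ '' Ioo w.1 w.2 := by
      rcases max_choice (φ w.1) (φ w.2) with h | h <;> rw [h] <;> assumption
    constructor
    · by_contra! h
      exact hmin (hord.out (mem_image_of_mem _ ht) (mem_image_of_mem _ hx) ⟨h, hx1.le⟩)
    · by_contra! h
      exact hmax (hord.out (mem_image_of_mem _ hx) (mem_image_of_mem _ ht) ⟨hx2.le, h⟩)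
  -- `Θ` sends a passage of `f ∘ φ` to the passage of `f` that it traverses, forgetting the
  -- direction.
  set Θ : ℝ × ℝ → ℝ × ℝ := fun w => (min (φ w.1) (φ w.2), max (φ w.1) (φ w.2)) with hΘ
  have hsurj : ∀ w : ℝ × ℝ, a ≤ w.1 → w.1 < w.2 → w.2 ≤ b → ∀ τ ∈ Ioo (Θ w).1 (Θ w).2,
      ∃ t ∈ Ioo w.1 w.2, φ t = τ := by
    intro w h1 h2 h3 τ hτ
    have hcc : ContinuousOn φ (Icc w.1 w.2) := hφ.mono (Icc_subset_Icc h1 h3)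
    simp only [hΘ] at hτ
    rcases le_total (φ w.1) (φ w.2) with h | h
    · rw [min_eq_left h, max_eq_right h] at hτ
      exact intermediate_value_Ioo h2.le hcc hτ
    · rw [min_eq_right h, max_eq_left h] at hτ
      exact intermediate_value_Ioo' h2.le hcc hτ
  have hmapsΘ : ∀ w ∈ hfin'.toFinset, Θ w ∈ hfin.toFinset := by
    intro w hw
    rw [Set.Finite.mem_toFinset] at hw ⊢
    have hb := hbetween w hw
    obtain ⟨h1, h2, h3, h4, h5, t, ht, htQ⟩ := hw
    have m1 := hmaps (⟨h1, h2.le.trans h3⟩ : w.1 ∈ Icc a b)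
    have m2 := hmaps (⟨h1.trans h2.le, h3⟩ : w.2 ∈ Icc a b)
    refine ⟨le_min m1.1 m2.1, (hb t ht).1.trans (hb t ht).2, max_le m1.2 m2.2, ?_, ?_,
      φ t, hb t ht, htQ⟩
    · simp only [hΘ]
      simp only [Function.comp] at h4
      rcases le_total (φ w.1) (φ w.2) with h | h
      · rw [min_eq_left h, max_eq_right h]; exact h4
      · rw [min_eq_right h, max_eq_left h]; tauto
    · intro τ hτ
      obtain ⟨x, hx, rfl⟩ := hsurj w h1 h2 h3 τ hτ
      exact h5 x hx
  -- The fibre over `(u, v)` consists of the crossings of `(u, v)` by `φ`. They are odd in number,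
  -- since `φ` takes the values `a'` and `b'` at its ends, on opposite sides of `(u, v)`.
  have hfib : ∀ J ∈ hfin.toFinset,
      ((hfin'.toFinset.filter (fun w => Θ w = J)).card : ZMod 2) = 1 := by
    rintro ⟨u, v⟩ hJ
    rw [Set.Finite.mem_toFinset] at hJ
    have hnu : f u ∉ B := crossings_fst_notMem hl hr hJ
    have hnv : f v ∉ B := crossings_snd_notMem hl hr hJ
    obtain ⟨h1, h2, h3, h4, h5, τ, hτ, hτQ⟩ := hJ
    simp only at h1 h2 h3 h4 h5 hτ
    have heq : ((hfin'.toFinset.filter (fun w => Θ w = (u, v)) : Finset (ℝ × ℝ)) : Set (ℝ × ℝ)) =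
        crossings (Ioo u v) univ u v φ a b := by
      ext w
      simp only [Finset.coe_filter, Set.Finite.mem_toFinset, mem_ofPred_eq]
      constructor
      · rintro ⟨hw, hwJ⟩
        have hb := hbetween w hw
        simp only [hΘ, Prod.mk.injEq] at hwJ
        rw [hwJ.1, hwJ.2] at hb
        obtain ⟨i1, i2, i3, -, -, t, ht, -⟩ := hw
        refine ⟨i1, i2, i3, ?_, hb, t, ht, trivial⟩
        rcases le_total (φ w.1) (φ w.2) with h | h
        · rw [min_eq_left h, max_eq_right h] at hwJ; exact Or.inl hwJ
        · rw [min_eq_right h, max_eq_left h] at hwJ; exact Or.inr ⟨hwJ.2, hwJ.1⟩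
      · rintro ⟨i1, i2, i3, i4, i5, -⟩
        have hΘw : Θ w = (u, v) := by
          rcases i4 with i4 | i4
          · simp [hΘ, i4.1, i4.2, h2.le]
          · simp [hΘ, i4.1, i4.2, h2.le]
        refine ⟨⟨i1, i2, i3, ?_, fun t ht => h5 _ (i5 t ht), ?_⟩, hΘw⟩
        · simp only [Function.comp]
          rcases i4 with i4 | i4 <;> rw [i4.1, i4.2] <;> tauto
        · obtain ⟨t, ht, e⟩ := hsurj w i1 i2 i3 τ (by rw [hΘw]; exact hτ)
          exact ⟨t, ht, by simp only [Function.comp]; rwa [e]⟩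
    rw [← Set.ncard_coe_finset, heq]
    have ha'u : a' ∉ Ioo u v := fun h => absurd h.1 (not_lt.mpr h1)
    have hb'v : b' ∉ Ioo u v := fun h => absurd h.2 (not_lt.mpr h3)
    have hbu : ¬ b' ≤ u := not_le.mpr (h2.trans_le h3)
    have := crossingParity_real h2 hab hφ
      (by rcases hends with h | h <;> rw [h.1] <;> assumption)
      (by rcases hends with h | h <;> rw [h.2] <;> assumption)
    rw [crossingParity] at this
    rw [this, if_neg]
    rcases hends with h | h <;> rw [h.1, h.2] <;> tauto
  rw [crossingParity, crossingParity, Set.ncard_eq_toFinset_card _ hfin',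
    Set.ncard_eq_toFinset_card _ hfin, Finset.card_eq_sum_card_fiberwise hmapsΘ, Nat.cast_sum,
    Finset.sum_congr rfl hfib]
  simp

end Crossings

/-! ### Extension of one-sided smooth functions, Hadamard factorization, and smoothness at a break.
-/

section Calculus
open MeasureTheory

variable {F : Type*} [NormedAddCommGroup F] [NormedSpace ℝ F]

/-- A function of class `C^N` on a compact interval extends to a function of class `C^N` on the
line. -/
theorem exists_contDiff_eqOn_Icc [CompleteSpace F] {a b : ℝ} (hab : a < b) (N : ℕ) (f : ℝ → F)
    (hf : ContDiffOn ℝ N f (Icc a b)) :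
    ∃ g : ℝ → F, ContDiff ℝ N g ∧ EqOn g f (Icc a b) := by
  induction N generalizing f with
  | zero =>
    have hc : Continuous ((Icc a b).domRestrict f) := hf.continuousOn.domRestrict
    refine ⟨IccExtend hab.le ((Icc a b).domRestrict f), ?_, fun x hx => ?_⟩
    · rw [Nat.cast_zero, contDiff_zero]
      exact hc.Icc_extend'
    · rw [IccExtend_of_mem hab.le _ hx]; rfl
  | succ N ih =>
    have hu := uniqueDiffOn_Icc hab
    rw [Nat.cast_succ, contDiffOn_succ_iff_derivWithin hu] at hf
    obtain ⟨hd, -, hf'⟩ := hf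
    -- Extend the derivative and integrate.
    obtain ⟨g, hg, hgf⟩ := ih _ hf'
    have hderiv : ∀ x, HasDerivAt (fun y => f a + ∫ t in a..y, g t) (g x) x := fun x =>
      (intervalIntegral.integral_hasDerivAt_right (hg.continuous.intervalIntegrable _ _)
        hg.continuous.stronglyMeasurable.stronglyMeasurableAtFilter
        hg.continuous.continuousAt).const_add _
    refine ⟨fun y => f a + ∫ t in a..y, g t, ?_, fun x hx => ?_⟩
    · rw [Nat.cast_succ, contDiff_succ_iff_deriv]
      refine ⟨fun x => (hderiv x).differentiableAt, by simp, ?_⟩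
      rwa [funext fun x => (hderiv x).deriv]
    · have : ∫ t in a..x, g t = f x - f a := by
        refine intervalIntegral.integral_eq_sub_of_hasDerivAt_of_le hx.1
          (hd.continuousOn.mono (Icc_subset_Icc_right hx.2)) (fun t ht => ?_)
          (hg.continuous.intervalIntegrable _ _)
        have ht' : t ∈ Icc a b := ⟨ht.1.le, ht.2.le.trans hx.2⟩
        have hn : Icc a b ∈ nhds t := Icc_mem_nhds ht.1 (ht.2.trans_le hx.2)
        rw [hgf ht', derivWithin_of_mem_nhds hn]
        exact ((hd t ht').differentiableAt hn).hasDerivAt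
      simp only [this, add_sub_cancel]

/-- The weight `t ^ j` makes the family stable under differentiation in `x`: it turns `G` into its
derivative and raises `j` by one, so the induction closes. -/
theorem contDiff_integral_pow_smul (N : ℕ) (j : ℕ) (G : ℝ → F) (hG : ContDiff ℝ N G) :
    ContDiff ℝ N (fun x => ∫ t in (0 : ℝ)..1, t ^ j • G (t * x)) := by
  induction N generalizing j G with
  | zero =>
    rw [Nat.cast_zero, contDiff_zero] at hG ⊢
    exact intervalIntegral.continuous_parametric_intervalIntegral_of_continuous' (by fun_prop) _ _
  | succ N ih =>
    rw [Nat.cast_succ, contDiff_succ_iff_deriv] at hG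
    obtain ⟨hd, -, hG'⟩ := hG
    have hGc : Continuous G := hd.continuous
    have hGc' : Continuous (deriv G) := hG'.continuous
    have key : ∀ x₀, HasDerivAt (fun x => ∫ t in (0 : ℝ)..1, t ^ j • G (t * x))
        (∫ t in (0 : ℝ)..1, t ^ (j + 1) • deriv G (t * x₀)) x₀ := by
      intro x₀
      obtain ⟨C, hC⟩ := (isCompact_Icc (a := -(|x₀| + 1)) (b := |x₀| + 1)).exists_bound_of_continuousOn
        hGc'.continuousOn
      refine (intervalIntegral.hasDerivAt_integral_of_dominated_loc_of_deriv_le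
        (F' := fun x t => t ^ (j + 1) • deriv G (t * x)) (bound := fun _ => C)
        (Metric.ball_mem_nhds x₀ one_pos) ?_ ?_ ?_ ?_ ?_ ?_).2
      · exact Filter.Eventually.of_forall fun x =>
          Continuous.aestronglyMeasurable (by fun_prop)
      · exact Continuous.intervalIntegrable (by fun_prop) _ _
      · exact Continuous.aestronglyMeasurable (by fun_prop)
      · refine Filter.Eventually.of_forall fun t ht x hx => ?_
        rw [uIoc_of_le zero_le_one] at ht
        rw [Metric.mem_ball, Real.dist_eq] at hx
        have hx' : |x| ≤ |x₀| + 1 := by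
          have := abs_sub_abs_le_abs_sub x x₀; linarith
        have h1 : |t * x| ≤ |x₀| + 1 := by
          rw [abs_mul, abs_of_pos ht.1]
          nlinarith [abs_nonneg x, ht.2]
        rw [norm_smul, Real.norm_eq_abs, abs_pow, abs_of_pos ht.1]
        have h2 := hC (t * x) (abs_le.mp h1)
        have h3 : t ^ (j + 1) ≤ 1 := pow_le_one₀ ht.1.le ht.2
        have h4 : 0 ≤ t ^ (j + 1) := pow_nonneg ht.1.le _
        nlinarith [norm_nonneg (deriv G (t * x))]
      · exact intervalIntegrable_const
      · refine Filter.Eventually.of_forall fun t _ x _ => ?_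
        have h1 : HasDerivAt (fun x => t * x) t x := by
          simpa using (hasDerivAt_id x).const_mul t
        have h2 := ((hd (t * x)).hasDerivAt.scomp x h1).const_smul (t ^ j)
        rw [smul_smul, ← pow_succ] at h2
        exact h2
    rw [Nat.cast_succ, contDiff_succ_iff_deriv]
    refine ⟨fun x => (key x).differentiableAt, by simp, ?_⟩
    rw [funext fun x => (key x).deriv]
    exact ih (j + 1) _ hG'

/-- Hadamard's lemma in one variable. -/
theorem exists_eq_smul_of_apply_zero [CompleteSpace F] (N : ℕ) (D : ℝ → F) (hD : ContDiff ℝ (N + 1 : ℕ) D)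
    (h0 : D 0 = 0) : ∃ A : ℝ → F, ContDiff ℝ N A ∧ ∀ x, D x = x • A x := by
  rw [Nat.cast_succ, contDiff_succ_iff_deriv] at hD
  obtain ⟨hd, -, hD'⟩ := hD
  refine ⟨fun x => ∫ t in (0 : ℝ)..1, t ^ 0 • deriv D (t * x),
    contDiff_integral_pow_smul N 0 _ hD', fun x => ?_⟩
  have hc : Continuous (deriv D) := hD'.continuous
  -- Integrate the derivative of `t ↦ D (t * x)` over the unit interval and use `D 0 = 0`.
  have := intervalIntegral.integral_eq_sub_of_hasDerivAt (a := 0) (b := 1)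
    (f := fun t => D (t * x)) (f' := fun t => x • deriv D (t * x)) (fun t _ => by
      have h1 : HasDerivAt (fun t => t * x) x t := by
        simpa using (hasDerivAt_id t).mul_const x
      exact (hd (t * x)).hasDerivAt.scomp t h1) (Continuous.intervalIntegrable (by fun_prop) _ _)
  rw [intervalIntegral.integral_smul] at this
  simp only [pow_zero, one_smul, this, one_mul, zero_mul, h0, sub_zero]

/-- Hadamard factors are split off until the quotient is nonzero at the origin or all `j` of them
have been used. Each factor costs one derivative. -/
theorem exists_eq_pow_smul [CompleteSpace F] (N j : ℕ) (D : ℝ → F) (hD : ContDiff ℝ (N + j : ℕ) D) :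
    ∃ k ≤ j, ∃ A : ℝ → F, ContDiff ℝ N A ∧ (∀ x, D x = x ^ k • A x) ∧ (k = j ∨ A 0 ≠ 0) := by
  induction j generalizing D with
  | zero => exact ⟨0, le_rfl, D, hD, fun x => by simp, Or.inl rfl⟩
  | succ j ih =>
    by_cases h0 : D 0 = 0
    · obtain ⟨D', hD', h⟩ := exists_eq_smul_of_apply_zero (N + j) D hD h0
      obtain ⟨k, hk, A, hA, hDA, hor⟩ := ih D' hD'
      refine ⟨k + 1, by omega, A, hA, fun x => ?_, hor.imp (by omega) id⟩
      rw [h, hDA, smul_smul, pow_succ']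
    · exact ⟨0, by omega, D, hD.of_le (by exact_mod_cast Nat.le_add_right _ _),
        fun x => by simp, Or.inr h0⟩

/-- This handles the case in which the jump between two branches is divisible by so high a power
that the gluing is already of class `C^N`. -/
theorem contDiff_max_zero_pow (N : ℕ) : ContDiff ℝ N (fun x : ℝ => (max x 0) ^ (N + 1)) := by
  induction N with
  | zero =>
    rw [Nat.cast_zero, contDiff_zero]
    fun_prop
  | succ N ih =>
    have key : ∀ x : ℝ, HasDerivAt (fun x : ℝ => (max x 0) ^ (N + 1 + 1))
        (((N + 2 : ℕ) : ℝ) * (max x 0) ^ (N + 1)) x := by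
      intro x
      rcases lt_trichotomy x 0 with h | h | h
      · refine (hasDerivAt_const x (0 : ℝ)).congr_of_eventuallyEq ?_ |>.congr_deriv ?_
        · filter_upwards [Iio_mem_nhds h] with y hy
          rw [max_eq_right (le_of_lt hy), zero_pow (by omega)]
        · rw [max_eq_right h.le, zero_pow (by omega), mul_zero]
      · subst h
        rw [max_self, zero_pow (by omega), mul_zero]
        rw [hasDerivAt_iff_isLittleO_nhds_zero]
        have h1 : (fun h : ℝ => h ^ (N + 2)) =o[nhds 0] fun h : ℝ => h := by
          simpa using Asymptotics.isLittleO_pow_pow (𝕜 := ℝ) (show 1 < N + 2 by omega)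
        refine (Asymptotics.IsBigO.of_bound 1 (Filter.Eventually.of_forall fun y => ?_)).trans_isLittleO h1
        simp only [zero_add, max_self, smul_zero, sub_zero, one_mul]
        rw [zero_pow (by omega), sub_zero, norm_pow, norm_pow]
        gcongr
        rw [Real.norm_eq_abs, Real.norm_eq_abs, abs_of_nonneg (le_max_right _ _)]
        exact max_le (le_abs_self _) (abs_nonneg _)
      · have := hasDerivAt_pow (N + 2) x
        refine (this.congr_of_eventuallyEq ?_).congr_deriv ?_
        · filter_upwards [Ioi_mem_nhds h] with y hy
          rw [max_eq_left (le_of_lt hy)]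
        · rw [max_eq_left h.le]; rfl
    rw [Nat.cast_succ, contDiff_succ_iff_deriv]
    refine ⟨fun x => (key x).differentiableAt, by simp, ?_⟩
    rw [funext fun x => (key x).deriv]
    exact contDiff_const.mul ih

/-- If `f` is smooth on both sides of `0` and `f ∘ φ` is smooth, then so is
`f ((1 - s) φ t)` in both variables. -/
theorem contDiffWithinAt_comp_mul [CompleteSpace F] {f : ℝ → F} {δ : ℝ} (hδ : 0 < δ)
    (hf₁ : ContDiffOn ℝ ∞ f (Icc (-δ) 0)) (hf₂ : ContDiffOn ℝ ∞ f (Icc 0 δ))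
    {φ : ℝ → ℝ} {S : Set ℝ} {t₀ s₀ : ℝ} (ht₀ : t₀ ∈ S) (hs₀ : s₀ ∈ Icc (0 : ℝ) 1) (h0 : φ t₀ = 0)
    (hφ : ContDiffWithinAt ℝ ∞ φ S t₀)
    (hfφ : ContDiffWithinAt ℝ ∞ (fun t => f (φ t)) S t₀) :
    ContDiffWithinAt ℝ ∞ (fun z : ℝ × ℝ => f ((1 - z.1) * φ z.2)) (Icc 0 1 ×ˢ S) (s₀, t₀) := by
  rw [contDiffWithinAt_infty]
  intro N
  have hle : ∀ m : ℕ, ((m : ℕ) : WithTop ℕ∞) ≤ ∞ := fun m => by exact_mod_cast le_top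
  -- Order `N + (N + 1)` leaves `N` derivatives after up to `N + 1` Hadamard divisions.
  obtain ⟨F₁, hF₁, e₁⟩ := exists_contDiff_eqOn_Icc (neg_lt_zero.mpr hδ) (N + (N + 1)) f
    (hf₁.of_le (hle _))
  obtain ⟨F₂, hF₂, e₂⟩ := exists_contDiff_eqOn_Icc hδ (N + (N + 1)) f (hf₂.of_le (hle _))
  obtain ⟨k, hk, A, hA, hDA, hor⟩ := exists_eq_pow_smul N (N + 1) (fun x => F₂ x - F₁ x)
    (hF₂.sub hF₁)
  -- The two extensions agree with `f` at the origin, so their difference vanishes there.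
  have hk0 : k ≠ 0 := by
    rintro rfl
    have h1 : F₂ 0 - F₁ 0 = 0 := by
      rw [e₁ ⟨by linarith, le_rfl⟩, e₂ ⟨le_rfl, hδ.le⟩, sub_self]
    have h2 := hDA 0
    simp only [h1, pow_zero, one_smul] at h2
    rcases hor with h | h
    · omega
    · exact h h2.symm
  have hF₁N : ContDiff ℝ N F₁ := hF₁.of_le (by exact_mod_cast Nat.le_add_right _ _)
  have hform : ∀ x ∈ Ioo (-δ) δ, f x = F₁ x + (max x 0) ^ k • A x := by
    intro x hx
    rcases le_total x 0 with h | h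
    · rw [max_eq_right h, zero_pow hk0, zero_smul, add_zero, e₁ ⟨hx.1.le, h⟩]
    · rw [max_eq_left h, ← hDA, e₂ ⟨h, hx.2.le⟩, add_sub_cancel]
  have hnear : ∀ᶠ t in nhdsWithin t₀ S, φ t ∈ Ioo (-δ) δ :=
    hφ.continuousWithinAt.eventually_mem (by rw [h0]; exact Ioo_mem_nhds (by linarith) hδ)
  have hφN : ContDiffWithinAt ℝ N φ S t₀ := hφ.of_le (hle _)
  -- The positive part of `φ` need not be smooth, but its `k`-th power is of class `C^N`. Either `k
  -- = N + 1`, or `A 0 ≠ 0` and the power is recovered from the smooth `f ∘ φ` by dividing by `A ∘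
  -- φ`, after applying a functional to make both scalar.
  have hpos : ContDiffWithinAt ℝ N (fun t => (max (φ t) 0) ^ k) S t₀ := by
    rcases hor with h | h
    · subst h
      exact (contDiff_max_zero_pow N).contDiffAt.comp_contDiffWithinAt t₀ hφN
    · obtain ⟨g, -, hg⟩ := exists_dual_vector ℝ (A 0) (norm_ne_zero_iff.mpr h)
      have hg0 : g (A 0) ≠ 0 := by
        rw [hg]; simpa using h
      have hAφ : ContDiffWithinAt ℝ N (fun t => g (A (φ t))) S t₀ :=
        g.contDiff.contDiffAt.comp_contDiffWithinAt t₀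
          (hA.contDiffAt.comp_contDiffWithinAt t₀ hφN)
      have hJ : ContDiffWithinAt ℝ N (fun t => g (f (φ t) - F₁ (φ t))) S t₀ :=
        g.contDiff.contDiffAt.comp_contDiffWithinAt t₀
          ((hfφ.of_le (hle _)).sub (hF₁N.contDiffAt.comp_contDiffWithinAt t₀ hφN))
      have hne : ∀ᶠ t in nhdsWithin t₀ S, g (A (φ t)) ≠ 0 :=
        hAφ.continuousWithinAt.eventually_ne (by simpa only [h0] using hg0)
      have hquot := hJ.div hAφ (by rw [h0]; exact hg0)
      refine hquot.congr_of_eventuallyEq_of_mem ?_ ht₀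
      filter_upwards [hne, hnear] with t h1 h2
      simp only [Pi.div_apply]
      rw [hform _ h2, add_sub_cancel_left, map_smul, smul_eq_mul, mul_div_assoc, div_self h1,
        mul_one]
  have hsnd : MapsTo (Prod.snd : ℝ × ℝ → ℝ) (Icc 0 1 ×ˢ S) S := fun z hz => hz.2
  have hφ2 : ContDiffWithinAt ℝ N (fun z : ℝ × ℝ => φ z.2) (Icc 0 1 ×ˢ S) (s₀, t₀) :=
    ContDiffWithinAt.comp (s₀, t₀) hφN contDiff_snd.contDiffWithinAt hsnd
  have hpos2 : ContDiffWithinAt ℝ N (fun z : ℝ × ℝ => (max (φ z.2) 0) ^ k) (Icc 0 1 ×ˢ S)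
      (s₀, t₀) :=
    ContDiffWithinAt.comp (g := fun t => (max (φ t) 0) ^ k) (s₀, t₀) hpos
      contDiff_snd.contDiffWithinAt hsnd
  have h1s : ContDiffWithinAt ℝ N (fun z : ℝ × ℝ => 1 - z.1) (Icc (0 : ℝ) 1 ×ˢ S) (s₀, t₀) :=
    (contDiff_const.sub contDiff_fst).contDiffWithinAt
  have harg := h1s.mul hφ2
  -- For `0 ≤ 1 - s`, the positive part of `(1 - s) * φ t` is `1 - s` times that of `φ t`, so its
  -- `k`-th power is a product of functions already controlled.
  have hres := (hF₁N.contDiffAt.comp_contDiffWithinAt (s₀, t₀) harg).add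
    (((h1s.pow k).mul hpos2).smul (hA.contDiffAt.comp_contDiffWithinAt (s₀, t₀) harg))
  refine hres.congr_of_eventuallyEq_of_mem ?_ ⟨hs₀, ht₀⟩
  have hnear2 : ∀ᶠ z in nhdsWithin (s₀, t₀) (Icc (0 : ℝ) 1 ×ˢ S), φ z.2 ∈ Ioo (-δ) δ := by
    rw [nhdsWithin_prod_eq]
    exact hnear.prod_inr _
  filter_upwards [hnear2, self_mem_nhdsWithin] with z hz hzS
  have hs1 : 0 ≤ 1 - z.1 := by linarith [hzS.1.2]
  have hs2 : 1 - z.1 ≤ 1 := by linarith [hzS.1.1]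
  rw [hform]
  · simp only [Function.comp, Pi.smul_apply']
    rw [← mul_pow, mul_max_of_nonneg _ _ hs1, mul_zero]
  · constructor <;> nlinarith [hz.1, hz.2]

end Calculus

/-! ### Affine images, unions and strips of polygonal pavings. -/

section Pavings

/-- A paving of a plane set by finitely many convex polygons with disjoint interiors. -/
def Paves (P : Finset (Set (ℝ × ℝ))) (S : Set (ℝ × ℝ)) : Prop :=
  (∀ K ∈ P, (∃ V : Finset (ℝ × ℝ), K = convexHull ℝ (V : Set (ℝ × ℝ))) ∧
    (interior K).Nonempty) ∧
  (∀ K ∈ P, ∀ L ∈ P, K ≠ L → Disjoint (interior K) (interior L)) ∧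
  (⋃ K ∈ P, K) = S

theorem Paves.subset {P : Finset (Set (ℝ × ℝ))} {S : Set (ℝ × ℝ)} (h : Paves P S)
    {K : Set (ℝ × ℝ)} (hK : K ∈ P) : K ⊆ S := by
  rw [← h.2.2]
  exact subset_biUnion_of_mem (u := fun K : Set (ℝ × ℝ) => K) hK

theorem Paves.union [DecidableEq (Set (ℝ × ℝ))] {P P' : Finset (Set (ℝ × ℝ))}
    {S S' : Set (ℝ × ℝ)} (h : Paves P S) (h' : Paves P' S')
    (hd : Disjoint (interior S) (interior S')) : Paves (P ∪ P') (S ∪ S') := by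
  refine ⟨fun K hK => ?_, fun K hK L hL hne => ?_, ?_⟩
  · rcases Finset.mem_union.mp hK with hK | hK
    · exact h.1 K hK
    · exact h'.1 K hK
  · rcases Finset.mem_union.mp hK with hK | hK <;> rcases Finset.mem_union.mp hL with hL | hL
    · exact h.2.1 K hK L hL hne
    · exact hd.mono (interior_mono (h.subset hK)) (interior_mono (h'.subset hL))
    · exact hd.symm.mono (interior_mono (h'.subset hK)) (interior_mono (h.subset hL))
    · exact h'.2.1 K hK L hL hne
  · rw [Finset.set_biUnion_union, h.2.2, h'.2.2]

/-- The affine map `(s, t) ↦ (s, m t + c)` of the plane. -/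
noncomputable def stripHomeo (m c : ℝ) (hm : m ≠ 0) : ℝ × ℝ ≃ₜ ℝ × ℝ :=
  (Homeomorph.refl ℝ).prodCongr (affineHomeomorph m c hm)

theorem stripHomeo_apply (m c : ℝ) (hm : m ≠ 0) (z : ℝ × ℝ) :
    stripHomeo m c hm z = (z.1, m * z.2 + c) := rfl

theorem stripHomeo_image_convexHull (m c : ℝ) (hm : m ≠ 0) (V : Set (ℝ × ℝ)) :
    stripHomeo m c hm '' convexHull ℝ V = convexHull ℝ (stripHomeo m c hm '' V) := by
  let A : ℝ × ℝ →ᵃ[ℝ] ℝ × ℝ :=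
    ((LinearMap.id : ℝ →ₗ[ℝ] ℝ).prodMap (m • (LinearMap.id : ℝ →ₗ[ℝ] ℝ))).toAffineMap +
      AffineMap.const ℝ (ℝ × ℝ) ((0 : ℝ), c)
  have hA : ⇑A = stripHomeo m c hm := by
    ext z <;> simp [A, stripHomeo_apply]
  rw [← hA]
  exact A.image_convexHull V

theorem Paves.image [DecidableEq (Set (ℝ × ℝ))] {P : Finset (Set (ℝ × ℝ))} {S : Set (ℝ × ℝ)}
    (h : Paves P S) (m c : ℝ) (hm : m ≠ 0) :
    Paves (P.image (fun K => stripHomeo m c hm '' K)) (stripHomeo m c hm '' S) := by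
  classical
  refine ⟨fun K hK => ?_, fun K hK L hL hne => ?_, ?_⟩
  · obtain ⟨K, hK', rfl⟩ := Finset.mem_image.mp hK
    obtain ⟨⟨V, rfl⟩, hi⟩ := h.1 K hK'
    refine ⟨⟨V.image (stripHomeo m c hm), ?_⟩, ?_⟩
    · rw [Finset.coe_image, stripHomeo_image_convexHull]
    · rw [← Homeomorph.image_interior]
      exact hi.image _
  · obtain ⟨K, hK', rfl⟩ := Finset.mem_image.mp hK
    obtain ⟨L, hL', rfl⟩ := Finset.mem_image.mp hL
    rw [← Homeomorph.image_interior, ← Homeomorph.image_interior,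
      Set.disjoint_image_iff (stripHomeo m c hm).injective]
    exact h.2.1 K hK' L hL' (fun e => hne (by rw [e]))
  · rw [Finset.set_biUnion_finset_image, ← h.2.2, Set.image_iUnion₂]

theorem exists_partition_Icc (T : Finset ℝ) {a b : ℝ} (hab : a < b) :
    ∃ Q : Finset (ℝ × ℝ), (∀ q ∈ Q, a ≤ q.1 ∧ q.1 < q.2 ∧ q.2 ≤ b ∧ ∀ t ∈ T, t ∉ Ioo q.1 q.2) ∧
      (∀ q ∈ Q, ∀ q' ∈ Q, q ≠ q' → Disjoint (Ioo q.1 q.2) (Ioo q'.1 q'.2)) ∧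
      (⋃ q ∈ Q, Icc q.1 q.2) = Icc a b := by
  classical
  induction T using Finset.induction_on generalizing a b with
  | empty => exact ⟨{(a, b)}, by simp [hab], by simp, by simp⟩
  | insert x T _ ih =>
    by_cases hx : x ∈ Ioo a b
    · obtain ⟨Q₁, h1, h2, h3⟩ := ih hx.1
      obtain ⟨Q₂, i1, i2, i3⟩ := ih hx.2
      have hd : ∀ q ∈ Q₁, ∀ q' ∈ Q₂, Disjoint (Ioo q.1 q.2) (Ioo q'.1 q'.2) := by
        intro q hq q' hq'
        rw [Set.disjoint_left]
        intro t ht ht'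
        have := (h1 q hq).2.2.1
        have := (i1 q' hq').1
        linarith [ht.2, ht'.1]
      refine ⟨Q₁ ∪ Q₂, fun q hq => ?_, fun q hq q' hq' hne => ?_, ?_⟩
      · rcases Finset.mem_union.mp hq with hq | hq
        · obtain ⟨j1, j2, j3, j4⟩ := h1 q hq
          refine ⟨j1, j2, j3.trans hx.2.le, fun t ht => ?_⟩
          rcases Finset.mem_insert.mp ht with rfl | ht
          · exact fun h => absurd h.2 (not_lt.mpr j3)
          · exact j4 t ht
        · obtain ⟨j1, j2, j3, j4⟩ := i1 q hq
          refine ⟨hx.1.le.trans j1, j2, j3, fun t ht => ?_⟩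
          rcases Finset.mem_insert.mp ht with rfl | ht
          · exact fun h => absurd h.1 (not_lt.mpr j1)
          · exact j4 t ht
      · rcases Finset.mem_union.mp hq with hq | hq <;>
          rcases Finset.mem_union.mp hq' with hq' | hq'
        · exact h2 q hq q' hq' hne
        · exact hd q hq q' hq'
        · exact (hd q' hq' q hq).symm
        · exact i2 q hq q' hq' hne
      · rw [Finset.set_biUnion_union, h3, i3, Icc_union_Icc_eq_Icc hx.1.le hx.2.le]
    · obtain ⟨Q, h1, h2, h3⟩ := ih hab
      refine ⟨Q, fun q hq => ?_, h2, h3⟩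
      obtain ⟨j1, j2, j3, j4⟩ := h1 q hq
      refine ⟨j1, j2, j3, fun t ht => ?_⟩
      rcases Finset.mem_insert.mp ht with rfl | ht
      · exact fun h => hx ⟨j1.trans_lt h.1, h.2.trans_le j3⟩
      · exact j4 t ht

theorem exists_paves_strips (T : Finset ℝ) {a b : ℝ} (hab : a < b) :
    ∃ P : Finset (Set (ℝ × ℝ)), Paves P (Icc (0 : ℝ) 1 ×ˢ Icc a b) ∧
      ∀ K ∈ P, ∃ c d : ℝ, a ≤ c ∧ c < d ∧ d ≤ b ∧ (∀ t ∈ T, t ∉ Ioo c d) ∧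
        K = Icc (0 : ℝ) 1 ×ˢ Icc c d := by
  classical
  obtain ⟨Q, h1, h2, h3⟩ := exists_partition_Icc T hab
  refine ⟨Q.image (fun q => Icc (0 : ℝ) 1 ×ˢ Icc q.1 q.2), ⟨fun K hK => ?_, fun K hK L hL hne => ?_,
    ?_⟩, fun K hK => ?_⟩
  · obtain ⟨q, hq, rfl⟩ := Finset.mem_image.mp hK
    have hlt := (h1 q hq).2.1
    refine ⟨⟨({0, 1} : Finset ℝ) ×ˢ ({q.1, q.2} : Finset ℝ), ?_⟩, ?_⟩
    · rw [Finset.coe_product, convexHull_prod]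
      simp only [Finset.coe_insert, Finset.coe_singleton]
      rw [convexHull_pair, convexHull_pair, segment_eq_Icc zero_le_one, segment_eq_Icc hlt.le]
    · rw [interior_prod_eq, interior_Icc, interior_Icc]
      exact (nonempty_Ioo.mpr zero_lt_one).prod (nonempty_Ioo.mpr hlt)
  · obtain ⟨q, hq, rfl⟩ := Finset.mem_image.mp hK
    obtain ⟨q', hq', rfl⟩ := Finset.mem_image.mp hL
    simp only [interior_prod_eq, interior_Icc]
    exact Set.disjoint_prod.mpr (Or.inr (h2 q hq q' hq' (fun e => hne (by rw [e]))))
  · rw [Finset.set_biUnion_finset_image, ← h3]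
    ext z
    simp only [mem_iUnion, mem_prod]
    constructor
    · rintro ⟨q, hq, hz1, hz2⟩; exact ⟨hz1, q, hq, hz2⟩
    · rintro ⟨hz1, q, hq, hz2⟩; exact ⟨q, hq, hz1, hz2⟩
  · obtain ⟨q, hq, rfl⟩ := Finset.mem_image.mp hK
    obtain ⟨j1, j2, j3, j4⟩ := h1 q hq
    exact ⟨q.1, q.2, j1, j2, j3, j4, rfl⟩

end Pavings

/-! ### Bringing a path to rest at a break point. -/

section Collapse

variable {n : ℕ} {M : Type*} [TopologicalSpace M] [ChartedSpace (EuclideanSpace ℝ (Fin n)) M]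

/-- The family of maps of the line that moves a neighbourhood of `b` into `b`, without passing
beyond it; the point `x` is moved at time `s` to `collapse f (s, x)`. -/
noncomputable def collapse {b : ℝ} (f : ContDiffBump b) (z : ℝ × ℝ) : ℝ :=
  b + (1 - z.1 * f z.2) * (z.2 - b)

variable {b : ℝ} (f : ContDiffBump b)

theorem contDiff_collapse : ContDiff ℝ ∞ (collapse f) := by
  unfold collapse
  have : ContDiff ℝ ∞ f := f.contDiff
  fun_prop

theorem collapse_zero (x : ℝ) : collapse f (0, x) = x := by
  simp [collapse]

theorem collapse_of_rOut_le (s : ℝ) {x : ℝ} (h : f.rOut ≤ dist x b) : collapse f (s, x) = x := by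
  simp [collapse, f.zero_of_le_dist h]

theorem collapse_of_mem (s : ℝ) {x : ℝ} (h : x ∈ Metric.closedBall b f.rIn) :
    collapse f (s, x) = b + (1 - s) * (x - b) := by
  simp [collapse, f.one_of_mem_closedBall h]

theorem collapse_mem_Icc {s x : ℝ} (hs : s ∈ Icc (0 : ℝ) 1) (hx : b ≤ x) :
    collapse f (s, x) ∈ Icc b x := by
  have h0 := f.nonneg (x := x)
  have h1 := f.le_one (x := x)
  have h2 : s * f x ≤ 1 := by nlinarith [hs.1, hs.2]
  have h3 : 0 ≤ s * f x := mul_nonneg hs.1 h0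
  simp only [collapse]
  constructor <;> nlinarith

theorem collapse_mem_Icc' {s x : ℝ} (hs : s ∈ Icc (0 : ℝ) 1) (hx : x ≤ b) :
    collapse f (s, x) ∈ Icc x b := by
  have h0 := f.nonneg (x := x)
  have h1 := f.le_one (x := x)
  have h2 : s * f x ≤ 1 := by nlinarith [hs.1, hs.2]
  have h3 : 0 ≤ s * f x := mul_nonneg hs.1 h0
  simp only [collapse]
  constructor <;> nlinarith

variable {g : ℝ → M} {ε : ℝ}

/-- The collapse never carries a point past `b`, so near `x₀` only one smooth branch of `g` is
involved. -/
theorem contMDiffWithinAt_comp_collapse_of_ne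
    (hg₁ : ContMDiffOn 𝓘(ℝ, ℝ) (𝓡 n) ∞ g (Icc (b - ε) b))
    (hg₂ : ContMDiffOn 𝓘(ℝ, ℝ) (𝓡 n) ∞ g (Icc b (b + ε)))
    {s₀ x₀ : ℝ} (hs₀ : s₀ ∈ Icc (0 : ℝ) 1) (hne : x₀ ≠ b) (hx₀ : x₀ ∈ Ioo (b - ε) (b + ε)) :
    ContMDiffWithinAt 𝓘(ℝ, ℝ × ℝ) (𝓡 n) ∞ (fun z => g (collapse f z)) (Icc 0 1 ×ˢ univ)
      (s₀, x₀) := by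
  have hc : ∀ U : Set (ℝ × ℝ), ContMDiffOn 𝓘(ℝ, ℝ × ℝ) 𝓘(ℝ, ℝ) ∞ (collapse f) U :=
    fun U => (contDiff_collapse f).contMDiff.contMDiffOn
  rcases lt_or_gt_of_ne hne with h | h
  · have := hg₁.comp (hc (Icc 0 1 ×ˢ Ioo (b - ε) b)) (fun z hz => by
      have := collapse_mem_Icc' f hz.1 hz.2.2.le
      exact ⟨hz.2.1.le.trans this.1, this.2⟩)
    refine (this (s₀, x₀) ⟨hs₀, hx₀.1, h⟩).mono_of_mem_nhdsWithin ?_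
    exact nhdsWithin_prod self_mem_nhdsWithin
      (mem_nhdsWithin_of_mem_nhds (Ioo_mem_nhds hx₀.1 h))
  · have := hg₂.comp (hc (Icc 0 1 ×ˢ Ioo b (b + ε))) (fun z hz => by
      have := collapse_mem_Icc f hz.1 hz.2.1.le
      exact ⟨this.1, this.2.trans hz.2.2.le⟩)
    refine (this (s₀, x₀) ⟨hs₀, h, hx₀.2⟩).mono_of_mem_nhdsWithin ?_
    exact nhdsWithin_prod self_mem_nhdsWithin
      (mem_nhdsWithin_of_mem_nhds (Ioo_mem_nhds h hx₀.2))

/-- Three cases at `t₀`. Far from `b` the collapse is the identity and `g ∘ φ` is smooth by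
assumption. Near but off `b`, a single branch of `g` is used. If `φ t₀ = b`, the collapse is scaling
by `1 - s` about `b`, and in a chart the statement is `contDiffWithinAt_comp_mul`. -/
theorem contMDiffOn_comp_collapse [IsManifold (𝓡 n) ∞ M] (hε : 0 < ε) (hf : f.rOut < ε)
    (hg₁ : ContMDiffOn 𝓘(ℝ, ℝ) (𝓡 n) ∞ g (Icc (b - ε) b))
    (hg₂ : ContMDiffOn 𝓘(ℝ, ℝ) (𝓡 n) ∞ g (Icc b (b + ε))) {φ : ℝ → ℝ} {S : Set ℝ}
    (hφ : ContDiffOn ℝ ∞ φ S) (hgφ : ContMDiffOn 𝓘(ℝ, ℝ) (𝓡 n) ∞ (fun t => g (φ t)) S) :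
    ContMDiffOn 𝓘(ℝ, ℝ × ℝ) (𝓡 n) ∞ (fun z : ℝ × ℝ => g (collapse f (z.1, φ z.2)))
      (Icc 0 1 ×ˢ S) := by
  rintro ⟨s₀, t₀⟩ ⟨hs₀, ht₀⟩
  simp only at hs₀ ht₀
  have hsnd : ContMDiffWithinAt 𝓘(ℝ, ℝ × ℝ) 𝓘(ℝ, ℝ) ∞ (Prod.snd : ℝ × ℝ → ℝ) (Icc 0 1 ×ˢ S)
    (s₀, t₀) := (contDiff_snd.contMDiff _).contMDiffWithinAt
  have hφ2 : ContDiffOn ℝ ∞ (fun z : ℝ × ℝ => (z.1, φ z.2)) (Icc 0 1 ×ˢ S) :=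
    contDiff_fst.contDiffOn.prodMk (hφ.comp contDiff_snd.contDiffOn (fun z hz => hz.2))
  rcases le_or_gt ε (dist (φ t₀) b) with hfar | hnear
  · have h1 : ContMDiffWithinAt 𝓘(ℝ, ℝ × ℝ) (𝓡 n) ∞ (fun z : ℝ × ℝ => g (φ z.2)) (Icc 0 1 ×ˢ S)
        (s₀, t₀) :=
      ContMDiffWithinAt.comp (g := fun t => g (φ t)) (s₀, t₀) (hgφ t₀ ht₀) hsnd (fun z hz => hz.2)
    refine h1.congr_of_eventuallyEq_of_mem ?_ ⟨hs₀, ht₀⟩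
    have h2 : ∀ᶠ t in nhdsWithin t₀ S, f.rOut < dist (φ t) b :=
      ((hφ.continuousOn t₀ ht₀).dist continuousWithinAt_const).eventually
        (lt_mem_nhds (hf.trans_le hfar))
    have h3 : ∀ᶠ z in nhdsWithin (s₀, t₀) (Icc (0 : ℝ) 1 ×ˢ S), f.rOut < dist (φ z.2) b := by
      rw [nhdsWithin_prod_eq]
      exact h2.prod_inr _
    filter_upwards [h3] with z hz
    rw [collapse_of_rOut_le f _ hz.le]
  by_cases hb : φ t₀ = b
  · have hgb : ContinuousAt g b := by
      have h1 : ContinuousOn g (Icc (b - ε) b ∪ Icc b (b + ε)) :=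
        hg₁.continuousOn.union_of_isClosed hg₂.continuousOn isClosed_Icc isClosed_Icc
      rw [Icc_union_Icc_eq_Icc (by linarith) (by linarith)] at h1
      exact h1.continuousAt (Icc_mem_nhds (by linarith) (by linarith))
    obtain ⟨δ, hδ, hsub⟩ : ∃ δ > 0, ∀ x ∈ Icc (b - δ) (b + δ),
        x ∈ Metric.closedBall b f.rIn ∧ x ∈ Icc (b - ε) (b + ε) ∧
          g x ∈ (chartAt (EuclideanSpace ℝ (Fin n)) (g b)).source := by
      have h1 : ∀ᶠ x in nhds b, x ∈ Metric.closedBall b f.rIn ∧ x ∈ Icc (b - ε) (b + ε) ∧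
          g x ∈ (chartAt (EuclideanSpace ℝ (Fin n)) (g b)).source :=
        (Filter.eventually_mem_set.mpr (Metric.closedBall_mem_nhds b f.rIn_pos)).and
          ((Filter.eventually_mem_set.mpr (Icc_mem_nhds (by linarith) (by linarith))).and
          (hgb.eventually_mem (chart_source_mem_nhds _ _)))
      obtain ⟨δ, hδ, h2⟩ := Metric.nhds_basis_closedBall.eventually_iff.mp h1
      refine ⟨δ, hδ, fun x hx => h2 ?_⟩
      rwa [Real.closedBall_eq_Icc]
    set e := extChartAt (𝓡 n) (g b) with he
    have hext : ContMDiffOn (𝓡 n) 𝓘(ℝ, EuclideanSpace ℝ (Fin n)) ∞ e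
        (chartAt (EuclideanSpace ℝ (Fin n)) (g b)).source := contMDiffOn_extChartAt
    have hchart : ∀ U ⊆ Icc (b - δ) (b + δ), ContMDiffOn 𝓘(ℝ, ℝ) (𝓡 n) ∞ g U →
        ContDiffOn ℝ ∞ (fun x => e (g x)) U := by
      intro U hU h
      rw [← contMDiffOn_iff_contDiffOn]
      exact hext.comp h
        (fun x hx => (hsub x (hU hx)).2.2)
    have hshift : ContDiff ℝ ∞ (fun x : ℝ => b + x) := by fun_prop
    have c1 : ContDiffOn ℝ ∞ (fun x => e (g (b + x))) (Icc (-δ) 0) := by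
      have := hchart (Icc (b - δ) b) (Icc_subset_Icc_right (by linarith)) (hg₁.mono (fun x hx =>
        ⟨(hsub x ⟨hx.1, by linarith [hx.2]⟩).2.1.1, hx.2⟩))
      exact this.comp hshift.contDiffOn (fun x hx => ⟨by linarith [hx.1], by linarith [hx.2]⟩)
    have c2 : ContDiffOn ℝ ∞ (fun x => e (g (b + x))) (Icc 0 δ) := by
      have := hchart (Icc b (b + δ)) (Icc_subset_Icc_left (by linarith)) (hg₂.mono (fun x hx =>
        ⟨hx.1, (hsub x ⟨by linarith [hx.1], hx.2⟩).2.1.2⟩))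
      exact this.comp hshift.contDiffOn (fun x hx => ⟨by linarith [hx.1], by linarith [hx.2]⟩)
    have hsrc : ∀ x ∈ Icc (b - δ) (b + δ), g x ∈ (extChartAt (𝓡 n) (g b)).source := fun x hx => by
      rw [extChartAt_source]; exact (hsub x hx).2.2
    have hmemb : b ∈ Icc (b - δ) (b + δ) := ⟨by linarith, by linarith⟩
    have c3 : ContDiffWithinAt ℝ ∞ (fun t => e (g (b + (φ t - b)))) S t₀ := by
      simp only [add_sub_cancel]
      rw [← contMDiffWithinAt_iff_contDiffWithinAt]
      exact (hext.contMDiffAt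
        (chart_source_mem_nhds _ _)).comp_contMDiffWithinAt_of_eq (hgφ t₀ ht₀) (by rw [hb])
    have c4 := contDiffWithinAt_comp_mul (f := fun x => e (g (b + x))) hδ c1 c2
      (φ := fun t => φ t - b) ht₀ hs₀ (by rw [hb, sub_self])
      ((hφ t₀ ht₀).sub contDiffWithinAt_const) c3
    have hev : ∀ᶠ z in nhdsWithin (s₀, t₀) (Icc (0 : ℝ) 1 ×ˢ S),
        φ z.2 ∈ Icc (b - δ) (b + δ) := by
      rw [nhdsWithin_prod_eq]
      refine Filter.Eventually.prod_inr
        (((hφ.continuousOn t₀ ht₀).eventually_mem ?_)) _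
      rw [hb]
      exact Icc_mem_nhds (by linarith) (by linarith)
    have hsymm : ContMDiffAt 𝓘(ℝ, EuclideanSpace ℝ (Fin n)) (𝓡 n) ∞ e.symm (e (g b)) :=
      (contMDiffOn_extChartAt_symm (g b)).contMDiffAt
        (extChartAt_target_mem_nhds (g b))
    have c5 := hsymm.comp_contMDiffWithinAt_of_eq (x := (s₀, t₀)) c4.contMDiffWithinAt
      (by simp only [hb, sub_self, mul_zero, add_zero])
    refine c5.congr_of_eventuallyEq_of_mem ?_ ⟨hs₀, ht₀⟩
    filter_upwards [hev, self_mem_nhdsWithin] with z hz hzS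
    simp only [Function.comp]
    rw [collapse_of_mem f _ (hsub _ hz).1, (extChartAt (𝓡 n) (g b)).left_inv]
    refine hsrc _ ?_
    have h1 : 0 ≤ 1 - z.1 := by linarith [hzS.1.2]
    have h2 : 1 - z.1 ≤ 1 := by linarith [hzS.1.1]
    constructor <;> nlinarith [hz.1, hz.2]
  · have hIoo : φ t₀ ∈ Ioo (b - ε) (b + ε) := by
      rw [← Real.ball_eq_Ioo]; exact hnear
    have h1 := contMDiffWithinAt_comp_collapse_of_ne f hg₁ hg₂ hs₀ hb hIoo
    exact ContMDiffWithinAt.comp (f := fun z : ℝ × ℝ => (z.1, φ z.2))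
      (g := fun z => g (collapse f z)) (s₀, t₀) h1
      ((hφ2 (s₀, t₀) ⟨hs₀, ht₀⟩).contMDiffWithinAt) (fun z hz => ⟨hz.1, trivial⟩)

/-- At time one a whole neighbourhood of `b` is mapped to `b`, so the path is locally constant there
and the break disappears. -/
theorem contMDiffOn_comp_collapse_one (hε : 0 < ε) (hf : f.rOut < ε)
    (hg₁ : ContMDiffOn 𝓘(ℝ, ℝ) (𝓡 n) ∞ g (Icc (b - ε) b))
    (hg₂ : ContMDiffOn 𝓘(ℝ, ℝ) (𝓡 n) ∞ g (Icc b (b + ε))) {a d : ℝ} (had : a < d)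
    (hg : ∀ a' d' : ℝ, a ≤ a' → a' < d' → d' ≤ d → b ∉ Ioo a' d' →
      ContMDiffOn 𝓘(ℝ, ℝ) (𝓡 n) ∞ g (Icc a' d')) :
    ContMDiffOn 𝓘(ℝ, ℝ) (𝓡 n) ∞ (fun t => g (collapse f (1, t))) (Icc a d) := by
  intro t₀ ht₀
  rcases le_or_gt ε (dist t₀ b) with hfar | hnear
  · have h1 : ContMDiffWithinAt 𝓘(ℝ, ℝ) (𝓡 n) ∞ g (Icc a d) t₀ := by
      have hne : t₀ ≠ b := by
        rintro rfl; rw [dist_self] at hfar; linarith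
      rcases lt_or_gt_of_ne hne with h | h
      · have := hg a (min d b) le_rfl (lt_min had (ht₀.1.trans_lt h)) (min_le_left _ _)
          (fun hb => absurd hb.2 (not_lt.mpr (min_le_right _ _)))
        refine (this t₀ ⟨ht₀.1, le_min ht₀.2 h.le⟩).mono_of_mem_nhdsWithin ?_
        filter_upwards [self_mem_nhdsWithin, mem_nhdsWithin_of_mem_nhds (Iio_mem_nhds h)]
          with t ht ht'
        exact ⟨ht.1, le_min ht.2 (le_of_lt ht')⟩
      · have := hg (max a b) d (le_max_left _ _) (max_lt had (h.trans_le ht₀.2)) le_rfl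
          (fun hb => absurd hb.1 (not_lt.mpr (le_max_right _ _)))
        refine (this t₀ ⟨max_le ht₀.1 h.le, ht₀.2⟩).mono_of_mem_nhdsWithin ?_
        filter_upwards [self_mem_nhdsWithin, mem_nhdsWithin_of_mem_nhds (Ioi_mem_nhds h)]
          with t ht ht'
        exact ⟨max_le ht.1 (le_of_lt ht'), ht.2⟩
    refine h1.congr_of_eventuallyEq_of_mem ?_ ht₀
    have h2 : ∀ᶠ t in nhds t₀, f.rOut < dist t b :=
      (continuousAt_id.dist continuousAt_const).eventually (lt_mem_nhds (hf.trans_le hfar))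
    filter_upwards [mem_nhdsWithin_of_mem_nhds h2] with t ht
    rw [collapse_of_rOut_le f _ (le_of_lt ht)]
  by_cases hb : t₀ = b
  · refine (contMDiffWithinAt_const (c := g b)).congr_of_eventuallyEq_of_mem ?_ ht₀
    filter_upwards [mem_nhdsWithin_of_mem_nhds
      (hb ▸ Metric.closedBall_mem_nhds b f.rIn_pos : Metric.closedBall b f.rIn ∈ nhds t₀)]
      with t ht
    rw [collapse_of_mem f _ ht, sub_self, zero_mul, add_zero]
  · have hIoo : t₀ ∈ Ioo (b - ε) (b + ε) := by
      rw [← Real.ball_eq_Ioo]; exact hnear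
    have h1 := contMDiffWithinAt_comp_collapse_of_ne f hg₁ hg₂ (right_mem_Icc.mpr zero_le_one)
      hb hIoo
    have h2 : ContDiff ℝ ∞ (fun t : ℝ => ((1 : ℝ), t)) := by fun_prop
    exact ContMDiffWithinAt.comp (f := fun t : ℝ => ((1 : ℝ), t))
      (g := fun z => g (collapse f z)) t₀ h1 (h2.contMDiff _).contMDiffWithinAt
      (fun z hz => ⟨right_mem_Icc.mpr zero_le_one, trivial⟩)

end Collapse

/-! ### Criteria for paved and thin homotopies. -/

section Thin

variable {n : ℕ} {M : Type*} [TopologicalSpace M] [ChartedSpace (EuclideanSpace ℝ (Fin n)) M]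
  {p : M}

/-- A homotopy through piecewise-smooth paths that is smooth on every polygon of a polygonal
paving. -/
def IsPaved (n : ℕ) {M : Type*} [TopologicalSpace M] [ChartedSpace (EuclideanSpace ℝ (Fin n)) M]
    {x y : M} {γ₀ γ₁ : Path x y} (η : Path.Homotopy γ₀ γ₁) : Prop :=
  (∀ s : I, IsPiecewiseSmooth (𝓡 n) (η.eval s)) ∧
    ∃ P : Finset (Set (ℝ × ℝ)), IsPolygonalPaving P ∧ ∀ K ∈ P,
      ContMDiffOn 𝓘(ℝ, ℝ × ℝ) (𝓡 n) ∞
        (fun z : ℝ × ℝ =>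
          η (projIcc (0 : ℝ) 1 zero_le_one z.1, projIcc (0 : ℝ) 1 zero_le_one z.2)) K

theorem thinHomotopic_of_isPaved {γ₀ γ₁ : PSLoop n p} {η : Path.Homotopy γ₀.1 γ₁.1}
    (h : IsPaved n η) (hr : range η ⊆ range γ₀.1 ∪ range γ₁.1) : ThinHomotopic γ₀ γ₁ :=
  ⟨η, h.1, h.2, hr⟩

/-- Most homotopies used here break only along lines of constant `t`, so rectangular strips suffice
as paving, and smoothness of each slice comes for free. -/
theorem isPaved_of_strips {x y : M} {γ₀ γ₁ : Path x y} (η : Path.Homotopy γ₀ γ₁) (T : Finset ℝ)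
    (F : ℝ × ℝ → M) (hF : ∀ s t : I, η (s, t) = F (s, t))
    (hsm : ∀ a b : ℝ, 0 ≤ a → a < b → b ≤ 1 → (∀ t ∈ T, t ∉ Ioo a b) →
      ContMDiffOn 𝓘(ℝ, ℝ × ℝ) (𝓡 n) ∞ F (Icc 0 1 ×ˢ Icc a b)) : IsPaved n η := by
  refine ⟨fun s => ⟨T, fun a b ha hab hb hT => ?_⟩, ?_⟩
  · have h1 : ContDiff ℝ ∞ (fun t : ℝ => ((s : ℝ), t)) := by fun_prop
    have h2 := (hsm a b ha hab hb hT).comp h1.contMDiff.contMDiffOn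
      (fun t (ht : t ∈ Icc a b) => ⟨s.2, ht⟩)
    refine h2.congr fun t ht => ?_
    have ht' : t ∈ I := ⟨ha.trans ht.1, ht.2.trans hb⟩
    rw [Path.extend_apply _ ht']
    exact hF s ⟨t, ht'⟩
  · obtain ⟨P, hP, h⟩ := exists_paves_strips T (zero_lt_one (α := ℝ))
    refine ⟨P, hP, fun K hK => ?_⟩
    obtain ⟨c, d, hc, hcd, hd, hT, rfl⟩ := h K hK
    refine (hsm c d hc hcd hd hT).congr fun z hz => ?_
    rw [hF, projIcc_of_mem zero_le_one hz.1,
      projIcc_of_mem zero_le_one ⟨hc.trans hz.2.1, hz.2.2.trans hd⟩]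

/-- A homotopy that only moves the parameter of `γ` stays in the image of `γ`; thinness then needs
only that the two ends cover this image. -/
theorem thinHomotopic_comp (γ : PSLoop n p) {γ₀ γ₁ : PSLoop n p} (H : ℝ × ℝ → ℝ)
    (hH : Continuous H) (h₀ : ∀ t : I, γ₀.1 t = γ.1.extend (H (0, t)))
    (h₁ : ∀ t : I, γ₁.1 t = γ.1.extend (H (1, t)))
    (hs₀ : ∀ s : I, γ.1.extend (H (s, 0)) = p) (hs₁ : ∀ s : I, γ.1.extend (H (s, 1)) = p)
    (T : Finset ℝ)
    (hsm : ∀ a b : ℝ, 0 ≤ a → a < b → b ≤ 1 → (∀ t ∈ T, t ∉ Ioo a b) →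
      ContMDiffOn 𝓘(ℝ, ℝ × ℝ) (𝓡 n) ∞ (fun z => γ.1.extend (H z)) (Icc 0 1 ×ˢ Icc a b))
    (hr : range γ.1 ⊆ range γ₀.1 ∪ range γ₁.1) : ThinHomotopic γ₀ γ₁ := by
  let η : Path.Homotopy γ₀.1 γ₁.1 :=
    { toFun := fun z => γ.1.extend (H (z.1, z.2))
      continuous_toFun := by fun_prop
      map_zero_left := fun t => (h₀ t).symm
      map_one_left := fun t => (h₁ t).symm
      prop' := fun s t ht => by
        rcases ht with rfl | rfl
        · exact (hs₀ s).trans γ₀.1.source.symm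
        · exact (hs₁ s).trans γ₀.1.target.symm }
  refine thinHomotopic_of_isPaved
    (isPaved_of_strips η T (fun z => γ.1.extend (H z)) (fun _ _ => rfl) hsm) ?_
  rintro _ ⟨z, rfl⟩
  refine hr ?_
  rw [← Path.extend_range]
  exact mem_range_self _

theorem thin_of_homotopic {γ γ' : PSLoop n p} (h : ThinHomotopic γ γ') : (thinSetoid n p).r γ γ' :=
  Relation.EqvGen.rel _ _ h

end Thin

/-! ### Generalized reparametrizations preserve the thin class. -/

section Reparametrization

variable {n : ℕ} {M : Type*} [TopologicalSpace M] [ChartedSpace (EuclideanSpace ℝ (Fin n)) M]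
  {p : M}

theorem extend_mem_unitInterval {φ : Path (0 : ℝ) 1} (hφ : ∀ t, φ t ∈ Icc (0 : ℝ) 1) (t : ℝ) :
    φ.extend t ∈ Icc (0 : ℝ) 1 := hφ _

theorem extend_eq_of_reparam {γ γ' : PSLoop n p} {φ : Path (0 : ℝ) 1}
    {hφ : ∀ t, φ t ∈ Icc (0 : ℝ) 1} (h : ∀ t : I, γ'.1 t = γ.1 ⟨φ t, hφ t⟩) (t : ℝ) :
    γ'.1.extend t = γ.1.extend (φ.extend t) := by
  rw [γ.1.extend_apply (extend_mem_unitInterval hφ t)]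
  exact h _

theorem range_eq_of_reparam {γ γ' : PSLoop n p} {φ : Path (0 : ℝ) 1}
    {hφ : ∀ t, φ t ∈ Icc (0 : ℝ) 1} (h : ∀ t : I, γ'.1 t = γ.1 ⟨φ t, hφ t⟩) :
    range γ.1 = range γ'.1 := by
  apply Subset.antisymm
  · rintro _ ⟨t, rfl⟩
    have h1 := intermediate_value_univ (f := φ) 0 1 φ.continuous
    rw [φ.source, φ.target] at h1
    obtain ⟨s, hs⟩ := h1 t.2
    exact ⟨s, by rw [h]; congr 1; exact Subtype.ext hs⟩
  · rintro _ ⟨t, rfl⟩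
    exact ⟨_, (h t).symm⟩

/-- A break point can be removed by staying there for a while. -/
theorem exists_bump_of_break {T : Finset ℝ} {b : ℝ} (hb : b ∈ Ioo (0 : ℝ) 1) (hbT : b ∉ T)
    (g : ℝ → M) (hg : ∀ a d : ℝ, 0 ≤ a → a < d → d ≤ 1 → (∀ t ∈ insert b T, t ∉ Ioo a d) →
      ContMDiffOn 𝓘(ℝ, ℝ) (𝓡 n) ∞ g (Icc a d)) :
    ∃ (ε : ℝ) (f : ContDiffBump b), 0 < ε ∧ f.rOut < ε ∧ f.rOut ≤ dist 0 b ∧ f.rOut ≤ dist 1 b ∧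
      ContMDiffOn 𝓘(ℝ, ℝ) (𝓡 n) ∞ g (Icc (b - ε) b) ∧
      ContMDiffOn 𝓘(ℝ, ℝ) (𝓡 n) ∞ g (Icc b (b + ε)) ∧
      ∀ a d : ℝ, 0 ≤ a → a < d → d ≤ 1 → (∀ t ∈ T, t ∉ Ioo a d) →
        ContMDiffOn 𝓘(ℝ, ℝ) (𝓡 n) ∞ (fun t => g (collapse f (1, t))) (Icc a d) := by
  obtain ⟨ε, hε, hε0, hε1, hεT⟩ : ∃ ε > 0, 0 ≤ b - ε ∧ b + ε ≤ 1 ∧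
      ∀ t ∈ T, t ∉ Ioo (b - ε) (b + ε) := by
    have h1 : ((T : Set ℝ)ᶜ ∩ Ioo 0 1) ∈ nhds b :=
      Filter.inter_mem (T.finite_toSet.isClosed.isOpen_compl.mem_nhds hbT) (Ioo_mem_nhds hb.1 hb.2)
    obtain ⟨ε, hε, h2⟩ := Metric.nhds_basis_closedBall.mem_iff.mp h1
    rw [Real.closedBall_eq_Icc] at h2
    exact ⟨ε, hε, (h2 ⟨le_rfl, by linarith⟩).2.1.le, (h2 ⟨by linarith, le_rfl⟩).2.2.le,
      fun t ht h => (h2 (Ioo_subset_Icc_self h)).1 ht⟩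
  let f : ContDiffBump b := ⟨ε / 4, ε / 2, by linarith, by linarith⟩
  have hfε : f.rOut < ε := by change ε / 2 < ε; linarith
  have hg₁ : ContMDiffOn 𝓘(ℝ, ℝ) (𝓡 n) ∞ g (Icc (b - ε) b) := by
    refine hg _ _ hε0 (by linarith) hb.2.le fun t ht h => ?_
    rcases Finset.mem_insert.mp ht with rfl | ht
    · exact lt_irrefl _ h.2
    · exact hεT t ht ⟨h.1, by linarith [h.2]⟩
  have hg₂ : ContMDiffOn 𝓘(ℝ, ℝ) (𝓡 n) ∞ g (Icc b (b + ε)) := by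
    refine hg _ _ hb.1.le (by linarith) hε1 fun t ht h => ?_
    rcases Finset.mem_insert.mp ht with rfl | ht
    · exact lt_irrefl _ h.1
    · exact hεT t ht ⟨by linarith [h.1], h.2⟩
  have hfar0 : f.rOut ≤ dist 0 b := by
    change ε / 2 ≤ _
    rw [Real.dist_eq, zero_sub, abs_neg, abs_of_pos hb.1]; linarith
  have hfar1 : f.rOut ≤ dist 1 b := by
    change ε / 2 ≤ _
    rw [Real.dist_eq, abs_of_pos (by linarith [hb.2])]; linarith
  refine ⟨ε, f, hε, hfε, hfar0, hfar1, hg₁, hg₂, fun a d ha had hd hT => ?_⟩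
  refine contMDiffOn_comp_collapse_one f hε hfε hg₁ hg₂ had fun a' d' ha' had' hd' hb' => ?_
  refine hg _ _ (ha.trans ha') had' (hd'.trans hd) fun t ht h => ?_
  rcases Finset.mem_insert.mp ht with rfl | ht
  · exact hb' h
  · exact hT t ht ⟨ha'.trans_lt h.1, h.2.trans_le hd'⟩

/-- Replacing `γ` by the loop that stays at `γ b` for a while removes the break point `b`, and
does not change the thin class of any of its reparametrizations. -/
theorem exists_removed_break [IsManifold (𝓡 n) ∞ M] {T : Finset ℝ} {b : ℝ} (hb : b ∈ Ioo (0 : ℝ) 1)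
    (hbT : b ∉ T) (γ : PSLoop n p)
    (hγ : ∀ a d : ℝ, 0 ≤ a → a < d → d ≤ 1 → (∀ t ∈ insert b T, t ∉ Ioo a d) →
      ContMDiffOn 𝓘(ℝ, ℝ) (𝓡 n) ∞ γ.1.extend (Icc a d)) :
    ∃ γ₁ : PSLoop n p,
      (∀ a d : ℝ, 0 ≤ a → a < d → d ≤ 1 → (∀ t ∈ T, t ∉ Ioo a d) →
        ContMDiffOn 𝓘(ℝ, ℝ) (𝓡 n) ∞ γ₁.1.extend (Icc a d)) ∧
      ∀ (γ' : PSLoop n p) (φ : Path (0 : ℝ) 1), IsPiecewiseSmooth 𝓘(ℝ, ℝ) φ →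
        ∀ hφ : ∀ t, φ t ∈ Icc (0 : ℝ) 1, (∀ t : I, γ'.1 t = γ.1 ⟨φ t, hφ t⟩) →
        ∃ γ₁' : PSLoop n p, ThinHomotopic γ' γ₁' ∧ ∀ t : I, γ₁'.1 t = γ₁.1 ⟨φ t, hφ t⟩ := by
  obtain ⟨ε, f, hε, hfε, hfar0, hfar1, hg₁, hg₂, hcol⟩ := exists_bump_of_break hb hbT _ hγ
  have hcont : Continuous (collapse f) := (contDiff_collapse f).continuous
  let γ₁p : Path p p :=
    { toFun := fun t => γ.1.extend (collapse f (1, t))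
      continuous_toFun := by fun_prop
      source' := by simp [collapse_of_rOut_le f 1 hfar0]
      target' := by simp [collapse_of_rOut_le f 1 hfar1] }
  have hγ₁ : ∀ a d : ℝ, 0 ≤ a → a < d → d ≤ 1 → (∀ t ∈ T, t ∉ Ioo a d) →
      ContMDiffOn 𝓘(ℝ, ℝ) (𝓡 n) ∞ γ₁p.extend (Icc a d) := by
    intro a d ha had hd hT
    refine (hcol a d ha had hd hT).congr fun t ht => ?_
    rw [Path.extend_apply _ ⟨ha.trans ht.1, ht.2.trans hd⟩]; rfl
  refine ⟨⟨γ₁p, T, hγ₁⟩, hγ₁, fun γ' φ hφs hφ hγ' => ?_⟩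
  have hext := extend_eq_of_reparam hγ'
  obtain ⟨T₁, hT₁⟩ := hφs
  obtain ⟨T₂, hT₂⟩ := γ'.2
  have hsm : ∀ a d : ℝ, 0 ≤ a → a < d → d ≤ 1 → (∀ t ∈ T₁ ∪ T₂, t ∉ Ioo a d) →
      ContMDiffOn 𝓘(ℝ, ℝ × ℝ) (𝓡 n) ∞
        (fun z => γ.1.extend (collapse f (z.1, φ.extend z.2))) (Icc 0 1 ×ˢ Icc a d) := by
    intro a d ha had hd hT
    refine contMDiffOn_comp_collapse f hε hfε hg₁ hg₂
      (contMDiffOn_iff_contDiffOn.mp (hT₁ a d ha had hd fun t ht => hT t ?_)) ?_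
    · exact Finset.mem_union_left _ ht
    · simp only [← hext]
      exact hT₂ a d ha had hd fun t ht => hT t (Finset.mem_union_right _ ht)
  let γ₁'p : Path p p :=
    { toFun := fun t => γ.1.extend (collapse f (1, φ t))
      continuous_toFun := by fun_prop
      source' := by simp [collapse_of_rOut_le f 1 hfar0]
      target' := by simp [collapse_of_rOut_le f 1 hfar1] }
  have hγ₁' : IsPiecewiseSmooth (𝓡 n) γ₁'p := by
    refine ⟨T₁ ∪ T₂, fun a d ha had hd hT => ?_⟩
    have h1 : ContDiff ℝ ∞ (fun t : ℝ => ((1 : ℝ), t)) := by fun_prop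
    refine ((hsm a d ha had hd hT).comp h1.contMDiff.contMDiffOn
      (fun t (ht : t ∈ Icc a d) => ⟨right_mem_Icc.mpr zero_le_one, ht⟩)).congr fun t ht => ?_
    have ht' : t ∈ I := ⟨ha.trans ht.1, ht.2.trans hd⟩
    rw [Path.extend_apply _ ht']
    simp only [Function.comp]
    rw [φ.extend_apply ht']
    rfl
  refine ⟨⟨γ₁'p, hγ₁'⟩, ?_, fun t => rfl⟩
  -- The parameter `φ t` is pushed towards `b`. The images of `γ` and `γ ∘ φ` coincide because `φ`
  -- is onto the unit interval, so the homotopy is thin.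
  refine thinHomotopic_comp γ (fun z => collapse f (z.1, φ.extend z.2)) (by fun_prop) ?_ ?_ ?_ ?_
    (T₁ ∪ T₂) hsm ?_
  · intro t
    simp only [collapse_zero, φ.extend_apply t.2]
    rw [γ.1.extend_apply (hφ t)]
    exact hγ' t
  · intro t
    simp only [φ.extend_apply t.2]
    rfl
  · intro s
    simp [collapse_of_rOut_le f _ hfar0]
  · intro s
    simp [collapse_of_rOut_le f _ hfar1]
  · rw [range_eq_of_reparam hγ']
    exact subset_union_left

/-- Induction on the break points of `γ`, each removed by resting there. The breaks of `φ` are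
harmless: they lie on lines of constant `t`. -/
theorem thin_of_reparam_of_breaks [IsManifold (𝓡 n) ∞ M] (T : Finset ℝ) (γ γ' : PSLoop n p)
    (hγ : ∀ a d : ℝ, 0 ≤ a → a < d → d ≤ 1 → (∀ t ∈ T, t ∉ Ioo a d) →
      ContMDiffOn 𝓘(ℝ, ℝ) (𝓡 n) ∞ γ.1.extend (Icc a d))
    (h : IsReparametrization γ γ') : (thinSetoid n p).r γ γ' := by
  induction T using Finset.induction_on generalizing γ γ' with
  | empty =>
    obtain ⟨φ, ⟨T, hT⟩, hφ, hγ'⟩ := h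
    -- With no breaks left, `γ` is smooth on the whole interval and the linear homotopy from the
    -- identity to `φ` can be composed with it.
    have h01 := hγ 0 1 le_rfl zero_lt_one le_rfl (by simp)
    refine thin_of_homotopic (thinHomotopic_comp γ
      (fun z => (1 - z.1) * z.2 + z.1 * φ.extend z.2) (by fun_prop) ?_ ?_ ?_ ?_ T ?_ ?_)
    · intro t
      simp
    · intro t
      simp only [sub_self, zero_mul, one_mul, zero_add, φ.extend_apply t.2]
      rw [γ.1.extend_apply (hφ t)]
      exact hγ' t
    · intro s
      simp
    · intro s
      simp
    · intro a d ha had hd hTad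
      have h1 := contMDiffOn_iff_contDiffOn.mp (hT a d ha had hd hTad)
      have h2 : ContDiffOn ℝ ∞ (fun z : ℝ × ℝ => (1 - z.1) * z.2 + z.1 * φ.extend z.2)
          (Icc 0 1 ×ˢ Icc a d) := by
        have h3 : ContDiffOn ℝ ∞ (fun z : ℝ × ℝ => φ.extend z.2) (Icc 0 1 ×ˢ Icc a d) :=
          h1.comp contDiff_snd.contDiffOn (fun z hz => hz.2)
        exact ((contDiff_const.sub contDiff_fst).mul contDiff_snd).contDiffOn.add
          (contDiff_fst.contDiffOn.mul h3)
      refine h01.comp h2.contMDiffOn fun z hz => ?_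
      have i1 := extend_mem_unitInterval hφ z.2
      have i2 : z.2 ∈ Icc (0 : ℝ) 1 := ⟨ha.trans hz.2.1, hz.2.2.trans hd⟩
      exact (convex_Icc (0 : ℝ) 1) i2 i1 (by linarith [hz.1.2]) hz.1.1 (by ring)
    · exact subset_union_left
  | insert b T hbT ih =>
    by_cases hb : b ∈ Ioo (0 : ℝ) 1
    · obtain ⟨γ₁, hγ₁, hrem⟩ := exists_removed_break hb hbT γ hγ
      obtain ⟨φ, hφs, hφ, hγ'⟩ := h
      obtain ⟨γ₁', h1, h2⟩ := hrem γ' φ hφs hφ hγ'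
      have hid : IsPiecewiseSmooth 𝓘(ℝ, ℝ)
          (⟨⟨fun t : I => (t : ℝ), continuous_subtype_val⟩, rfl, rfl⟩ : Path (0 : ℝ) 1) := by
        refine ⟨∅, fun a d ha had hd _ => ?_⟩
        refine (contMDiff_id.contMDiffOn (s := Icc a d)).congr fun t ht => ?_
        rw [Path.extend_apply _ ⟨ha.trans ht.1, ht.2.trans hd⟩]
        rfl
      -- The identity parameter connects `γ` itself to the rested loop; the parameter `φ` connects
      -- `γ'` to the corresponding reparametrization of the same loop.
      obtain ⟨γ₂, h3, h4⟩ := hrem γ _ hid (fun t => t.2) (fun t => rfl)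
      have h5 : γ₂ = γ₁ := Subtype.ext (Path.ext (funext h4))
      subst h5
      have h6 := ih γ₂ γ₁' hγ₁ ⟨φ, hφs, hφ, h2⟩
      exact (thin_of_homotopic h3).trans _ _ _ (h6.trans _ _ _ ((thin_of_homotopic h1).symm _ _))
    · refine ih γ γ' (fun a d ha had hd hT => hγ a d ha had hd fun t ht => ?_) h
      rcases Finset.mem_insert.mp ht with rfl | ht
      · exact fun h => hb ⟨ha.trans_lt h.1, h.2.trans_le hd⟩
      · exact hT t ht

/-- A generalized reparametrization does not change the thin class. -/
theorem thin_of_reparam [IsManifold (𝓡 n) ∞ M] {γ γ' : PSLoop n p}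
    (h : IsReparametrization γ γ') : (thinSetoid n p).r γ γ' := by
  obtain ⟨T, hT⟩ := γ.2
  exact thin_of_reparam_of_breaks T γ γ' hT h

end Reparametrization

/-! ### Concatenation and reversal of paved homotopies. -/

section PavedHomotopies

variable {n : ℕ} {M : Type*} [TopologicalSpace M] [ChartedSpace (EuclideanSpace ℝ (Fin n)) M]
  {x y z : M}

theorem IsPaved.refl {γ : Path x y} (h : IsPiecewiseSmooth (𝓡 n) γ) :
    IsPaved n (Path.Homotopy.refl γ) := by
  obtain ⟨T, hT⟩ := h
  refine isPaved_of_strips _ T (fun w => γ.extend w.2) (fun s t => ?_) fun a b ha hab hb h => ?_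
  · exact (γ.extend_apply t.2).symm
  · exact ContMDiffOn.comp (g := γ.extend) (hT a b ha hab hb h) contDiff_snd.contMDiff.contMDiffOn
      (fun w hw => hw.2)

theorem IsPaved.symm₂ {γ₀ γ₁ : Path x y} {η : Path.Homotopy γ₀ γ₁} (h : IsPaved n η) :
    IsPaved n η.symm₂ := by
  classical
  refine ⟨fun s => (h.1 s).symm, ?_⟩
  obtain ⟨P, hP, hsm⟩ := h.2
  refine ⟨P.image (fun K => stripHomeo (-1) 1 (by norm_num) '' K), ?_, fun K hK => ?_⟩
  · have h1 := Paves.image hP (-1) 1 (by norm_num)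
    have h2 : stripHomeo (-1) 1 (by norm_num) '' (Icc (0 : ℝ) 1 ×ˢ Icc (0 : ℝ) 1) =
        Icc (0 : ℝ) 1 ×ˢ Icc (0 : ℝ) 1 := by
      ext w
      simp only [mem_image, stripHomeo_apply]
      constructor
      · rintro ⟨v, hv, rfl⟩
        exact ⟨hv.1, by simp only; linarith [hv.2.2], by simp only; linarith [hv.2.1]⟩
      · intro hw
        exact ⟨(w.1, 1 - w.2), ⟨hw.1, by simp only; linarith [hw.2.2], by simp only; linarith [hw.2.1]⟩,
          Prod.ext rfl (by simp only; ring)⟩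
    rw [h2] at h1
    exact h1
  · obtain ⟨K, hK', rfl⟩ := Finset.mem_image.mp hK
    have hKsub := Paves.subset hP hK'
    have h1 : ContDiff ℝ ∞ (fun w : ℝ × ℝ => (w.1, 1 - w.2)) := by fun_prop
    refine ((hsm K hK').comp h1.contMDiff.contMDiffOn ?_).congr ?_
    · rintro _ ⟨w, hw, rfl⟩
      simpa [stripHomeo_apply] using hw
    · rintro _ ⟨w, hw, rfl⟩
      have hw' := hKsub hw
      simp only [Function.comp, stripHomeo_apply, Path.Homotopy.symm₂]
      change η _ = η _
      congr 2
      have e1 : -1 * w.2 + 1 ∈ Icc (0 : ℝ) 1 :=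
        ⟨by linarith [hw'.2.2], by linarith [hw'.2.1]⟩
      rw [projIcc_of_mem zero_le_one e1, projIcc_of_mem zero_le_one (x := 1 - (-1 * w.2 + 1))
        (by convert hw'.2 using 1; ring)]
      rfl

theorem eval_hcomp {p₀ q₀ : Path x y} {p₁ q₁ : Path y z} (F : Path.Homotopy p₀ q₀)
    (G : Path.Homotopy p₁ q₁) (s : I) :
    (F.hcomp G).eval s = (F.eval s).trans (G.eval s) := by
  ext t
  rfl

/-- The two pavings are compressed into the lower and upper halves of the square, whose interiors
are disjoint. -/
theorem IsPaved.hcomp {p₀ q₀ : Path x y} {p₁ q₁ : Path y z} {F : Path.Homotopy p₀ q₀}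
    {G : Path.Homotopy p₁ q₁} (hF : IsPaved n F) (hG : IsPaved n G) : IsPaved n (F.hcomp G) := by
  classical
  refine ⟨fun s => ?_, ?_⟩
  · rw [eval_hcomp]
    exact (hF.1 s).trans (hG.1 s)
  obtain ⟨P, hP, hsm⟩ := hF.2
  obtain ⟨P', hP', hsm'⟩ := hG.2
  have hhalf : (1 / 2 : ℝ) ≠ 0 := by norm_num
  have e1 : stripHomeo (1 / 2) 0 hhalf '' (Icc (0 : ℝ) 1 ×ˢ Icc (0 : ℝ) 1) =
      Icc (0 : ℝ) 1 ×ˢ Icc (0 : ℝ) (1 / 2) := by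
    ext w
    simp only [mem_image, stripHomeo_apply]
    constructor
    · rintro ⟨v, hv, rfl⟩
      exact ⟨hv.1, by simp only; linarith [hv.2.1], by simp only; linarith [hv.2.2]⟩
    · intro hw
      exact ⟨(w.1, 2 * w.2), ⟨hw.1, by simp only; linarith [hw.2.1], by simp only; linarith [hw.2.2]⟩,
        Prod.ext rfl (by simp only; ring)⟩
  have e2 : stripHomeo (1 / 2) (1 / 2) hhalf '' (Icc (0 : ℝ) 1 ×ˢ Icc (0 : ℝ) 1) =
      Icc (0 : ℝ) 1 ×ˢ Icc (1 / 2 : ℝ) 1 := by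
    ext w
    simp only [mem_image, stripHomeo_apply]
    constructor
    · rintro ⟨v, hv, rfl⟩
      exact ⟨hv.1, by simp only; linarith [hv.2.1], by simp only; linarith [hv.2.2]⟩
    · intro hw
      exact ⟨(w.1, 2 * w.2 - 1),
        ⟨hw.1, by simp only; linarith [hw.2.1], by simp only; linarith [hw.2.2]⟩,
        Prod.ext rfl (by simp only; ring)⟩
  have h1 := Paves.image hP (1 / 2) 0 hhalf
  have h2 := Paves.image hP' (1 / 2) (1 / 2) hhalf
  rw [e1] at h1
  rw [e2] at h2
  refine ⟨P.image (fun K => stripHomeo (1 / 2) 0 hhalf '' K) ∪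
      P'.image (fun K => stripHomeo (1 / 2) (1 / 2) hhalf '' K), ?_, fun K hK => ?_⟩
  · have h3 := h1.union h2 (by
      rw [interior_prod_eq, interior_prod_eq, interior_Icc, interior_Icc, interior_Icc]
      refine Set.disjoint_prod.mpr (Or.inr ?_)
      rw [Set.disjoint_left]
      intro t ht ht'
      linarith [ht.2, ht'.1])
    rw [← Set.prod_union, Icc_union_Icc_eq_Icc (by norm_num) (by norm_num)] at h3
    exact h3
  · have hval : ∀ w ∈ Icc (0 : ℝ) 1 ×ˢ Icc (0 : ℝ) 1, F.hcomp G (projIcc (0 : ℝ) 1 zero_le_one w.1,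
        projIcc (0 : ℝ) 1 zero_le_one w.2) =
        ((F.eval (projIcc (0 : ℝ) 1 zero_le_one w.1)).trans
          (G.eval (projIcc (0 : ℝ) 1 zero_le_one w.1))).extend w.2 := by
      intro w hw
      rw [Path.extend_apply _ hw.2, ← eval_hcomp, projIcc_of_mem zero_le_one hw.2]
      rfl
    rcases Finset.mem_union.mp hK with hK | hK
    · obtain ⟨K, hK', rfl⟩ := Finset.mem_image.mp hK
      have hs : ContDiff ℝ ∞ (fun w : ℝ × ℝ => (w.1, 2 * w.2)) := by fun_prop
      have hKsub : stripHomeo (1 / 2) 0 hhalf '' K ⊆ Icc (0 : ℝ) 1 ×ˢ Icc (0 : ℝ) (1 / 2) := by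
        rw [← e1]; exact image_mono (Paves.subset hP hK')
      refine ((hsm K hK').comp hs.contMDiff.contMDiffOn ?_).congr ?_
      · rintro _ ⟨w, hw, rfl⟩
        simpa [stripHomeo_apply] using hw
      · intro w hw
        have hw' := hKsub hw
        rw [hval w ⟨hw'.1, hw'.2.1, by linarith [hw'.2.2]⟩,
          Path.extend_trans_of_le_half _ _ hw'.2.2]
        rfl
    · obtain ⟨K, hK', rfl⟩ := Finset.mem_image.mp hK
      have hs : ContDiff ℝ ∞ (fun w : ℝ × ℝ => (w.1, 2 * w.2 - 1)) := by fun_prop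
      have hKsub : stripHomeo (1 / 2) (1 / 2) hhalf '' K ⊆ Icc (0 : ℝ) 1 ×ˢ Icc (1 / 2 : ℝ) 1 := by
        rw [← e2]; exact image_mono (Paves.subset hP' hK')
      refine ((hsm' K hK').comp hs.contMDiff.contMDiffOn ?_).congr ?_
      · rintro _ ⟨w, hw, rfl⟩
        have : (w.1, 2 * (1 / 2 * w.2 + 1 / 2) - 1) = w := Prod.ext rfl (by simp only; ring)
        rw [mem_preimage, stripHomeo_apply]
        simp only
        rwa [this]
      · intro w hw
        have hw' := hKsub hw
        rw [hval w ⟨hw'.1, by linarith [hw'.2.1], hw'.2.2⟩,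
          Path.extend_trans_of_half_le _ _ hw'.2.1]
        rfl

theorem range_hcomp_subset {p₀ q₀ : Path x y} {p₁ q₁ : Path y z} (F : Path.Homotopy p₀ q₀)
    (G : Path.Homotopy p₁ q₁) : range (F.hcomp G) ⊆ range F ∪ range G := by
  rintro _ ⟨w, rfl⟩
  rw [Path.Homotopy.hcomp_apply]
  split_ifs
  · exact Or.inl ⟨_, rfl⟩
  · exact Or.inr ⟨_, rfl⟩

theorem range_refl (γ : Path x y) : range (Path.Homotopy.refl γ) = range γ := by
  apply Subset.antisymm
  · rintro _ ⟨w, rfl⟩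
    exact ⟨w.2, rfl⟩
  · rintro _ ⟨t, rfl⟩
    exact ⟨(0, t), rfl⟩

variable {p : M}

theorem ThinHomotopic.trans_right {γ γ' : PSLoop n p} (h : ThinHomotopic γ γ') (δ : PSLoop n p) :
    ThinHomotopic (γ.trans δ) (γ'.trans δ) := by
  obtain ⟨η, h1, h2, h3⟩ := h
  refine thinHomotopic_of_isPaved (IsPaved.hcomp (F := η) ⟨h1, h2⟩ (IsPaved.refl δ.2)) ?_
  refine (range_hcomp_subset _ _).trans ?_
  rw [range_refl]
  simp only [PSLoop.trans, Path.trans_range]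
  intro m hm
  rcases hm with hm | hm
  · rcases h3 hm with h | h
    · exact Or.inl (Or.inl h)
    · exact Or.inr (Or.inl h)
  · exact Or.inl (Or.inr hm)

theorem ThinHomotopic.inv {γ γ' : PSLoop n p} (h : ThinHomotopic γ γ') :
    ThinHomotopic γ.symm γ'.symm := by
  obtain ⟨η, h1, h2, h3⟩ := h
  refine thinHomotopic_of_isPaved (IsPaved.symm₂ (η := η) ⟨h1, h2⟩) ?_
  simp only [PSLoop.symm, Path.symm_range]
  refine Subset.trans ?_ h3
  rintro _ ⟨w, rfl⟩
  exact ⟨_, rfl⟩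

end PavedHomotopies

/-! ### Reparametrizations of paths: reversal, concatenation, associativity and units. -/

section Reparametrizations

variable {X : Type*} [TopologicalSpace X] {x y z w : X}

/-- `γ'` is a generalized reparametrization of the path `γ`. -/
def Reparam (γ γ' : Path x y) : Prop :=
  ∃ φ : Path (0 : ℝ) 1, IsPiecewiseSmooth 𝓘(ℝ, ℝ) φ ∧ (∀ t, φ t ∈ Icc (0 : ℝ) 1) ∧
    ∀ t ∈ Icc (0 : ℝ) 1, γ'.extend t = γ.extend (φ.extend t)

/-- A path from `0` to `1` rescaled to a path from `a` to `b`. -/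
noncomputable def rescale (φ : Path (0 : ℝ) 1) (a b : ℝ) : Path a b where
  toFun t := a + (b - a) * φ t
  continuous_toFun := by fun_prop
  source' := by simp
  target' := by simp

theorem rescale_extend (φ : Path (0 : ℝ) 1) (a b t : ℝ) :
    (rescale φ a b).extend t = a + (b - a) * φ.extend t := rfl

theorem IsPiecewiseSmooth.rescale {φ : Path (0 : ℝ) 1} (h : IsPiecewiseSmooth 𝓘(ℝ, ℝ) φ)
    (a b : ℝ) : IsPiecewiseSmooth 𝓘(ℝ, ℝ) (rescale φ a b) := by
  obtain ⟨T, hT⟩ := h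
  refine ⟨T, fun c d hc hcd hd hn => ?_⟩
  have h1 : ContDiff ℝ ∞ (fun t : ℝ => a + (b - a) * t) := by fun_prop
  exact h1.contMDiff.comp_contMDiffOn (hT c d hc hcd hd hn)

/-- The path `t ↦ t` from `0` to `1`. -/
def unitPath : Path (0 : ℝ) 1 := ⟨⟨fun t : I => (t : ℝ), continuous_subtype_val⟩, rfl, rfl⟩

theorem unitPath_extend {t : ℝ} (ht : t ∈ Icc (0 : ℝ) 1) : unitPath.extend t = t :=
  unitPath.extend_apply ht

theorem isPiecewiseSmooth_of_contDiff {φ : Path (0 : ℝ) 1} {ψ : ℝ → ℝ} (hψ : ContDiff ℝ ∞ ψ)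
    (h : ∀ t : I, φ t = ψ t) : IsPiecewiseSmooth 𝓘(ℝ, ℝ) φ := by
  refine ⟨∅, fun a d ha had hd _ => ?_⟩
  refine (hψ.contMDiff.contMDiffOn (s := Icc a d)).congr fun t ht => ?_
  rw [Path.extend_apply _ ⟨ha.trans ht.1, ht.2.trans hd⟩]
  exact h _

theorem isPiecewiseSmooth_unitPath : IsPiecewiseSmooth 𝓘(ℝ, ℝ) unitPath :=
  isPiecewiseSmooth_of_contDiff contDiff_id fun _ => rfl

theorem trans_mem_Icc {u v w a b : ℝ} {φ : Path u v} {φ' : Path v w}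
    (h : ∀ t, φ t ∈ Icc a b) (h' : ∀ t, φ' t ∈ Icc a b) (t : I) : φ.trans φ' t ∈ Icc a b := by
  rw [Path.trans_apply]
  split_ifs
  · exact h _
  · exact h' _

theorem rescale_mem_Icc {φ : Path (0 : ℝ) 1} (h : ∀ t, φ t ∈ Icc (0 : ℝ) 1) {a b : ℝ}
    (ha : a ∈ Icc (0 : ℝ) 1) (hb : b ∈ Icc (0 : ℝ) 1) (t : I) : rescale φ a b t ∈ Icc (0 : ℝ) 1 := by
  have h1 := h t
  have := (convex_Icc (0 : ℝ) 1) ha hb (by linarith [h1.2]) h1.1 (by ring : (1 - φ t) + φ t = 1)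
  convert this using 1
  simp only [rescale, Path.coe_mk_mk, smul_eq_mul]
  ring

theorem unitPath_mem (t : I) : unitPath t ∈ Icc (0 : ℝ) 1 := t.2

theorem Reparam.refl (γ : Path x y) : Reparam γ γ :=
  ⟨unitPath, isPiecewiseSmooth_unitPath, unitPath_mem, fun t ht => by rw [unitPath_extend ht]⟩

theorem Reparam.symm {γ γ' : Path x y} (h : Reparam γ γ') : Reparam γ.symm γ'.symm := by
  obtain ⟨φ, h1, h2, h3⟩ := h
  -- The new parameter is `1 - φ (1 - t)`.
  refine ⟨(rescale φ 1 0).symm, (h1.rescale 1 0).symm, fun t => ?_, fun t ht => ?_⟩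
  · exact rescale_mem_Icc h2 ⟨zero_le_one, le_rfl⟩ ⟨le_rfl, zero_le_one⟩ _
  · rw [Path.extend_symm, Path.extend_symm, Path.extend_symm]
    simp only [rescale_extend]
    rw [h3 (1 - t) ⟨by linarith [ht.2], by linarith [ht.1]⟩]
    congr 1
    ring

theorem Reparam.trans {γ γ' : Path x y} {δ δ' : Path y z} (h : Reparam γ γ') (h' : Reparam δ δ') :
    Reparam (γ.trans δ) (γ'.trans δ') := by
  obtain ⟨φ, h1, h2, h3⟩ := h
  obtain ⟨ψ, i1, i2, i3⟩ := h'
  have hhalf : (1 / 2 : ℝ) ∈ Icc (0 : ℝ) 1 := ⟨by norm_num, by norm_num⟩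
  refine ⟨(rescale φ 0 (1 / 2)).trans (rescale ψ (1 / 2) 1), (h1.rescale _ _).trans (i1.rescale _ _),
    trans_mem_Icc (rescale_mem_Icc h2 ⟨le_rfl, zero_le_one⟩ hhalf)
      (rescale_mem_Icc i2 hhalf ⟨zero_le_one, le_rfl⟩), fun t ht => ?_⟩
  rcases le_total t (1 / 2) with h | h
  · have hφ := extend_mem_unitInterval h2 (2 * t)
    rw [Path.extend_trans_of_le_half _ _ h, Path.extend_trans_of_le_half _ _ h, rescale_extend,
      Path.extend_trans_of_le_half _ _ (by linarith [hφ.2]),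
      h3 _ ⟨by linarith [ht.1], by linarith⟩]
    congr 1
    ring
  · have hψ := extend_mem_unitInterval i2 (2 * t - 1)
    rw [Path.extend_trans_of_half_le _ _ h, Path.extend_trans_of_half_le _ _ h, rescale_extend,
      Path.extend_trans_of_half_le _ _ (by linarith [hψ.1]),
      i3 _ ⟨by linarith, by linarith [ht.2]⟩]
    congr 1
    ring

/-- The change of parameter is piecewise linear, with values `0`, `1/4`, `1/2`, `1` at the times
`0`, `1/2`, `3/4`, `1`. -/
theorem Reparam.assoc (α : Path x y) (β : Path y z) (γ : Path z w) :
    Reparam ((α.trans β).trans γ) (α.trans (β.trans γ)) := by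
  have hu := isPiecewiseSmooth_unitPath
  have m0 : (0 : ℝ) ∈ Icc (0 : ℝ) 1 := ⟨le_rfl, zero_le_one⟩
  have m1 : (1 : ℝ) ∈ Icc (0 : ℝ) 1 := ⟨zero_le_one, le_rfl⟩
  have m2 : (1 / 2 : ℝ) ∈ Icc (0 : ℝ) 1 := ⟨by norm_num, by norm_num⟩
  have m4 : (1 / 4 : ℝ) ∈ Icc (0 : ℝ) 1 := ⟨by norm_num, by norm_num⟩
  refine ⟨(rescale unitPath 0 (1 / 4)).trans
    ((rescale unitPath (1 / 4) (1 / 2)).trans (rescale unitPath (1 / 2) 1)),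
    (hu.rescale _ _).trans ((hu.rescale _ _).trans (hu.rescale _ _)),
    trans_mem_Icc (rescale_mem_Icc unitPath_mem m0 m4) (trans_mem_Icc
      (rescale_mem_Icc unitPath_mem m4 m2) (rescale_mem_Icc unitPath_mem m2 m1)), fun t ht => ?_⟩
  rcases le_total t (1 / 2) with h | h
  · rw [Path.extend_trans_of_le_half _ _ h, Path.extend_trans_of_le_half _ _ h, rescale_extend,
      unitPath_extend ⟨by linarith [ht.1], by linarith⟩,
      Path.extend_trans_of_le_half _ _ (by linarith),
      Path.extend_trans_of_le_half _ _ (by linarith)]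
    congr 1
    ring
  · rw [Path.extend_trans_of_half_le _ _ h, Path.extend_trans_of_half_le _ _ h]
    rcases le_total (2 * t - 1) (1 / 2) with h' | h'
    · rw [Path.extend_trans_of_le_half _ _ h', Path.extend_trans_of_le_half _ _ h', rescale_extend,
        unitPath_extend ⟨by linarith, by linarith⟩,
        Path.extend_trans_of_le_half _ _ (by linarith),
        Path.extend_trans_of_half_le _ _ (by linarith)]
      congr 1
      ring
    · rw [Path.extend_trans_of_half_le _ _ h', Path.extend_trans_of_half_le _ _ h', rescale_extend,
        unitPath_extend ⟨by linarith, by linarith [ht.2]⟩,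
        Path.extend_trans_of_half_le _ _ (by linarith)]
      congr 1
      ring

/-- The parameter waits at `0` for the first half and then runs at double speed. -/
theorem Reparam.refl_trans (γ : Path x y) : Reparam γ ((Path.refl x).trans γ) := by
  have hu := isPiecewiseSmooth_unitPath
  have m0 : (0 : ℝ) ∈ Icc (0 : ℝ) 1 := ⟨le_rfl, zero_le_one⟩
  have m1 : (1 : ℝ) ∈ Icc (0 : ℝ) 1 := ⟨zero_le_one, le_rfl⟩
  refine ⟨(rescale unitPath 0 0).trans (rescale unitPath 0 1),
    (hu.rescale _ _).trans (hu.rescale _ _), trans_mem_Icc (rescale_mem_Icc unitPath_mem m0 m0)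
      (rescale_mem_Icc unitPath_mem m0 m1), fun t ht => ?_⟩
  rcases le_total t (1 / 2) with h | h
  · rw [Path.extend_trans_of_le_half _ _ h, Path.extend_trans_of_le_half _ _ h, rescale_extend]
    simp
  · rw [Path.extend_trans_of_half_le _ _ h, Path.extend_trans_of_half_le _ _ h, rescale_extend,
      unitPath_extend ⟨by linarith, by linarith [ht.2]⟩]
    congr 1
    ring

theorem Reparam.trans_refl (γ : Path x y) : Reparam γ (γ.trans (Path.refl y)) := by
  have := (Reparam.refl_trans γ.symm).symm
  rwa [Path.trans_symm, Path.symm_symm, Path.refl_symm] at this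

theorem Reparam.isReparametrization {n : ℕ} {M : Type*} [TopologicalSpace M]
    [ChartedSpace (EuclideanSpace ℝ (Fin n)) M] {p : M} {γ γ' : PSLoop n p}
    (h : Reparam γ.1 γ'.1) : IsReparametrization γ γ' := by
  obtain ⟨φ, h1, h2, h3⟩ := h
  refine ⟨φ, h1, h2, fun t => ?_⟩
  have := h3 t t.2
  rw [γ'.1.extend_apply t.2, φ.extend_apply t.2, γ.1.extend_apply (h2 t)] at this
  exact this

end Reparametrizations

/-! ### Retracings preserve the thin class. -/

section Retracing

variable {n : ℕ} {M : Type*} [TopologicalSpace M] [ChartedSpace (EuclideanSpace ℝ (Fin n)) M]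
  {p : M}

theorem collapse_mem_unitInterval {b : ℝ} (f : ContDiffBump b) (hb : b ∈ Icc (0 : ℝ) 1) {s t : ℝ}
    (hs : s ∈ Icc (0 : ℝ) 1) (ht : t ∈ Icc (0 : ℝ) 1) : collapse f (s, t) ∈ Icc (0 : ℝ) 1 := by
  rcases le_total b t with h | h
  · have := collapse_mem_Icc f hs h
    exact ⟨hb.1.trans this.1, this.2.trans ht.2⟩
  · have := collapse_mem_Icc' f hs h
    exact ⟨ht.1.trans this.1, this.2.trans hb.2⟩

/-- A piecewise-smooth path becomes smooth if it is made to stop at its break points. -/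
theorem exists_smoothing (T : Finset ℝ) (g : ℝ → M)
    (hg : ∀ a b : ℝ, 0 ≤ a → a < b → b ≤ 1 → (∀ t ∈ T, t ∉ Ioo a b) →
      ContMDiffOn 𝓘(ℝ, ℝ) (𝓡 n) ∞ g (Icc a b)) :
    ∃ ψ : ℝ → ℝ, ContDiff ℝ ∞ ψ ∧ ψ 0 = 0 ∧ ψ 1 = 1 ∧ MapsTo ψ (Icc 0 1) (Icc 0 1) ∧
      ContMDiffOn 𝓘(ℝ, ℝ) (𝓡 n) ∞ (fun t => g (ψ t)) (Icc 0 1) := by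
  induction T using Finset.induction_on generalizing g with
  | empty =>
    exact ⟨fun t => t, contDiff_id, rfl, rfl, mapsTo_id _, hg 0 1 le_rfl zero_lt_one le_rfl (by simp)⟩
  | insert b T hbT ih =>
    by_cases hb : b ∈ Ioo (0 : ℝ) 1
    · obtain ⟨ε, f, -, -, h0, h1, -, -, hcol⟩ := exists_bump_of_break hb hbT g hg
      obtain ⟨ψ, i1, i2, i3, i4, i5⟩ := ih _ hcol
      refine ⟨fun t => collapse f (1, ψ t), ?_, ?_, ?_, fun t ht => ?_, i5⟩
      · exact (contDiff_collapse f).comp (contDiff_const.prodMk i1)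
      · simp only [i2]
        rw [collapse_of_rOut_le f 1 h0]
      · simp only [i3]
        rw [collapse_of_rOut_le f 1 h1]
      · exact collapse_mem_unitInterval f (Ioo_subset_Icc_self hb) ⟨zero_le_one, le_rfl⟩ (i4 ht)
    · refine ih g fun a d ha had hd hT => hg a d ha had hd fun t ht => ?_
      rcases Finset.mem_insert.mp ht with rfl | ht
      · exact fun h => hb ⟨ha.trans_lt h.1, h.2.trans_le hd⟩
      · exact hT t ht

theorem exists_smooth_reparam {x y : M} {β : Path x y} (hβ : IsPiecewiseSmooth (𝓡 n) β) :
    ∃ β' : Path x y, Reparam β β' ∧ ContMDiffOn 𝓘(ℝ, ℝ) (𝓡 n) ∞ β'.extend (Icc 0 1) := by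
  obtain ⟨T, hT⟩ := hβ
  obtain ⟨ψ, h1, h2, h3, h4, h5⟩ := exists_smoothing T _ hT
  have hc : Continuous ψ := h1.continuous
  let φ : Path (0 : ℝ) 1 := ⟨⟨fun t : I => ψ t, by fun_prop⟩, h2, h3⟩
  refine ⟨⟨⟨fun t : I => β.extend (ψ t), by fun_prop⟩, by simp [h2], by simp [h3]⟩,
    ⟨φ, isPiecewiseSmooth_of_contDiff h1 fun _ => rfl, fun t => h4 t.2, fun t ht => ?_⟩, ?_⟩
  · rw [Path.extend_apply _ ht, φ.extend_apply ht]
    rfl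
  · refine h5.congr fun t ht => ?_
    rw [Path.extend_apply _ ht]
    rfl

/-- The contraction of a path followed by its reverse. -/
noncomputable def retraction {x y : M} (β : Path x y) :
    Path.Homotopy (β.trans β.symm) (Path.refl x) where
  toFun z := β.extend ((1 - (z.1 : ℝ)) * min (2 * (z.2 : ℝ)) (2 - 2 * (z.2 : ℝ)))
  continuous_toFun := by fun_prop
  map_zero_left t := by
    have ht := (β.trans β.symm).extend_apply t.2
    change _ = (β.trans β.symm) t
    change (β.trans β.symm).extend t = (β.trans β.symm) t at ht
    rw [← ht]
    rcases le_total (t : ℝ) (1 / 2) with h | h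
    · rw [Path.extend_trans_of_le_half _ _ h]
      simp only [Icc.coe_zero, sub_zero, one_mul]
      rw [min_eq_left (by linarith)]
    · rw [Path.extend_trans_of_half_le _ _ h, Path.extend_symm]
      simp only [Icc.coe_zero, sub_zero, one_mul]
      rw [min_eq_right (by linarith)]
      congr 1
      ring
  map_one_left t := by simp
  prop' s t ht := by
    rcases ht with rfl | rfl <;> simp

/-- With `β` smooth on the whole interval, the only break is at the turning time `1/2`. For a
general `β` the preimages of its breaks would be curved, hence the prior smoothing. -/
theorem isPaved_retraction {x y : M} {β : Path x y}
    (hβ : ContMDiffOn 𝓘(ℝ, ℝ) (𝓡 n) ∞ β.extend (Icc 0 1)) : IsPaved n (retraction β) := by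
  refine isPaved_of_strips _ {1 / 2}
    (fun z => β.extend ((1 - z.1) * min (2 * z.2) (2 - 2 * z.2))) (fun _ _ => rfl)
    fun a b ha hab hb hT => ?_
  have hhalf := hT (1 / 2) (Finset.mem_singleton_self _)
  rcases le_or_gt b (1 / 2) with h | h
  · have h1 : ContDiff ℝ ∞ (fun z : ℝ × ℝ => (1 - z.1) * (2 * z.2)) := by fun_prop
    refine (hβ.comp h1.contMDiff.contMDiffOn fun z hz => ?_).congr fun z hz => ?_
    · have i1 : 0 ≤ 1 - z.1 := by linarith [hz.1.2]
      have i2 : 1 - z.1 ≤ 1 := by linarith [hz.1.1]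
      have i3 : 0 ≤ 2 * z.2 := by linarith [hz.2.1]
      have i4 : 2 * z.2 ≤ 1 := by linarith [hz.2.2]
      exact ⟨mul_nonneg i1 i3, mul_le_one₀ i2 i3 i4⟩
    · simp only [Function.comp]
      rw [min_eq_left (by linarith [hz.2.2])]
  · have ha2 : 1 / 2 ≤ a := by
      by_contra hlt
      exact hhalf ⟨not_le.mp hlt, h⟩
    have h1 : ContDiff ℝ ∞ (fun z : ℝ × ℝ => (1 - z.1) * (2 - 2 * z.2)) := by fun_prop
    refine (hβ.comp h1.contMDiff.contMDiffOn fun z hz => ?_).congr fun z hz => ?_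
    · have i1 : 0 ≤ 1 - z.1 := by linarith [hz.1.2]
      have i2 : 1 - z.1 ≤ 1 := by linarith [hz.1.1]
      have i3 : 0 ≤ 2 - 2 * z.2 := by linarith [hz.2.2]
      have i4 : 2 - 2 * z.2 ≤ 1 := by linarith [hz.2.1]
      exact ⟨mul_nonneg i1 i3, mul_le_one₀ i2 i3 i4⟩
    · simp only [Function.comp]
      rw [min_eq_right (by linarith [hz.2.1])]

theorem range_retraction_subset {x y : M} (β : Path x y) : range (retraction β) ⊆ range β := by
  rintro _ ⟨z, rfl⟩
  rw [← Path.extend_range]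
  exact mem_range_self _

theorem isPiecewiseSmooth_of_contMDiffOn {x y : M} {β : Path x y}
    (hβ : ContMDiffOn 𝓘(ℝ, ℝ) (𝓡 n) ∞ β.extend (Icc 0 1)) : IsPiecewiseSmooth (𝓡 n) β :=
  ⟨∅, fun _ _ ha _ hb _ => hβ.mono (Icc_subset_Icc ha hb)⟩

/-- A retracing does not change the thin class. -/
theorem thin_of_retracing [IsManifold (𝓡 n) ∞ M] {γ γ' : PSLoop n p} (h : IsRetracing γ γ') :
    (thinSetoid n p).r γ γ' := by
  obtain ⟨x, y, α₁, β, α₂, h1, hβ, h2, hγ, hγ'⟩ := h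
  obtain ⟨β', hr, hβ'⟩ := exists_smooth_reparam hβ
  have hβp := isPiecewiseSmooth_of_contMDiffOn hβ'
  let δ : PSLoop n p := ⟨α₁.trans ((β'.trans β'.symm).trans α₂),
    h1.trans ((hβp.trans hβp.symm).trans h2)⟩
  let δ' : PSLoop n p := ⟨α₁.trans ((Path.refl x).trans α₂),
    h1.trans ((IsPiecewiseSmooth.refl x).trans h2)⟩
  have e1 : (thinSetoid n p).r γ' δ := thin_of_reparam (Reparam.isReparametrization (by
    rw [hγ']
    exact (Reparam.refl α₁).trans ((hr.trans hr.symm).trans (Reparam.refl α₂))))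
  have e2 : (thinSetoid n p).r γ δ' := thin_of_reparam (Reparam.isReparametrization (by
    rw [hγ]
    exact (Reparam.refl α₁).trans (Reparam.refl_trans α₂)))
  -- The contraction acts on the middle factor only and stays in the image of `β'`, which `δ`
  -- traverses.
  have e3 : ThinHomotopic δ δ' := by
    refine thinHomotopic_of_isPaved (η := (Path.Homotopy.refl α₁).hcomp
      ((retraction β').hcomp (Path.Homotopy.refl α₂)))
      ((IsPaved.refl h1).hcomp ((isPaved_retraction hβ').hcomp (IsPaved.refl h2))) ?_
    refine (range_hcomp_subset _ _).trans ?_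
    rw [range_refl]
    refine union_subset ?_ ((range_hcomp_subset _ _).trans ?_)
    · refine Subset.trans ?_ subset_union_left
      rw [Path.trans_range]
      exact subset_union_left
    · rw [range_refl]
      refine Subset.trans ?_ subset_union_left
      rw [Path.trans_range, Path.trans_range, Path.trans_range]
      refine Subset.trans ?_ subset_union_right
      exact union_subset_union_left _ ((range_retraction_subset β').trans subset_union_left)
  exact e2.trans _ _ _ (((thin_of_homotopic e3).symm _ _).trans _ _ _ (e1.symm _ _))

theorem thin_of_retrace [IsManifold (𝓡 n) ∞ M] {γ γ' : PSLoop n p}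
    (h : (retraceSetoid n p).r γ γ') : (thinSetoid n p).r γ γ' := by
  induction h with
  | rel _ _ h => exact h.elim thin_of_reparam thin_of_retracing
  | refl _ => exact Relation.EqvGen.refl _
  | symm _ _ _ ih => exact ih.symm _ _
  | trans _ _ _ _ _ ih ih' => exact ih.trans _ _ _ ih'

end Retracing

/-! ### Group structures on the quotients by loop congruences. -/

section Groups

variable {n : ℕ} {M : Type*} [TopologicalSpace M] [ChartedSpace (EuclideanSpace ℝ (Fin n)) M]
  {p : M}

/-- The constant loop. -/
def PSLoop.const (n : ℕ) {M : Type*} [TopologicalSpace M]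
    [ChartedSpace (EuclideanSpace ℝ (Fin n)) M] (p : M) : PSLoop n p :=
  ⟨Path.refl p, IsPiecewiseSmooth.refl p⟩

/-- An equivalence relation on loops that is compatible with concatenation and inversion and
contains retrace equivalence. -/
structure IsLoopCongruence (r : Setoid (PSLoop n p)) : Prop where
  of_reparam : ∀ {γ γ' : PSLoop n p}, Reparam γ.1 γ'.1 → r.r γ γ'
  of_retracing : ∀ {γ γ' : PSLoop n p}, IsRetracing γ γ' → r.r γ γ'
  trans_right : ∀ {γ γ' : PSLoop n p}, r.r γ γ' → ∀ δ, r.r (γ.trans δ) (γ'.trans δ)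
  inv : ∀ {γ γ' : PSLoop n p}, r.r γ γ' → r.r γ.symm γ'.symm

theorem PSLoop.symm_trans (γ δ : PSLoop n p) : (γ.trans δ).symm = δ.symm.trans γ.symm :=
  Subtype.ext (Path.trans_symm _ _)

theorem PSLoop.symm_symm (γ : PSLoop n p) : γ.symm.symm = γ :=
  Subtype.ext (Path.symm_symm _)

namespace IsLoopCongruence

variable {r : Setoid (PSLoop n p)}

/-- Reversal turns left factors into right factors. -/
theorem trans_left (h : IsLoopCongruence r) {γ γ' : PSLoop n p} (hr : r.r γ γ') (δ : PSLoop n p) :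
    r.r (δ.trans γ) (δ.trans γ') := by
  have := h.inv (h.trans_right (h.inv hr) δ.symm)
  rwa [PSLoop.symm_trans, PSLoop.symm_trans, PSLoop.symm_symm, PSLoop.symm_symm,
    PSLoop.symm_symm] at this

theorem trans_congr (h : IsLoopCongruence r) {γ γ' δ δ' : PSLoop n p} (hr : r.r γ γ') (hr' : r.r δ δ') :
    r.r (γ.trans δ) (γ'.trans δ') :=
  r.iseqv.trans (h.trans_right hr δ) (h.trans_left hr' γ')

/-- A retracing with constant `α₁` and `α₂` gives the cancellation; the constant factors are
absorbed by reparametrization. -/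
theorem trans_inv (h : IsLoopCongruence r) (γ : PSLoop n p) : r.r (γ.trans γ.symm) (PSLoop.const n p) := by
  have hc : IsPiecewiseSmooth (𝓡 n) (Path.refl p) := IsPiecewiseSmooth.refl p
  let δ : PSLoop n p := ⟨(Path.refl p).trans (Path.refl p), hc.trans hc⟩
  let δ' : PSLoop n p := ⟨(Path.refl p).trans ((γ.1.trans γ.1.symm).trans (Path.refl p)),
    hc.trans ((γ.2.trans γ.2.symm).trans hc)⟩
  have e1 : r.r (PSLoop.const n p) δ := h.of_reparam (Reparam.refl_trans _)
  have e2 : r.r δ δ' := h.of_retracing ⟨p, p, Path.refl p, γ.1, Path.refl p, hc, γ.2, hc, rfl, rfl⟩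
  have e3 : r.r (γ.trans γ.symm) ((γ.trans γ.symm).trans (PSLoop.const n p)) :=
    h.of_reparam (Reparam.trans_refl _)
  have e4 : r.r ((γ.trans γ.symm).trans (PSLoop.const n p)) δ' :=
    h.of_reparam (Reparam.refl_trans _)
  exact r.iseqv.trans (r.iseqv.trans e3 e4) (r.iseqv.symm (r.iseqv.trans e1 e2))

/-- The group of classes of loops, in which `[γ'] * [γ]` is the class of the loop that runs first
through `γ` and then through `γ'`. -/
@[reducible]
noncomputable def group (h : IsLoopCongruence r) : Group (Quotient r) :=
  letI : Mul (Quotient r) := ⟨Quotient.map₂ (fun γ' γ => γ.trans γ')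
    fun _ _ hr _ _ hr' => h.trans_congr hr' hr⟩
  letI : Inv (Quotient r) := ⟨Quotient.map PSLoop.symm fun _ _ hr => h.inv hr⟩
  letI : One (Quotient r) := ⟨Quotient.mk r (PSLoop.const n p)⟩
  Group.ofLeftAxioms
    (by
      rintro ⟨a⟩ ⟨b⟩ ⟨c⟩
      exact Quotient.sound (r.iseqv.symm (h.of_reparam (Reparam.assoc _ _ _))))
    (by
      rintro ⟨a⟩
      exact Quotient.sound (r.iseqv.symm (h.of_reparam (Reparam.trans_refl _))))
    (by
      rintro ⟨a⟩
      exact Quotient.sound (h.trans_inv a))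

end IsLoopCongruence

theorem isLoopCongruence_thin [IsManifold (𝓡 n) ∞ M] : IsLoopCongruence (thinSetoid n p) where
  of_reparam h := thin_of_reparam h.isReparametrization
  of_retracing h := thin_of_retracing h
  trans_right h δ := by
    induction h with
    | rel _ _ h => exact thin_of_homotopic (h.trans_right δ)
    | refl _ => exact Relation.EqvGen.refl _
    | symm _ _ _ ih => exact ih.symm _ _
    | trans _ _ _ _ _ ih ih' => exact ih.trans _ _ _ ih'
  inv h := by
    induction h with
    | rel _ _ h => exact thin_of_homotopic h.inv
    | refl _ => exact Relation.EqvGen.refl _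
    | symm _ _ _ ih => exact ih.symm _ _
    | trans _ _ _ _ _ ih ih' => exact ih.trans _ _ _ ih'

theorem IsReparametrization.reparam {γ γ' : PSLoop n p} (h : IsReparametrization γ γ') :
    Reparam γ.1 γ'.1 := by
  obtain ⟨φ, h1, h2, h3⟩ := h
  exact ⟨φ, h1, h2, fun t _ => extend_eq_of_reparam h3 t⟩

theorem retrace_of_reparam {γ γ' : PSLoop n p} (h : Reparam γ.1 γ'.1) :
    (retraceSetoid n p).r γ γ' :=
  Relation.EqvGen.rel _ _ (Or.inl h.isReparametrization)

/-- After reassociation, `δ` becomes part of `α₂`. -/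
theorem retrace_trans_right_of_retracing {γ γ' : PSLoop n p} (h : IsRetracing γ γ')
    (δ : PSLoop n p) : (retraceSetoid n p).r (γ.trans δ) (γ'.trans δ) := by
  obtain ⟨x, y, α₁, β, α₂, h1, hβ, h2, hγ, hγ'⟩ := h
  let ε : PSLoop n p := ⟨α₁.trans (α₂.trans δ.1), h1.trans (h2.trans δ.2)⟩
  let ε' : PSLoop n p := ⟨α₁.trans ((β.trans β.symm).trans (α₂.trans δ.1)),
    h1.trans ((hβ.trans hβ.symm).trans (h2.trans δ.2))⟩
  let ζ : PSLoop n p := ⟨α₁.trans (((β.trans β.symm).trans α₂).trans δ.1),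
    h1.trans (((hβ.trans hβ.symm).trans h2).trans δ.2)⟩
  have e1 : (retraceSetoid n p).r (γ.trans δ) ε := retrace_of_reparam (by
    change Reparam (γ.1.trans δ.1) _
    rw [hγ]
    exact Reparam.assoc _ _ _)
  have e2 : (retraceSetoid n p).r ε ε' := Relation.EqvGen.rel _ _
    (Or.inr ⟨x, y, α₁, β, α₂.trans δ.1, h1, hβ, h2.trans δ.2, rfl, rfl⟩)
  have e3 : (retraceSetoid n p).r (γ'.trans δ) ζ := retrace_of_reparam (by
    change Reparam (γ'.1.trans δ.1) _
    rw [hγ']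
    exact Reparam.assoc _ _ _)
  have e4 : (retraceSetoid n p).r ζ ε' :=
    retrace_of_reparam ((Reparam.refl α₁).trans (Reparam.assoc _ _ _))
  exact e1.trans _ _ _ (e2.trans _ _ _ ((e3.trans _ _ _ e4).symm _ _))

/-- The spike `β.trans β.symm` is its own reverse, so reversal exchanges the roles of `α₁` and `α₂`,
up to bracketing. -/
theorem retrace_inv_of_retracing {γ γ' : PSLoop n p} (h : IsRetracing γ γ') :
    (retraceSetoid n p).r γ.symm γ'.symm := by
  obtain ⟨x, y, α₁, β, α₂, h1, hβ, h2, hγ, hγ'⟩ := h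
  let ε : PSLoop n p := ⟨α₂.symm.trans ((β.trans β.symm).trans α₁.symm),
    h2.symm.trans ((hβ.trans hβ.symm).trans h1.symm)⟩
  have e1 : (retraceSetoid n p).r γ.symm ε := Relation.EqvGen.rel _ _
    (Or.inr ⟨x, y, α₂.symm, β, α₁.symm, h2.symm, hβ, h1.symm, by
      change γ.1.symm = _
      rw [hγ, Path.trans_symm], rfl⟩)
  have e2 : (retraceSetoid n p).r γ'.symm ε := retrace_of_reparam (by
    change Reparam γ'.1.symm _
    rw [hγ', Path.trans_symm, Path.trans_symm, Path.trans_symm, Path.symm_symm]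
    exact Reparam.assoc _ _ _)
  exact e1.trans _ _ _ (e2.symm _ _)

theorem isLoopCongruence_retrace : IsLoopCongruence (retraceSetoid n p) where
  of_reparam h := retrace_of_reparam h
  of_retracing h := Relation.EqvGen.rel _ _ (Or.inr h)
  trans_right h δ := by
    induction h with
    | rel _ _ h =>
      rcases h with h | h
      · exact retrace_of_reparam (h.reparam.trans (Reparam.refl δ.1))
      · exact retrace_trans_right_of_retracing h δ
    | refl _ => exact Relation.EqvGen.refl _
    | symm _ _ _ ih => exact ih.symm _ _
    | trans _ _ _ _ _ ih ih' => exact ih.trans _ _ _ ih'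
  inv h := by
    induction h with
    | rel _ _ h =>
      rcases h with h | h
      · exact retrace_of_reparam h.reparam.symm
      · exact retrace_inv_of_retracing h
    | refl _ => exact Relation.EqvGen.refl _
    | symm _ _ _ ih => exact ih.symm _ _
    | trans _ _ _ _ _ ih ih' => exact ih.trans _ _ _ ih'

end Groups

/-! ### Crossing parity of paths. -/

section PathParity

variable {X : Type*} {B Q : Set X} {l r : X}

theorem crossings_congr {f g : ℝ → X} {a b : ℝ} (h : EqOn f g (Icc a b)) :
    crossings B Q l r f a b = crossings B Q l r g a b := by
  have key : ∀ {f g : ℝ → X}, EqOn f g (Icc a b) →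
      crossings B Q l r f a b ⊆ crossings B Q l r g a b := by
    rintro f g h w ⟨h1, h2, h3, h4, h5, t, ht, htQ⟩
    have hm : ∀ t ∈ Ioo w.1 w.2, t ∈ Icc a b := fun t ht =>
      ⟨h1.trans ht.1.le, ht.2.le.trans h3⟩
    refine ⟨h1, h2, h3, ?_, fun t ht => ?_, t, ht, ?_⟩
    · rwa [← h ⟨h1, h2.le.trans h3⟩, ← h ⟨h1.trans h2.le, h3⟩]
    · rw [← h (hm t ht)]
      exact h5 t ht
    · rwa [← h (hm t ht)]
  exact Subset.antisymm (key h) (key h.symm)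

theorem crossingParity_congr {f g : ℝ → X} {a b : ℝ} (h : EqOn f g (Icc a b)) :
    crossingParity B Q l r f a b = crossingParity B Q l r g a b := by
  rw [crossingParity, crossings_congr h, crossingParity]

variable [TopologicalSpace X] {x y z : X}

/-- The parity of the number of crossings of a path. -/
noncomputable def pathParity (B Q : Set X) (l r : X) (γ : Path x y) : ZMod 2 :=
  crossingParity B Q l r γ.extend 0 1

theorem pathParity_reparam [T1Space X] (hl : l ∉ B) (hr : r ∉ B) (hlr : l ≠ r) {γ γ' : Path x y}
    (h : Reparam γ γ') : pathParity B Q l r γ' = pathParity B Q l r γ := by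
  obtain ⟨φ, -, h2, h3⟩ := h
  rw [pathParity, crossingParity_congr (g := γ.extend ∘ φ.extend) h3]
  exact crossingParity_comp hl hr hlr zero_le_one γ.continuous_extend.continuousOn
    φ.continuous_extend.continuousOn (fun t _ => extend_mem_unitInterval h2 t)
    (Or.inl ⟨φ.extend_zero, φ.extend_one⟩)

theorem pathParity_symm [T1Space X] (hl : l ∉ B) (hr : r ∉ B) (hlr : l ≠ r) (γ : Path x y) :
    pathParity B Q l r γ.symm = pathParity B Q l r γ := by
  rw [pathParity, Path.extend_symm]
  exact crossingParity_comp (φ := fun t => 1 - t) hl hr hlr zero_le_one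
    γ.continuous_extend.continuousOn (by fun_prop)
    (fun t ht => ⟨by linarith [ht.2], by linarith [ht.1]⟩) (Or.inr ⟨by norm_num, by norm_num⟩)

/-- The junction `y` outside `B` forbids passages across time `1/2`; each half is then a linear
change of parameter. -/
theorem pathParity_trans [T1Space X] (hl : l ∉ B) (hr : r ∉ B) (hlr : l ≠ r) (γ : Path x y) (γ' : Path y z)
    (hy : y ∉ B) :
    pathParity B Q l r (γ.trans γ') = pathParity B Q l r γ + pathParity B Q l r γ' := by
  have hm : (γ.trans γ').extend (1 / 2) ∉ B := by
    rw [Path.extend_trans_of_le_half _ _ le_rfl]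
    simpa using hy
  rw [pathParity, crossingParity_add hl hr hlr (γ.trans γ').continuous_extend.continuousOn hm
    (by norm_num) (by norm_num)]
  congr 1
  · rw [crossingParity_congr (g := γ.extend ∘ fun t => 2 * t)
      (fun t ht => Path.extend_trans_of_le_half _ _ ht.2)]
    exact crossingParity_comp hl hr hlr (by norm_num) γ.continuous_extend.continuousOn
      (by fun_prop) (fun t ht => ⟨by linarith [ht.1], by linarith [ht.2]⟩)
      (Or.inl ⟨by norm_num, by norm_num⟩)
  · rw [crossingParity_congr (g := γ'.extend ∘ fun t => 2 * t - 1)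
      (fun t ht => Path.extend_trans_of_half_le _ _ ht.1)]
    exact crossingParity_comp hl hr hlr (by norm_num) γ'.continuous_extend.continuousOn
      (by fun_prop) (fun t ht => ⟨by linarith [ht.1], by linarith [ht.2]⟩)
      (Or.inl ⟨by norm_num, by norm_num⟩)

theorem pathParity_refl (hlr : l ≠ r) : pathParity B Q l r (Path.refl x) = 0 := by
  have : crossings B Q l r (Path.refl x).extend 0 1 = ∅ := by
    rw [Path.refl_extend]
    ext w
    simp only [mem_empty_iff_false, iff_false]
    rintro ⟨-, -, -, h | h, -⟩
    · exact hlr (h.1.symm.trans h.2)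
    · exact hlr (h.2.symm.trans h.1)
  rw [pathParity, crossingParity, this, Set.ncard_empty, Nat.cast_zero]

end PathParity

/-! ### Eventual crossing parity as an invariant of retrace equivalence. -/

section RetraceInvariant

variable {n : ℕ} {M : Type*} [TopologicalSpace M] [ChartedSpace (EuclideanSpace ℝ (Fin n)) M]
  [T1Space M] {p : M}

/-- For pairwise disjoint sets `B k`, retrace equivalent loops have the same parity of crossings
of `B k` for all but finitely many `k`. -/
theorem eventually_pathParity_eq {B Q : ℕ → Set M} {l r : ℕ → M}
    (hB : Pairwise fun i j => Disjoint (B i) (B j)) (hl : ∀ k, l k ∉ B k) (hr : ∀ k, r k ∉ B k)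
    (hlr : ∀ k, l k ≠ r k) {γ γ' : PSLoop n p} (h : (retraceSetoid n p).r γ γ') :
    ∀ᶠ k in Filter.cofinite,
      pathParity (B k) (Q k) (l k) (r k) γ.1 = pathParity (B k) (Q k) (l k) (r k) γ'.1 := by
  -- By disjointness, a point lies in at most one `B k`.
  have hnot : ∀ x : M, ∀ᶠ k in Filter.cofinite, x ∉ B k := by
    intro x
    refine Set.Subsingleton.finite fun i hi j hj => ?_
    by_contra hne
    exact Set.disjoint_left.mp (hB hne) (not_not.mp hi) (not_not.mp hj)
  induction h with
  | rel γ γ' h =>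
    rcases h with h | ⟨x, y, α₁, β, α₂, -, -, -, hγ, hγ'⟩
    · exact Filter.Eventually.of_forall fun k =>
        (pathParity_reparam (hl k) (hr k) (hlr k) h.reparam).symm
    -- For `k` with `x` and `y` outside `B k`, the spike contributes the parity of `β` twice, which
    -- is zero modulo two.
    · filter_upwards [hnot x, hnot y] with k hx hy
      rw [hγ, hγ', pathParity_trans (hl k) (hr k) (hlr k) _ _ hx,
        pathParity_trans (hl k) (hr k) (hlr k) _ _ hx,
        pathParity_trans (hl k) (hr k) (hlr k) _ _ hx,
        pathParity_trans (hl k) (hr k) (hlr k) _ _ hy,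
        pathParity_symm (hl k) (hr k) (hlr k), CharTwo.add_self_eq_zero, zero_add]
  | refl _ => exact Filter.Eventually.of_forall fun _ => rfl
  | symm _ _ _ ih => exact ih.mono fun _ h => h.symm
  | trans _ _ _ _ _ ih ih' =>
    filter_upwards [ih, ih'] with k h h'
    exact h.trans h'

end RetraceInvariant

/-! ### Construction of the comb in the plane. -/

section Comb

open MeasureTheory

/-- The coordinates of a plane loop that runs out along an interval, with infinitely many
excursions along orthogonal teeth, and returns along the interval without excursions; the points
`X (d k)` separate consecutive teeth. -/
structure IsComb (X Y : ℝ → ℝ) (d : ℕ → ℝ) : Prop where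
  contDiff_fst : ContDiff ℝ ∞ X
  contDiff_snd : ContDiff ℝ ∞ Y
  fst_zero : X 0 = 0
  fst_one : X 1 = 0
  fst_mem : ∀ t ∈ Icc (0 : ℝ) 1, X t ∈ Icc (0 : ℝ) 1
  snd_mem : ∀ t, Y t ∈ Icc (0 : ℝ) 1
  snd_zero : Y 0 = 0
  snd_eq_zero : ∀ t, 1 / 2 ≤ t → Y t = 0
  fst_const : ∀ t ∈ Icc (0 : ℝ) 1, Y t ≠ 0 → ∃ a ∈ Icc 0 t, Y a = 0 ∧ X a = X t ∧
    ∀ x ∈ Icc a t, X x = X t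
  strictAnti : StrictAnti d
  d_mem : ∀ k, d k ∈ Ioo (0 : ℝ) (1 / 2)
  snd_d : ∀ k, Y (d k) = 0
  fst_symm : ∀ t, X (1 - t) = X t
  fst_inj : ∀ k, ∀ t ∈ Icc (0 : ℝ) 1, X t = X (d k) → t = d k ∨ t = 1 - d k
  fst_lt : ∀ k, X (d (k + 1)) < X (d k)
  fst_between : ∀ k, ∀ t ∈ Ioo (d (k + 1)) (d k), X t ∈ Ioo (X (d (k + 1))) (X (d k))
  exists_snd_ne : ∀ k, ∃ t ∈ Ioo (d (k + 1)) (d k), Y t ≠ 0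

/-- For `c > 0` this is the union of the intervals from `1/(2k + c + 1)` to `1/(2k + c)`. The values
`c = 2` and `c = 3` give two alternating families accumulating at zero: horizontal motion and teeth.
-/
theorem isOpen_setOf_exists_between (c : ℝ) :
    IsOpen {t : ℝ | ∃ k : ℕ, 1 < (2 * k + c + 1) * t ∧ (2 * k + c) * t < 1} := by
  have : {t : ℝ | ∃ k : ℕ, 1 < (2 * k + c + 1) * t ∧ (2 * k + c) * t < 1} =
      ⋃ k : ℕ, {t : ℝ | 1 < (2 * k + c + 1) * t} ∩ {t : ℝ | (2 * k + c) * t < 1} := by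
    ext t; simp
  rw [this]
  exact isOpen_iUnion fun k => (isOpen_lt continuous_const (by fun_prop)).inter
    (isOpen_lt (by fun_prop) continuous_const)

/-- Smooth functions with exactly these open supports serve as horizontal speed `g` and height `Y`,
so nothing has to be checked at the accumulation point. -/
theorem exists_isComb : ∃ X Y d, IsComb X Y d := by
  obtain ⟨g, hg, hgs, hgr⟩ := (isOpen_setOf_exists_between 2).exists_contDiff_support_eq (n := ⊤)
  obtain ⟨Y, hY, hYs, hYr⟩ := (isOpen_setOf_exists_between 3).exists_contDiff_support_eq (n := ⊤)
  have hg01 : ∀ t, g t ∈ Icc (0 : ℝ) 1 := fun t => hgr (mem_range_self t)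
  have hgc : Continuous g := hgs.continuous
  have hgi : ∀ a b, IntervalIntegrable g volume a b := fun a b => hgc.intervalIntegrable a b
  have hg_ne : ∀ t, g t ≠ 0 ↔ ∃ k : ℕ, 1 < (2 * (k : ℝ) + 2 + 1) * t ∧ (2 * (k : ℝ) + 2) * t < 1 :=
    fun t => by rw [← Function.mem_support, hg]; rfl
  have hY_ne : ∀ t, Y t ≠ 0 ↔ ∃ k : ℕ, 1 < (2 * (k : ℝ) + 3 + 1) * t ∧ (2 * (k : ℝ) + 3) * t < 1 :=
    fun t => by rw [← Function.mem_support, hY]; rfl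
  -- `g` vanishes outside `(0, 1/2)` and on the closure of the teeth
  have hg_half : ∀ t, 1 / 2 ≤ t → g t = 0 := by
    intro t ht
    by_contra h
    obtain ⟨k, -, hk⟩ := (hg_ne t).mp h
    nlinarith [(Nat.cast_nonneg k : (0 : ℝ) ≤ k)]
  have hY_half : ∀ t, 1 / 2 ≤ t → Y t = 0 := by
    intro t ht
    by_contra h
    obtain ⟨k, -, hk⟩ := (hY_ne t).mp h
    nlinarith [(Nat.cast_nonneg k : (0 : ℝ) ≤ k)]
  have hg_tooth : ∀ (k : ℕ) (t : ℝ), 1 ≤ (2 * (k : ℝ) + 4) * t → (2 * (k : ℝ) + 3) * t < 1 →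
      g t = 0 := by
    intro k t h1 h2
    by_contra h
    obtain ⟨j, h3, h4⟩ := (hg_ne t).mp h
    have ht : 0 < t := by
      by_contra! ht
      nlinarith [(Nat.cast_nonneg k : (0 : ℝ) ≤ k)]
    have i1 : (k : ℝ) < j := by
      by_contra! hle
      nlinarith
    have i2 : (k : ℝ) + 1 ≤ j := by exact_mod_cast i1
    nlinarith
  set G : ℝ → ℝ := fun t => ∫ x in (0 : ℝ)..t, g x with hG
  have hGsub : ∀ a b, G b - G a = ∫ x in a..b, g x := fun a b =>
    intervalIntegral.integral_interval_sub_left (hgi _ _) (hgi _ _)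
  have hGderiv : ∀ t, HasDerivAt G (g t) t := fun t =>
    intervalIntegral.integral_hasDerivAt_right (hgi _ _)
      hgc.stronglyMeasurable.stronglyMeasurableAtFilter hgc.continuousAt
  have hGs : ContDiff ℝ ∞ G := by
    rw [contDiff_infty_iff_deriv]
    refine ⟨fun t => (hGderiv t).differentiableAt, ?_⟩
    rw [funext fun t => (hGderiv t).deriv]
    exact hgs
  have hG0 : G 0 = 0 := intervalIntegral.integral_same
  have hGmono : ∀ a b, a ≤ b → G a ≤ G b := fun a b hab => by
    have := intervalIntegral.integral_nonneg (f := g) (μ := volume) hab fun u _ => (hg01 u).1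
    linarith [hGsub a b]
  have hGlt : ∀ a b c, a < b → c ∈ Icc a b → g c ≠ 0 → G a < G b := fun a b c hab hc hgc0 => by
    have := intervalIntegral.integral_pos hab hgc.continuousOn (fun u _ => (hg01 u).1)
      ⟨c, hc, lt_of_le_of_ne (hg01 c).1 (Ne.symm hgc0)⟩
    linarith [hGsub a b]
  have hGle : ∀ t, 0 ≤ t → G t ≤ t := fun t ht => by
    have := intervalIntegral.norm_integral_le_of_norm_le_const (a := 0) (b := t) (C := 1) (f := g)
      fun x _ => by
        rw [Real.norm_eq_abs, abs_of_nonneg (hg01 x).1]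
        exact (hg01 x).2
    rw [sub_zero, abs_of_nonneg ht, one_mul] at this
    exact (le_abs_self _).trans this
  have hGconst : ∀ a b, a ≤ b → (∀ t ∈ Icc a b, g t = 0) → G a = G b := fun a b hab h => by
    have : ∫ x in a..b, g x = ∫ x in a..b, (0 : ℝ) :=
      intervalIntegral.integral_congr fun t ht => h t (by rwa [uIcc_of_le hab] at ht)
    rw [intervalIntegral.integral_zero] at this
    linarith [hGsub a b]
  have hGhalf : ∀ t, 1 / 2 ≤ t → G t = G 1 := fun t ht => by
    rcases le_total t 1 with h | h
    · exact hGconst t 1 h fun x hx => hg_half x (ht.trans hx.1)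
    · exact (hGconst 1 t h fun x hx => hg_half x (by linarith [hx.1])).symm
  -- Since `G` is constant after `1/2`, this equals `G t` on the first half and is mirrored on the
  -- second. The time `d k` is `1/(2k + 5/2)`, inside the `k`-th interval of horizontal motion.
  let X : ℝ → ℝ := fun t => G t + G (1 - t) - G 1
  let d : ℕ → ℝ := fun k => 2 / (4 * (k : ℝ) + 5)
  have hX1 : ∀ t, t ≤ 1 / 2 → X t = G t := fun t ht => by
    simp only [X]
    rw [hGhalf (1 - t) (by linarith)]
    ring
  have hXsymm : ∀ t, X (1 - t) = X t := fun t => by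
    simp only [X, sub_sub_cancel]
    ring
  have hd : StrictAnti d := strictAnti_nat_of_succ_lt fun k => by
    simp only [d]
    push_cast
    exact div_lt_div_of_pos_left two_pos (by positivity) (by linarith)
  have hd_mem : ∀ k, d k ∈ Ioo (0 : ℝ) (1 / 2) := fun k => by
    have : (0 : ℝ) ≤ k := Nat.cast_nonneg k
    refine ⟨by positivity, ?_⟩
    simp only [d]
    rw [div_lt_div_iff₀ (by positivity) two_pos]
    linarith
  have hgd : ∀ k, g (d k) ≠ 0 := fun k => by
    have : (0 : ℝ) ≤ k := Nat.cast_nonneg k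
    refine (hg_ne _).mpr ⟨k, ?_, ?_⟩ <;> simp only [d, mul_div_assoc']
    · rw [one_lt_div (by positivity)]; linarith
    · rw [div_lt_one (by positivity)]; linarith
  have hlt : ∀ k t, t ∈ Icc (0 : ℝ) (1 / 2) → t < d k → X t < X (d k) := fun k t ht h => by
    rw [hX1 t ht.2, hX1 _ (hd_mem k).2.le]
    exact hGlt _ _ (d k) h ⟨h.le, le_rfl⟩ (hgd k)
  have hgt : ∀ k t, t ∈ Icc (0 : ℝ) (1 / 2) → d k < t → X (d k) < X t := fun k t ht h => by
    rw [hX1 t ht.2, hX1 _ (hd_mem k).2.le]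
    exact hGlt _ _ (d k) h ⟨le_rfl, h.le⟩ (hgd k)
  have hinj : ∀ k t, t ∈ Icc (0 : ℝ) (1 / 2) → X t = X (d k) → t = d k := fun k t ht h => by
    rcases lt_trichotomy t (d k) with h' | h' | h'
    · exact absurd h (hlt k t ht h').ne
    · exact h'
    · exact absurd h (hgt k t ht h').ne'
  refine ⟨X, Y, d, ?_⟩
  constructor
  · exact (hGs.add (hGs.comp (contDiff_const.sub contDiff_id))).sub contDiff_const
  · exact hYs
  · simp [X, hG0]
  · simp [X, hG0]
  · have key : ∀ t ∈ Icc (0 : ℝ) (1 / 2), X t ∈ Icc (0 : ℝ) 1 := fun t ht => by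
      rw [hX1 t ht.2]
      exact ⟨hG0 ▸ hGmono 0 t ht.1, (hGle t ht.1).trans (by linarith [ht.2])⟩
    intro t ht
    rcases le_total t (1 / 2) with h | h
    · exact key t ⟨ht.1, h⟩
    · rw [← hXsymm]
      exact key (1 - t) ⟨by linarith [ht.2], by linarith⟩
  · exact fun t => hYr (mem_range_self t)
  · by_contra h
    obtain ⟨k, hk, -⟩ := (hY_ne 0).mp h
    rw [mul_zero] at hk
    linarith
  · exact hY_half
  · intro t ht hYt
    obtain ⟨k, hk1, hk2⟩ := (hY_ne t).mp hYt
    have hk : (0 : ℝ) ≤ k := Nat.cast_nonneg k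
    have hpos : (0 : ℝ) < 2 * k + 4 := by positivity
    have ht2 : t ≤ 1 / 2 := by
      by_contra! h
      exact hYt (hY_half t h.le)
    -- The time at which the tooth containing `t` begins.
    set a : ℝ := (2 * (k : ℝ) + 4)⁻¹ with ha
    have ha1 : (2 * (k : ℝ) + 4) * a = 1 := mul_inv_cancel₀ hpos.ne'
    have ha0 : 0 < a := inv_pos.mpr hpos
    have hat : a ≤ t := by
      by_contra! h
      nlinarith
    have hconst : ∀ x ∈ Icc a t, X x = X t := fun x hx => by
      rw [hX1 x (hx.2.trans ht2), hX1 t ht2]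
      refine hGconst x t hx.2 fun u hu => hg_tooth k u ?_ ?_
      · nlinarith [hx.1, hu.1]
      · nlinarith [hu.2]
    refine ⟨a, ⟨ha0.le, hat⟩, ?_, hconst a ⟨le_rfl, hat⟩, hconst⟩
    by_contra h
    obtain ⟨j, h3, h4⟩ := (hY_ne a).mp h
    have i1 : (k : ℝ) < j := by
      by_contra! hle
      nlinarith
    have i2 : (k : ℝ) + 1 ≤ j := by exact_mod_cast i1
    nlinarith
  · exact hd
  · exact hd_mem
  · intro k
    by_contra h
    obtain ⟨j, h1, h2⟩ := (hY_ne _).mp h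
    exact hgd k (hg_tooth j _ (by linarith) (by linarith))
  · exact hXsymm
  · intro k t ht h
    rcases le_total t (1 / 2) with h' | h'
    · exact Or.inl (hinj k t ⟨ht.1, h'⟩ h)
    · refine Or.inr ?_
      have := hinj k (1 - t) ⟨by linarith [ht.2], by linarith⟩ (by rw [hXsymm, h])
      linarith
  · exact fun k => hlt k _ ⟨(hd_mem _).1.le, (hd_mem _).2.le⟩ (hd (Nat.lt_succ_self k))
  · intro k t ht
    have ht' : t ∈ Icc (0 : ℝ) (1 / 2) :=
      ⟨((hd_mem _).1.trans ht.1).le, (ht.2.trans (hd_mem k).2).le⟩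
    exact ⟨hgt _ t ht' ht.1, hlt _ t ht' ht.2⟩
  · intro k
    have hk : (0 : ℝ) ≤ k := Nat.cast_nonneg k
    -- This is `1/(2k + 7/2)`, a time inside the `k`-th tooth.
    refine ⟨2 / (4 * (k : ℝ) + 7), ⟨?_, ?_⟩, (hY_ne _).mpr ⟨k, ?_, ?_⟩⟩
    · simp only [d]
      push_cast
      exact div_lt_div_of_pos_left two_pos (by positivity) (by linarith)
    · exact div_lt_div_of_pos_left two_pos (by positivity) (by linarith)
    · rw [mul_div_assoc', one_lt_div (by positivity)]; linarith
    · rw [mul_div_assoc', div_lt_one (by positivity)]; linarith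

end Comb

/-! ### Loops and homotopies in an embedded square. -/

section PlaneLoops

variable {n : ℕ} {M : Type*} [TopologicalSpace M] [ChartedSpace (EuclideanSpace ℝ (Fin n)) M]

/-- A smoothly embedded square at a point of a manifold of dimension at least two. -/
theorem exists_square [IsManifold (𝓡 n) ∞ M] (hn : 2 ≤ n) (p : M) :
    ∃ (Γ : ℝ × ℝ → M) (u v : M → ℝ), Γ (0, 0) = p ∧
      ContMDiffOn 𝓘(ℝ, ℝ × ℝ) (𝓡 n) ∞ Γ (Icc 0 1 ×ˢ Icc 0 1) ∧
      ∀ w ∈ Icc (0 : ℝ) 1 ×ˢ Icc (0 : ℝ) 1, u (Γ w) = w.1 ∧ v (Γ w) = w.2 := by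
  set e := extChartAt (𝓡 n) p with he
  have hnhds : e.target ∈ nhds (e p) := extChartAt_target_mem_nhds p
  obtain ⟨R, hR, hball⟩ := Metric.mem_nhds_iff.mp hnhds
  let i₀ : Fin n := ⟨0, by omega⟩
  let i₁ : Fin n := ⟨1, by omega⟩
  have hi : i₀ ≠ i₁ := by simp [i₀, i₁]
  let v₀ : EuclideanSpace ℝ (Fin n) := EuclideanSpace.single i₀ 1
  let v₁ : EuclideanSpace ℝ (Fin n) := EuclideanSpace.single i₁ 1
  -- Two orthogonal steps of length at most `R / 3` stay within the ball of radius `R` in the chart.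
  have hρ : 0 < R / 3 := by linarith
  let L : ℝ × ℝ → EuclideanSpace ℝ (Fin n) := fun w =>
    e p + ((R / 3 * w.1) • v₀ + (R / 3 * w.2) • v₁)
  have hL : ContDiff ℝ ∞ L := by fun_prop
  have hmem : ∀ w ∈ Icc (0 : ℝ) 1 ×ˢ Icc (0 : ℝ) 1, L w ∈ e.target := by
    intro w hw
    refine hball ?_
    rw [Metric.mem_ball, dist_eq_norm]
    have h1 : L w - e p = (R / 3 * w.1) • v₀ + (R / 3 * w.2) • v₁ := by
      simp only [L]; abel
    have h2 : ‖v₀‖ = 1 := by simp [v₀]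
    have h3 : ‖v₁‖ = 1 := by simp [v₁]
    have h4 : ‖(R / 3 * w.1) • v₀‖ ≤ R / 3 := by
      rw [norm_smul, h2, mul_one, Real.norm_eq_abs, abs_of_nonneg (mul_nonneg hρ.le hw.1.1)]
      nlinarith [hw.1.2]
    have h5 : ‖(R / 3 * w.2) • v₁‖ ≤ R / 3 := by
      rw [norm_smul, h3, mul_one, Real.norm_eq_abs, abs_of_nonneg (mul_nonneg hρ.le hw.2.1)]
      nlinarith [hw.2.2]
    change ‖L w - e p‖ < R
    rw [h1]
    linarith [norm_add_le ((R / 3 * w.1) • v₀) ((R / 3 * w.2) • v₁)]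
  refine ⟨fun w => e.symm (L w), fun m => (e m - e p) i₀ / (R / 3),
    fun m => (e m - e p) i₁ / (R / 3), ?_, ?_, fun w hw => ?_⟩
  · simp [L, he]
  · exact (contMDiffOn_extChartAt_symm p).comp hL.contMDiff.contMDiffOn hmem
  · have h1 : e (e.symm (L w)) = L w := e.right_inv (hmem w hw)
    have h2 : L w - e p = (R / 3 * w.1) • v₀ + (R / 3 * w.2) • v₁ := by
      simp only [L]; abel
    simp only [h1, h2]
    constructor
    · simp [v₀, v₁, hi]
      field_simp
    · simp [v₀, v₁, hi.symm]
      field_simp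

variable {p : M} {Γ : ℝ × ℝ → M}

/-- The loop in an embedded square with the given coordinates. -/
noncomputable def squareLoop (hΓ : ContMDiffOn 𝓘(ℝ, ℝ × ℝ) (𝓡 n) ∞ Γ (Icc 0 1 ×ˢ Icc 0 1))
    (hp : Γ (0, 0) = p) (w : ℝ → ℝ × ℝ) (hw : ContDiff ℝ ∞ w) (h0 : w 0 = (0, 0))
    (h1 : w 1 = (0, 0)) (hmem : ∀ t ∈ I, w t ∈ Icc (0 : ℝ) 1 ×ˢ Icc (0 : ℝ) 1) : PSLoop n p :=
  ⟨{  toFun := fun t : I => Γ (w t)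
      continuous_toFun := hΓ.continuousOn.comp_continuous
        (hw.continuous.comp continuous_subtype_val) (fun t => hmem t t.2)
      source' := by simp [h0, hp]
      target' := by simp [h1, hp] }, by
    refine ⟨∅, fun a b ha hab hb _ => ?_⟩
    refine (hΓ.comp hw.contMDiff.contMDiffOn
      (fun t ht => hmem t ⟨ha.trans ht.1, ht.2.trans hb⟩)).congr fun t ht => ?_
    rw [Path.extend_apply _ ⟨ha.trans ht.1, ht.2.trans hb⟩]
    rfl⟩

theorem thinHomotopic_of_square
    (hΓ : ContMDiffOn 𝓘(ℝ, ℝ × ℝ) (𝓡 n) ∞ Γ (Icc 0 1 ×ˢ Icc 0 1)) (hp : Γ (0, 0) = p)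
    {γ₀ γ₁ : PSLoop n p} (W : ℝ × ℝ → ℝ × ℝ) (hW : ContDiff ℝ ∞ W)
    (hmem : ∀ s ∈ I, ∀ t ∈ I, W (s, t) ∈ Icc (0 : ℝ) 1 ×ˢ Icc (0 : ℝ) 1)
    (hs₀ : ∀ s, W (s, 0) = (0, 0)) (hs₁ : ∀ s, W (s, 1) = (0, 0))
    (h₀ : ∀ t : I, γ₀.1 t = Γ (W (0, t))) (h₁ : ∀ t : I, γ₁.1 t = Γ (W (1, t)))
    (hr : ∀ s ∈ I, ∀ t ∈ I, ∃ t' ∈ I, W (s, t) = W (0, t')) : ThinHomotopic γ₀ γ₁ := by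
  let η : Path.Homotopy γ₀.1 γ₁.1 :=
    { toFun := fun z => Γ (W (z.1, z.2))
      continuous_toFun := hΓ.continuousOn.comp_continuous
        (hW.continuous.comp (by fun_prop)) (fun z => hmem _ z.1.2 _ z.2.2)
      map_zero_left := fun t => (h₀ t).symm
      map_one_left := fun t => (h₁ t).symm
      prop' := fun s t ht => by
        rcases ht with rfl | rfl
        · refine Eq.trans ?_ γ₀.1.source.symm
          simp [hs₀, hp]
        · refine Eq.trans ?_ γ₀.1.target.symm
          simp [hs₁, hp] }
  refine thinHomotopic_of_isPaved (isPaved_of_strips η ∅ (fun z => Γ (W z)) (fun _ _ => rfl)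
    fun a b ha hab hb _ => ?_) ?_
  · exact hΓ.comp hW.contMDiff.contMDiffOn fun z hz =>
      hmem _ hz.1 _ ⟨ha.trans hz.2.1, hz.2.2.trans hb⟩
  · rintro _ ⟨z, rfl⟩
    obtain ⟨t', ht', h⟩ := hr _ z.1.2 _ z.2.2
    refine Or.inl ⟨⟨t', ht'⟩, ?_⟩
    rw [h₀]
    change Γ (W (0, t')) = Γ (W (z.1, z.2))
    rw [h]

end PlaneLoops

/-! ### The comb loop is thinly trivial but not retrace trivial. -/

section CombLoop

variable {n : ℕ} {M : Type*} [TopologicalSpace M] [ChartedSpace (EuclideanSpace ℝ (Fin n)) M]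
  {p : M} {Γ : ℝ × ℝ → M} {X Y : ℝ → ℝ} {d : ℕ → ℝ}

/-- The comb-shaped loop in an embedded square. -/
noncomputable def combLoop (hΓ : ContMDiffOn 𝓘(ℝ, ℝ × ℝ) (𝓡 n) ∞ Γ (Icc 0 1 ×ˢ Icc 0 1))
    (hp : Γ (0, 0) = p) (hc : IsComb X Y d) : PSLoop n p :=
  squareLoop hΓ hp (fun t => (X t, Y t)) (hc.contDiff_fst.prodMk hc.contDiff_snd)
    (by rw [hc.fst_zero, hc.snd_zero]) (by rw [hc.fst_one, hc.snd_eq_zero 1 (by norm_num)])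
    (fun t ht => ⟨hc.fst_mem t ht, hc.snd_mem t⟩)

/-- All teeth are lowered simultaneously, then the base interval is shrunk to `p`. Both stages stay
in the image of their initial loop by the intermediate value theorem. -/
theorem combLoop_thin (hΓ : ContMDiffOn 𝓘(ℝ, ℝ × ℝ) (𝓡 n) ∞ Γ (Icc 0 1 ×ˢ Icc 0 1))
    (hp : Γ (0, 0) = p) (hc : IsComb X Y d) :
    (thinSetoid n p).r (combLoop hΓ hp hc) (PSLoop.const n p) := by
  have hX : ContDiff ℝ ∞ X := hc.contDiff_fst
  have hY : ContDiff ℝ ∞ Y := hc.contDiff_snd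
  have m0 : (0 : ℝ) ∈ Icc (0 : ℝ) 1 := ⟨le_rfl, zero_le_one⟩
  have hsc : ∀ s ∈ I, ∀ a ∈ Icc (0 : ℝ) 1, (1 - s) * a ∈ Icc (0 : ℝ) 1 := fun s hs a ha =>
    ⟨mul_nonneg (by linarith [hs.2]) ha.1,
      mul_le_one₀ (by linarith [hs.1]) ha.1 ha.2⟩
  let δ : PSLoop n p := squareLoop hΓ hp (fun t => (X t, 0)) (hX.prodMk contDiff_const)
    (by rw [hc.fst_zero]) (by rw [hc.fst_one]) (fun t ht => ⟨hc.fst_mem t ht, m0⟩)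
  have e1 : ThinHomotopic (combLoop hΓ hp hc) δ := by
    refine thinHomotopic_of_square hΓ hp (fun z => (X z.2, (1 - z.1) * Y z.2)) (by fun_prop)
      (fun s hs t ht => ⟨hc.fst_mem t ht, hsc s hs _ (hc.snd_mem t)⟩) (fun s => ?_) (fun s => ?_)
      (fun t => ?_) (fun t => ?_) (fun s hs t ht => ?_)
    · simp [hc.fst_zero, hc.snd_zero]
    · simp [hc.fst_one, hc.snd_eq_zero 1 (by norm_num)]
    · simp [combLoop, squareLoop]
    · simp [δ, squareLoop]
    · by_cases hYt : Y t = 0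
      · exact ⟨t, ht, by simp [hYt]⟩
      -- The lowered point lies on the same tooth and was passed on the way up, between the start
      -- `a` of the tooth and `t`, while `X` was constant.
      · obtain ⟨a, ha, hYa, -, hconst⟩ := hc.fst_const t ht hYt
        have hm := hc.snd_mem t
        obtain ⟨x, hx, hYx⟩ := intermediate_value_Icc ha.2 hY.continuous.continuousOn
          (⟨by rw [hYa]; exact (hsc s hs _ hm).1, by nlinarith [hs.1, hm.1]⟩ :
            (1 - s) * Y t ∈ Icc (Y a) (Y t))
        exact ⟨x, ⟨ha.1.trans hx.1, hx.2.trans ht.2⟩, by simp [hconst x hx, hYx]⟩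
  have e2 : ThinHomotopic δ (PSLoop.const n p) := by
    refine thinHomotopic_of_square hΓ hp (fun z => ((1 - z.1) * X z.2, 0)) (by fun_prop)
      (fun s hs t ht => ⟨hsc s hs _ (hc.fst_mem t ht), m0⟩) (fun s => ?_) (fun s => ?_)
      (fun t => ?_) (fun t => ?_) (fun s hs t ht => ?_)
    · simp [hc.fst_zero]
    · simp [hc.fst_one]
    · simp [δ, squareLoop]
    · simp [PSLoop.const, hp]
    · have hm := hc.fst_mem t ht
      obtain ⟨x, hx, hXx⟩ := intermediate_value_Icc ht.1 hX.continuous.continuousOn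
        (⟨by rw [hc.fst_zero]; exact (hsc s hs _ hm).1, by nlinarith [hs.1, hm.1]⟩ :
          (1 - s) * X t ∈ Icc (X 0) (X t))
      exact ⟨x, ⟨hx.1, hx.2.trans ht.2⟩, by simp [hXx]⟩
  exact (thin_of_homotopic e1).trans _ _ _ (thin_of_homotopic e2)

/-- The `k`-th strip `B k` contains the `k`-th tooth. Requiring a nonzero height on the way counts
the outward passage and ignores the return, which would otherwise cancel it modulo two. -/
theorem combLoop_not_retrace [T1Space M]
    (hΓ : ContMDiffOn 𝓘(ℝ, ℝ × ℝ) (𝓡 n) ∞ Γ (Icc 0 1 ×ˢ Icc 0 1)) (hp : Γ (0, 0) = p)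
    {u v : M → ℝ}
    (huv : ∀ w ∈ Icc (0 : ℝ) 1 ×ˢ Icc (0 : ℝ) 1, u (Γ w) = w.1 ∧ v (Γ w) = w.2)
    (hc : IsComb X Y d) : ¬ (retraceSetoid n p).r (combLoop hΓ hp hc) (PSLoop.const n p) := by
  intro h
  let B : ℕ → Set M := fun k => {m | u m ∈ Ioo (X (d (k + 1))) (X (d k))}
  let q : ℕ → M := fun k => Γ (X (d k), 0)
  have hdI : ∀ k, d k ∈ Icc (0 : ℝ) 1 := fun k =>
    ⟨(hc.d_mem k).1.le, by linarith [(hc.d_mem k).2]⟩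
  have m0 : (0 : ℝ) ∈ Icc (0 : ℝ) 1 := ⟨le_rfl, zero_le_one⟩
  have hanti : StrictAnti fun k => X (d k) := strictAnti_nat_of_succ_lt hc.fst_lt
  have huq : ∀ k, u (q k) = X (d k) := fun k => (huv _ ⟨hc.fst_mem _ (hdI k), m0⟩).1
  have hB : Pairwise fun i j => Disjoint (B i) (B j) := by
    have key : ∀ i j, i < j → Disjoint (B i) (B j) := fun i j hij => by
      rw [Set.disjoint_left]
      intro m hm hm'
      have : X (d j) ≤ X (d (i + 1)) := hanti.antitone hij
      linarith [hm.1, hm'.2]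
    intro i j hij
    rcases lt_or_gt_of_ne hij with h | h
    · exact key i j h
    · exact (key j i h).symm
  have hl : ∀ k, q (k + 1) ∉ B k := fun k hk => by
    simp only [B, mem_ofPred_eq, huq] at hk
    exact lt_irrefl _ hk.1
  have hr : ∀ k, q k ∉ B k := fun k hk => by
    simp only [B, mem_ofPred_eq, huq] at hk
    exact lt_irrefl _ hk.2
  have hlr : ∀ k, q (k + 1) ≠ q k := fun k hk => by
    have := huq (k + 1)
    rw [hk, huq] at this
    exact (hc.fst_lt k).ne' this
  have hval : ∀ t ∈ Icc (0 : ℝ) 1, (combLoop hΓ hp hc).1.extend t = Γ (X t, Y t) := fun t ht => by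
    rw [Path.extend_apply _ ht]; rfl
  have hu : ∀ t ∈ Icc (0 : ℝ) 1, u (Γ (X t, Y t)) = X t := fun t ht =>
    (huv _ ⟨hc.fst_mem t ht, hc.snd_mem t⟩).1
  have hv : ∀ t ∈ Icc (0 : ℝ) 1, v (Γ (X t, Y t)) = Y t := fun t ht =>
    (huv _ ⟨hc.fst_mem t ht, hc.snd_mem t⟩).2
  have hone : ∀ k, pathParity (B k) {m | v m ≠ 0} (q (k + 1)) (q k) (combLoop hΓ hp hc).1 = 1 := by
    intro k
    have hkk : d (k + 1) < d k := hc.strictAnti (Nat.lt_succ_self k)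
    have hX : ∀ t ∈ Icc (0 : ℝ) 1, ∀ j, (combLoop hΓ hp hc).1.extend t = q j →
        t = d j ∨ t = 1 - d j := fun t ht j h => by
      refine hc.fst_inj j t ht ?_
      rw [← hu t ht, ← hval t ht, h, huq]
    -- The end points of a passage can only be `d k`, `d (k + 1)` or their mirror images. A nonzero
    -- height forces a time before `1/2`, and `d k` and `1 - d k` cannot lie inside, which leaves
    -- only the outward passage.
    have hset : crossings (B k) {m | v m ≠ 0} (q (k + 1)) (q k) (combLoop hΓ hp hc).1.extend 0 1 =
        {(d (k + 1), d k)} := by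
      have h0 := hc.d_mem k
      have h1 := hc.d_mem (k + 1)
      ext w
      constructor
      · rintro ⟨i1, i2, i3, i4, i5, t, ht, htQ⟩
        have hsub : ∀ t ∈ Ioo w.1 w.2, t ∈ Icc (0 : ℝ) 1 := fun t ht =>
          ⟨i1.trans ht.1.le, ht.2.le.trans i3⟩
        have hav : ∀ t ∈ Ioo w.1 w.2, X t ∈ Ioo (X (d (k + 1))) (X (d k)) := fun t ht => by
          have := i5 t ht
          rw [hval t (hsub t ht)] at this
          simp only [B, mem_ofPred_eq] at this
          rwa [hu t (hsub t ht)] at this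
        have n1 : d k ∉ Ioo w.1 w.2 := fun h => lt_irrefl _ (hav _ h).2
        have n2 : 1 - d k ∉ Ioo w.1 w.2 := fun h => by
          have := (hav _ h).2
          rw [hc.fst_symm] at this
          exact lt_irrefl _ this
        have ht2 : t < 1 / 2 := by
          by_contra! h
          rw [hval t (hsub t ht)] at htQ
          simp only [mem_ofPred_eq] at htQ
          rw [hv t (hsub t ht)] at htQ
          exact htQ (hc.snd_eq_zero t h)
        obtain ⟨h0a, h0b⟩ := h0
        obtain ⟨h1a, h1b⟩ := h1
        have m1 : w.1 ∈ Icc (0 : ℝ) 1 := ⟨i1, i2.le.trans i3⟩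
        have m2 : w.2 ∈ Icc (0 : ℝ) 1 := ⟨i1.trans i2.le, i3⟩
        rcases i4 with ⟨j1, j2⟩ | ⟨j1, j2⟩
        · rcases hX _ m1 _ j1 with e1 | e1 <;> rcases hX _ m2 _ j2 with e2 | e2
          · exact Prod.ext e1 e2
          · exact absurd ⟨by linarith, by linarith⟩ n1
          · linarith
          · linarith
        · rcases hX _ m1 _ j1 with e1 | e1 <;> rcases hX _ m2 _ j2 with e2 | e2
          · linarith
          · exact absurd ⟨by linarith, by linarith⟩ n2
          · linarith
          · linarith [ht.1]
      · rintro rfl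
        obtain ⟨t, ht, hYt⟩ := hc.exists_snd_ne k
        have hsub : ∀ t ∈ Ioo (d (k + 1)) (d k), t ∈ Icc (0 : ℝ) 1 := fun t ht =>
          ⟨h1.1.le.trans ht.1.le, ht.2.le.trans (hdI k).2⟩
        refine ⟨h1.1.le, hkk, (hdI k).2, Or.inl ⟨?_, ?_⟩, fun t ht => ?_, t, ht, ?_⟩
        · rw [hval _ (hdI _), hc.snd_d]
        · rw [hval _ (hdI _), hc.snd_d]
        · rw [hval t (hsub t ht)]
          simp only [B, mem_ofPred_eq]
          rw [hu t (hsub t ht)]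
          exact hc.fst_between k t ht
        · rw [hval t (hsub t ht)]
          simp only [mem_ofPred_eq]
          rwa [hv t (hsub t ht)]
    rw [pathParity, crossingParity, hset, Set.ncard_singleton, Nat.cast_one]
  have hev := eventually_pathParity_eq (Q := fun _ => {m | v m ≠ 0}) hB hl hr hlr h
  obtain ⟨k, hk⟩ := hev.exists
  rw [hone k] at hk
  have hz : pathParity (B k) {m | v m ≠ 0} (q (k + 1)) (q k) (PSLoop.const n p).1 = 0 :=
    pathParity_refl (hlr k)
  rw [hz] at hk
  exact one_ne_zero hk

/-- In dimension at least two there is a thinly trivial loop that cannot be retraced to the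
constant loop. -/
theorem exists_thin_not_retrace [T1Space M] [IsManifold (𝓡 n) ∞ M] (hn : 2 ≤ n) (p : M) :
    ∃ c : PSLoop n p, (thinSetoid n p).r c (PSLoop.const n p) ∧
      ¬ (retraceSetoid n p).r c (PSLoop.const n p) := by
  obtain ⟨Γ, u, v, hp, hΓ, huv⟩ := exists_square hn p
  obtain ⟨X, Y, d, hc⟩ := exists_isComb
  exact ⟨combLoop hΓ hp hc, combLoop_thin hΓ hp hc, combLoop_not_retrace hΓ hp huv hc⟩

end CombLoop

end ThinLoops

/-! ### The main theorem. -/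

theorem mainTheorem4 (n : ℕ) (hn : 2 ≤ n) (M : Type*) [TopologicalSpace M] [T2Space M]
    [ChartedSpace (EuclideanSpace ℝ (Fin n)) M] [IsManifold (𝓡 n) ∞ M] (p : M) :
    (∀ γ : PSLoop n p, ∃ γ' : PSLoop n p,
      (thinSetoid n p).r γ γ' ∧ ¬ (retraceSetoid n p).r γ γ') ∧
    (∀ γ : PSLoop n p,
      {γ' : PSLoop n p | (retraceSetoid n p).r γ γ'} ⊂
        {γ' : PSLoop n p | (thinSetoid n p).r γ γ'}) ∧
    (∃ (_ : Group (LRet n p)) (_ : Group (LThin n p)) (Φ : LRet n p →* LThin n p),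
      (∀ γ γ' : PSLoop n p, retraceClass γ' * retraceClass γ = retraceClass (γ.trans γ')) ∧
      (∀ γ : PSLoop n p, (retraceClass γ)⁻¹ = retraceClass γ.symm) ∧
      (∀ γ γ' : PSLoop n p, thinClass γ' * thinClass γ = thinClass (γ.trans γ')) ∧
      (∀ γ : PSLoop n p, (thinClass γ)⁻¹ = thinClass γ.symm) ∧
      (∀ γ : PSLoop n p, Φ (retraceClass γ) = thinClass γ) ∧
      Function.Surjective Φ ∧ ¬ Function.Injective Φ) := by
  obtain ⟨c, hthin, hret⟩ := exists_thin_not_retrace hn p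
  have hT : IsLoopCongruence (thinSetoid n p) := isLoopCongruence_thin
  have hR : IsLoopCongruence (retraceSetoid n p) := isLoopCongruence_retrace
  have part1 : ∀ γ : PSLoop n p, ∃ γ' : PSLoop n p,
      (thinSetoid n p).r γ γ' ∧ ¬ (retraceSetoid n p).r γ γ' := by
    intro γ
    refine ⟨γ.trans c, ?_, fun h => hret ?_⟩
    · exact (hT.of_reparam (Reparam.trans_refl γ.1)).trans _ _ _
        ((hT.trans_left hthin γ).symm _ _)
    · let := hR.group
      have h1 : retraceClass c * retraceClass γ = retraceClass γ :=
        (Quotient.sound h : retraceClass γ = retraceClass (γ.trans c)).symm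
      -- Cancelling the class of `γ` in the retrace group would make `c` retrace trivial.
      exact Quotient.exact (mul_eq_right.mp h1)
  refine ⟨part1, fun γ => ⟨fun γ' h => thin_of_retrace h, fun h => ?_⟩, ?_⟩
  · obtain ⟨γ', h1, h2⟩ := part1 γ
    exact h2 (h h1)
  · let iR := hR.group
    let iT := hT.group
    let Φ : LRet n p →* LThin n p :=
      { toFun := Quotient.map id fun _ _ h => thin_of_retrace h
        map_one' := rfl
        map_mul' := by
          rintro ⟨a⟩ ⟨b⟩
          rfl }
    refine ⟨iR, iT, Φ, fun _ _ => rfl, fun _ => rfl, fun _ _ => rfl, fun _ => rfl, fun _ => rfl,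
      ?_, fun hinj => ?_⟩
    · rintro ⟨γ⟩
      exact ⟨retraceClass γ, rfl⟩
    · have h1 : Φ (retraceClass c) = Φ (retraceClass (PSLoop.const n p)) := Quotient.sound hthin
      exact hret (Quotient.exact (hinj h1))
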